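/- Theorem. Let $N\ge 4$, let $$\Lambda(x,y,v_1,\dots,v_N)=\frac{x^{N-1}}{N-1}+xy^2+\sum_{k=1}^{N-1}v_kx^{k-1}+v_Ny$$ be the universal unfolding of the $D_N$-singularity, and let $\widehat{\mathcal A}=\mathbb C[x,y,v_1,\dots,v_N]/(\partial_x\Lambda,\partial_y\Lambda)$. The classes $[1],[x],\dots,[x^{N-2}],[y]$ form a basis of $\widehat{\mathcal A}$ over $\mathbb C[v_1,\dots,v_N]$; sending $\partial/\partial v_1,\dots,\partial/\partial v_N$ to them defines a multiplication on the tangent spaces of $\mathbb C^N$, with structure constants $(c_v)^k_{ij}$. With the metric $\eta(\partial/\partial v_i,\partial/\partial v_j)=(c_v)^{N-1}_{ij}$ this is a Frobenius manifold structure on $\mathbb C^N$ (the $D_N$ Saito Frobenius manifold), with global flat coordinates $t^\alpha=v_\alpha+O(v^2)$ such that $\partial/\partial t^1$ is the unit, given by $t^N=v_N$ and, for $1\le\gamma\le N-1$, $$t^\gamma=\sum_{\substack{\alpha_1,\dots,\alpha_{N-1}\ge0\\ \sum(N-i)\alpha_i=N-\gamma}}\Bigl(-\tfrac12\Bigr)^{\sum\alpha_i-1}\prod_{k=0}^{\sum\alpha_i-2}\bigl(2\gamma-1+2k(N-1)\bigr)\frac{\prod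 v_i^{\alpha_i}}{\prod\alpha_i!}.$$ These form a polynomial automorphism of $\mathbb C^N$; let $v_i=v_i(t^1,\dots,t^N)$ be the inverse polynomial map. Let $(\eta_{\alpha\beta})$ be the constant, non-degenerate matrix of $\eta$ in the coordinates $t^\alpha$ and $(\eta^{\alpha\beta})$ its inverse. There is a potential $F_{D_N}\in\mathbb C[t^1,\dots,t^N]$ of this Frobenius manifold without monomials of degree less than $3$: $\partial_{t^1}\partial_{t^\alpha}\partial_{t^\beta}F_{D_N}=\eta_{\alpha\beta}$, and $\bigl(\eta^{1\mu}\frac{\partial F_{D_N}}{\partial t^\mu},\dots,\eta^{N\mu}\frac{\partial F_{D_N}}{\partial t^\mu}\bigr)$ is its vector potential. On $M^{\rm ext}=\mathbb C^N\times\mathbb C^*$ with coordinates $v_1,\dots,v_{N+1}$, the classes $[1],[x],\dots,[x^{N-2}],[y],[w]$ form a basis over $\mathbb C[v_1,\dots,v_N,v_{N+1}^{\pm1}]$ of $$\mathbb C[x,y,w,v_1,\dots,v_N,v_{N+1}^{\pm1}]\big/\bigl(w-v_{N+1}\partial_x\Lambda,\ \partial_y\Lambda,\ 2wx-v_{N+1}^2w\bigr);$$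 sending $\partial/\partial v_1,\dots,\partial/\partial v_{N+1}$ to them defines a multiplication on the tangent spaces of $M^{\rm ext}$. Then: 1. The coordinates $t^1(v_1,\dots,v_N),\dots,t^N(v_1,\dots,v_N)$ and $t^{N+1}=v_{N+1}$ together with this multiplication define a flat F-manifold structure on $M^{\rm ext}$: the connection $\nabla$ with flat coordinates $t^1,\dots,t^{N+1}$ is such that $\nabla+z\,\circ$ is flat and torsion-free for all $z\in\mathbb C$, and the unit field is $\partial/\partial t^1$, which is $\nabla$-parallel. 2. The vector potential of this flat F-manifold (functions $F^1,\dots,F^{N+1}$ of $t^1,\dots,t^{N+1}$ whose second derivatives $\partial^2F^\alpha/\partial t^\beta\partial t^\gamma$ are the structure constants of the multiplication in the coordinates $t$) is $$\Bigl(\eta^{1\mu}\frac{\partial F_{D_N}}{\partial t^\mu},\dots,\eta^{N\mu}\frac{\partial F_{D_N}}{\partial t^\mu},\,F^o_{D_N}\Bigr),$$ where, with $s=t^{N+1}$, $$F^o_{D_N}=\sum_{k=1}^{N-1}\frac{v_k(t)\,s^{2k-1}}{2^{k-1}(2k-1)}+\frac{s^{2N-1}}{2^{N-2}(2N-1)(2N-2)}+\frac{v_N(t)^2}{2s}.$$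 In particular its first $N$ components do not depend on $s$ and form the vector potential of the Saito Frobenius manifold, which is thereby extended, and $F^o_{D_N}$ is a Laurent polynomial in $s$ over $\mathbb C[t^1,\dots,t^N]$ with a simple pole at $s=0$, the coefficient of $s^{-1}$ being $(t^N)^2/2$. -/

import Mathlib

noncomputable section

namespace DSaito

/-! ### Flat F-manifolds and Frobenius manifolds on open subsets of `ℂⁿ`

Tensors on an open set `M ⊆ ℂⁿ` are given by their components in the standard coordinates
`v_1, …, v_n`. Indices `1, …, n` are represented by `Fin n`, so the index `1` is `0 : Fin n`.
Components carrying an upper index have it first: `c k i j` stands for `c^k_{ij}`. -/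

/-- The partial derivative `∂f/∂v_i` at `p`. -/
def pd {n : ℕ} (i : Fin n) (f : (Fin n → ℂ) → ℂ) (p : Fin n → ℂ) : ℂ :=
  fderiv ℂ f p (Pi.single i 1)

/-- `∇_{∂_i} ∂_j = ∑_k Γ^k_{ij} ∂_k`, torsion-free at every point of `M`. -/
def IsTorsionFree {n : ℕ} (M : Set (Fin n → ℂ))
    (Γ : Fin n → Fin n → Fin n → (Fin n → ℂ) → ℂ) : Prop :=
  ∀ p ∈ M, ∀ k i j, Γ k i j p = Γ k j i p

/-- Vanishing on `M` of the curvature of the connection `∇_{∂_i} ∂_j = ∑_k Γ^k_{ij} ∂_k`. -/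
def IsFlatConnection {n : ℕ} (M : Set (Fin n → ℂ))
    (Γ : Fin n → Fin n → Fin n → (Fin n → ℂ) → ℂ) : Prop :=
  ∀ p ∈ M, ∀ l i j k,
    pd i (Γ l j k) p - pd j (Γ l i k) p
      + ∑ m, (Γ l i m p * Γ m j k p - Γ l j m p * Γ m i k p) = 0

/-- `(M, ∇, ∘)` is a flat F-manifold with unit field `e = ∑_k e^k ∂_k`, where
`∇_{∂_i} ∂_j = ∑_k Γ^k_{ij} ∂_k` and `∂_i ∘ ∂_j = ∑_k c^k_{ij} ∂_k`. -/
structure IsFlatFManifold {n : ℕ} (M : Set (Fin n → ℂ))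
    (Γ c : Fin n → Fin n → Fin n → (Fin n → ℂ) → ℂ) (e : Fin n → (Fin n → ℂ) → ℂ) : Prop where
  isOpen : IsOpen M
  analytic_connection : ∀ k i j, AnalyticOnNhd ℂ (Γ k i j) M
  analytic_mul : ∀ k i j, AnalyticOnNhd ℂ (c k i j) M
  analytic_unit : ∀ k, AnalyticOnNhd ℂ (e k) M
  mul_assoc : ∀ p ∈ M, ∀ l i j k, ∑ m, c m i j p * c l m k p = ∑ m, c m j k p * c l i m p
  unit_mul : ∀ p ∈ M, ∀ k j, ∑ i, e i p * c k i j p = if k = j then 1 else 0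
  mul_unit : ∀ p ∈ M, ∀ k i, ∑ j, e j p * c k i j p = if k = i then 1 else 0
  torsionFree : ∀ z : ℂ, IsTorsionFree M fun k i j p => Γ k i j p + z * c k i j p
  flat : ∀ z : ℂ, IsFlatConnection M fun k i j p => Γ k i j p + z * c k i j p
  unit_parallel : ∀ p ∈ M, ∀ k i, pd i (e k) p + ∑ j, Γ k i j p * e j p = 0

/-- A Frobenius manifold: a flat F-manifold with a parallel, invariant, symmetric and
non-degenerate analytic bilinear form `η`. -/
structure IsFrobeniusManifold {n : ℕ} (M : Set (Fin n → ℂ))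
    (Γ c : Fin n → Fin n → Fin n → (Fin n → ℂ) → ℂ) (e : Fin n → (Fin n → ℂ) → ℂ)
    (η : Fin n → Fin n → (Fin n → ℂ) → ℂ) : Prop
    extends IsFlatFManifold M Γ c e where
  analytic_metric : ∀ i j, AnalyticOnNhd ℂ (η i j) M
  symm : ∀ p ∈ M, ∀ i j, η i j p = η j i p
  nondegenerate : ∀ p ∈ M, (Matrix.of fun i j => η i j p).det ≠ 0
  parallel : ∀ p ∈ M, ∀ k i j,
    pd k (η i j) p = ∑ m, (Γ m k i p * η m j p + Γ m k j p * η i m p)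
  invariant : ∀ p ∈ M, ∀ i j k, ∑ m, c m i j p * η m k p = ∑ m, c m j k p * η i m p

/-- `t^1, …, t^n` are global coordinates on `M`, flat for `∇` (that is, `∇ dt^α = 0`), and such
that `e = ∂/∂t^1`. -/
structure IsFlatCoordinates {n : ℕ} (M : Set (Fin n → ℂ))
    (Γ : Fin n → Fin n → Fin n → (Fin n → ℂ) → ℂ) (e : Fin n → (Fin n → ℂ) → ℂ)
    (t : Fin n → (Fin n → ℂ) → ℂ) : Prop where
  analytic : ∀ α, AnalyticOnNhd ℂ (t α) M
  injective : Set.InjOn (fun p α => t α p) M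
  jacobian : ∀ p ∈ M, (Matrix.of fun α i => pd i (t α) p).det ≠ 0
  flat : ∀ p ∈ M, ∀ α i j, pd i (pd j (t α)) p = ∑ k, Γ k i j p * pd k (t α) p
  unit : ∀ p ∈ M, ∀ α, ∑ k, e k p * pd k (t α) p = if α.val = 0 then 1 else 0

/-- The coordinates `t` together with the multiplication `c` define a flat F-manifold structure
on `M`. The connection is the one with flat coordinates `t`. -/
def DefinesFlatFManifold {n : ℕ} (M : Set (Fin n → ℂ))
    (c : Fin n → Fin n → Fin n → (Fin n → ℂ) → ℂ) (t : Fin n → (Fin n → ℂ) → ℂ) : Prop :=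
  ∃ Γ e, IsFlatFManifold M Γ c e ∧ IsFlatCoordinates M Γ e t

/-- The form `η` together with the multiplication `c` defines a Frobenius manifold structure on
`M` with flat coordinates `t`. -/
def DefinesFrobeniusManifold {n : ℕ} (M : Set (Fin n → ℂ))
    (c : Fin n → Fin n → Fin n → (Fin n → ℂ) → ℂ) (η : Fin n → Fin n → (Fin n → ℂ) → ℂ)
    (t : Fin n → (Fin n → ℂ) → ℂ) : Prop :=
  ∃ Γ e, IsFrobeniusManifold M Γ c e η ∧ IsFlatCoordinates M Γ e t

/-- `G` is the constant matrix of the bilinear form `η` in the coordinates `t`: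
`η = ∑ G_{αβ} dt^α dt^β` on `M`. -/
def IsConstantMatrixOf {n : ℕ} (M : Set (Fin n → ℂ)) (η : Fin n → Fin n → (Fin n → ℂ) → ℂ)
    (t : Fin n → (Fin n → ℂ) → ℂ) (G : Matrix (Fin n) (Fin n) ℂ) : Prop :=
  ∀ p ∈ M, ∀ i j, η i j p = ∑ α, ∑ β, G α β * pd i (t α) p * pd j (t β) p

/-- `(F^1, …, F^n)`, functions of `t^1, …, t^n`, is a vector potential in the coordinates `t` of
the multiplication `c`: the structure constants in the coordinates `t` are
`∂²F^α / ∂t^β ∂t^γ`. This is written as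
`dt^α(∂_i ∘ ∂_j) = ∑ (∂²F^α / ∂t^β ∂t^γ) dt^β(∂_i) dt^γ(∂_j)`. -/
structure IsVectorPotential {n : ℕ} (M : Set (Fin n → ℂ))
    (c : Fin n → Fin n → Fin n → (Fin n → ℂ) → ℂ) (t : Fin n → (Fin n → ℂ) → ℂ)
    (F : Fin n → (Fin n → ℂ) → ℂ) : Prop where
  analytic : ∀ α, AnalyticOnNhd ℂ (F α) ((fun p α => t α p) '' M)
  structure_constants : ∀ p ∈ M, ∀ α i j,
    ∑ k, c k i j p * pd k (t α) p =
      ∑ β, ∑ γ, pd β (pd γ (F α)) (fun δ => t δ p) * pd i (t β) p * pd j (t γ) p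

/-! ### Structure constants of an algebra with respect to a module basis -/

/-- The family `φ` is a basis of the `A`-module `R`. -/
def IsModuleBasis (A : Type*) {R ι : Type*} [CommRing A] [AddCommGroup R] [Module A R]
    (φ : ι → R) : Prop :=
  LinearIndependent A φ ∧ ⊤ ≤ Submodule.span A (Set.range φ)

open Classical in
/-- The coefficient at `φ_k` of `φ_i φ_j`, if `φ` is a basis of the `A`-algebra `R`. -/
def structureConstant (A : Type*) {R ι : Type*} [CommRing A] [CommRing R] [Algebra A R]
    (φ : ι → R) (k i j : ι) : A :=
  if h : IsModuleBasis A φ then (Module.Basis.mk h.1 h.2).repr (φ i * φ j) k else 0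

/-! ### The unfolding of the singularity `D_N` and the Saito Frobenius manifold -/

/-- The elements `1, x, …, x^{N-2}, y`. -/
def monomialD (N : ℕ) {R : Type*} [CommRing R] (x y : R) (i : Fin N) : R :=
  if i.val + 1 = N then y else x ^ i.val

/-- `Λ_{D_N} = x^{N-1}/(N-1) + x y² + ∑_{k=1}^{N-1} v_k x^{k-1} + v_N y`, as a polynomial in
variables including `x` and `y`, over a ring `S` containing the parameters `v_k`. -/
def unfoldingD (N : ℕ) {S σ : Type*} [CommRing S] [Algebra ℂ S] (x y : σ) (v : Fin N → S) :
    MvPolynomial σ S :=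
  MvPolynomial.C (algebraMap ℂ S (1 / ((N : ℂ) - 1))) * MvPolynomial.X x ^ (N - 1)
    + MvPolynomial.X x * MvPolynomial.X y ^ 2
    + ∑ i, MvPolynomial.C (v i) * monomialD N (MvPolynomial.X x) (MvPolynomial.X y) i

/-- `ℂ[v_1, …, v_N]` -/
abbrev Params (N : ℕ) : Type := MvPolynomial (Fin N) ℂ

/-- `Λ_{D_N}` as an element of `ℂ[v_1, …, v_N][x, y]`, with `x`, `y` the variables `0`, `1`. -/
def saitoUnfolding (N : ℕ) : MvPolynomial (Fin 2) (Params N) :=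
  unfoldingD N 0 1 fun i => MvPolynomial.X i

/-- `ℂ[x, y, v_1, …, v_N] / (∂_x Λ, ∂_y Λ)` -/
abbrev SaitoAlgebra (N : ℕ) : Type :=
  MvPolynomial (Fin 2) (Params N) ⧸
    Ideal.span {MvPolynomial.pderiv 0 (saitoUnfolding N), MvPolynomial.pderiv 1 (saitoUnfolding N)}

/-- The classes `[1], [x], …, [x^{N-2}], [y]`, the images of `∂/∂v_1, …, ∂/∂v_N`. -/
def saitoBasis (N : ℕ) (i : Fin N) : SaitoAlgebra N :=
  Ideal.Quotient.mk _ (monomialD N (MvPolynomial.X 0) (MvPolynomial.X 1) i)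

/-- The structure constants `(c_v)^k_{ij}` of the multiplication on the tangent spaces of `ℂ^N`. -/
def saitoMul (N : ℕ) (k i j : Fin N) (p : Fin N → ℂ) : ℂ :=
  MvPolynomial.eval p (structureConstant (Params N) (saitoBasis N) k i j)

/-- The Saito metric `η(∂/∂v_i, ∂/∂v_j) = (c_v)^{N-1}_{ij}`. -/
def saitoMetric (N : ℕ) (hN : 4 ≤ N) (i j : Fin N) (p : Fin N → ℂ) : ℂ :=
  saitoMul N ⟨N - 2, by omega⟩ i j p

/-- The tuples `(a_1, …, a_{N-1})` of non-negative integers with `∑ (N - i) a_i = N - γ`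
(all of whose entries are automatically less than `N`). -/
def flatExponents (N γ : ℕ) : Finset (Fin (N - 1) → ℕ) :=
  (Fintype.piFinset fun _ => Finset.range N).filter
    fun a => ∑ i, (N - (i.val + 1)) * a i = N - γ

/-- The Saito flat coordinates of `D_N` as polynomials in `v_1, …, v_N`: `t^N = v_N`, and, for
`1 ≤ γ ≤ N - 1`,
`t^γ = ∑_a (-1/2)^{|a|-1} ∏_{k=0}^{|a|-2} (2γ-1+2k(N-1)) ∏ v_i^{a_i} / ∏ a_i!`,
the sum being over `∑ (N - i) a_i = N - γ` and `|a| = ∑ a_i`. The index `α` is `γ - 1`. -/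
def flatCoord (N : ℕ) (α : Fin N) : Params N :=
  if α.val + 1 = N then MvPolynomial.X α
  else ∑ a ∈ flatExponents N (α.val + 1),
    MvPolynomial.C
        ((-1 / 2 : ℂ) ^ (∑ i, a i - 1)
          * (∏ k ∈ Finset.range (∑ i, a i - 1),
              (2 * ((α.val : ℂ) + 1) - 1 + 2 * (k : ℂ) * ((N : ℂ) - 1)))
          / ∏ i, ((a i).factorial : ℂ))
      * ∏ i, MvPolynomial.X (Fin.castLE (Nat.sub_le N 1) i) ^ a i

/-- `t^α` as a function on `ℂ^N`. -/
def saitoCoord (N : ℕ) (α : Fin N) (p : Fin N → ℂ) : ℂ :=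
  MvPolynomial.eval p (flatCoord N α)

/-- `(η^{1μ} ∂F/∂t^μ, …, η^{Nμ} ∂F/∂t^μ)`, where `G = (η_{αβ})`. -/
def gradientPotential {N : ℕ} (G : Matrix (Fin N) (Fin N) ℂ) (F : Params N)
    (α : Fin N) (τ : Fin N → ℂ) : ℂ :=
  ∑ μ, G⁻¹ α μ * MvPolynomial.eval τ (MvPolynomial.pderiv μ F)

/-! ### The extended manifold -/

/-- `ℂ^N × ℂ^*` -/
def extManifold (N : ℕ) : Set (Fin (N + 1) → ℂ) := {p | p (Fin.last N) ≠ 0}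

/-- `ℂ[v_1, …, v_N, v_{N+1}, v_{N+1}⁻¹]` -/
abbrev ExtParams (N : ℕ) : Type :=
  Localization.Away (MvPolynomial.X (Fin.last N) : MvPolynomial (Fin (N + 1)) ℂ)

/-- `v_i` as an element of `ℂ[v_1, …, v_N, v_{N+1}, v_{N+1}⁻¹]`. -/
def extParam (N : ℕ) (i : Fin (N + 1)) : ExtParams N :=
  algebraMap (MvPolynomial (Fin (N + 1)) ℂ) (ExtParams N) (MvPolynomial.X i)

/-- The value of an element of `ℂ[v_1, …, v_N, v_{N+1}, v_{N+1}⁻¹]` at a point of `ℂ^N × ℂ^*`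
(and `0` off this set). -/
def evalExt {N : ℕ} (f : ExtParams N) (p : Fin (N + 1) → ℂ) : ℂ :=
  if h : p (Fin.last N) ≠ 0 then
    IsLocalization.Away.lift (S := ExtParams N) (MvPolynomial.X (Fin.last N))
      (g := MvPolynomial.eval p) (by rw [MvPolynomial.eval_X]; exact h.isUnit) f
  else 0

/-- `Λ_{D_N}` as a polynomial in `x`, `y`, `w` (the variables `0`, `1`, `2`). -/
def extUnfolding (N : ℕ) : MvPolynomial (Fin 3) (ExtParams N) :=
  unfoldingD N 0 1 fun i => extParam N i.castSucc

/-- `v_{N+1}` as a constant of `ℂ[v_1, …, v_N, v_{N+1}^{±1}][x, y, w]`. -/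
def extVar (N : ℕ) : MvPolynomial (Fin 3) (ExtParams N) :=
  MvPolynomial.C (extParam N (Fin.last N))

/-- `ℂ[x, y, w, v_1, …, v_N, v_{N+1}^{±1}] / (w - v_{N+1} ∂_x Λ, ∂_y Λ, 2 w x - v_{N+1}² w)` -/
abbrev ExtAlgebra (N : ℕ) : Type :=
  MvPolynomial (Fin 3) (ExtParams N) ⧸
    Ideal.span {MvPolynomial.X 2 - extVar N * MvPolynomial.pderiv 0 (extUnfolding N),
      MvPolynomial.pderiv 1 (extUnfolding N),
      2 * MvPolynomial.X 2 * MvPolynomial.X 0 - extVar N ^ 2 * MvPolynomial.X 2}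

/-- The classes `[1], [x], …, [x^{N-2}], [y], [w]`, the images of `∂/∂v_1, …, ∂/∂v_{N+1}`. -/
def extBasis (N : ℕ) : Fin (N + 1) → ExtAlgebra N :=
  Fin.snoc (fun i : Fin N =>
      Ideal.Quotient.mk _ (monomialD N (MvPolynomial.X 0) (MvPolynomial.X 1) i))
    (Ideal.Quotient.mk _ (MvPolynomial.X 2))

/-- The structure constants, in the coordinates `v_1, …, v_{N+1}`, of the multiplication on the
tangent spaces of `ℂ^N × ℂ^*`. -/
def extMul (N : ℕ) (k i j : Fin (N + 1)) (p : Fin (N + 1) → ℂ) : ℂ :=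
  evalExt (structureConstant (ExtParams N) (extBasis N) k i j) p

/-- The coordinates `t^1(v_1, …, v_N), …, t^N(v_1, …, v_N), t^{N+1} = v_{N+1}`. -/
def extCoord (N : ℕ) : Fin (N + 1) → (Fin (N + 1) → ℂ) → ℂ :=
  Fin.snoc (fun (α : Fin N) p => saitoCoord N α (Fin.init p)) (fun p => p (Fin.last N))

/-- The value at `(τ_1, …, τ_N, s)`, `s ≠ 0`, of a Laurent polynomial in `s` with coefficients in
`ℂ[t^1, …, t^N]` (and `0` for `s = 0`). -/
def evalLaurent {N : ℕ} (f : LaurentPolynomial (MvPolynomial (Fin N) ℂ))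
    (τ : Fin (N + 1) → ℂ) : ℂ :=
  if h : τ (Fin.last N) ≠ 0 then
    LaurentPolynomial.eval₂ (MvPolynomial.eval (Fin.init τ : Fin N → ℂ))
      (Units.mk0 (τ (Fin.last N)) h) f
  else 0

/-- `F^o_{D_N} = ∑_{k=1}^{N-1} v_k s^{2k-1} / (2^{k-1} (2k-1))
  + s^{2N-1} / (2^{N-2} (2N-1) (2N-2)) + v_N² / (2s)`
with polynomials `v_i = V_i(t^1, …, t^N)` substituted; `s = t^{N+1}`. -/
def openPotential (N : ℕ) (V : Fin N → Params N) : LaurentPolynomial (MvPolynomial (Fin N) ℂ) :=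
  ∑ i : Fin N,
      (if i.val + 1 = N then
        LaurentPolynomial.C (MvPolynomial.C (1 / 2 : ℂ) * V i ^ 2) * LaurentPolynomial.T (-1)
      else
        LaurentPolynomial.C (MvPolynomial.C (1 / (2 ^ i.val * (2 * (i.val : ℂ) + 1))) * V i)
          * LaurentPolynomial.T (2 * (i.val : ℤ) + 1))
    + LaurentPolynomial.C
        (MvPolynomial.C (1 / (2 ^ (N - 2) * (2 * (N : ℂ) - 1) * (2 * (N : ℂ) - 2))))
      * LaurentPolynomial.T (2 * (N : ℤ) - 1)

end DSaito

end

/-! Put n = N - 1. The equation ∂_yΛ = 0 says xy = -v_N/2, so y can be eliminated: on this curve Λ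
becomes λ(x) = x^n/n + Σ v_k x^{k-1} - v_N²/(4x), ∂λ/∂v_i is the restriction of the i-th basis
element φ_i, and λ' is the restriction of ∂_xΛ. Euclidean division by `critPoly` = x(∂_xΛ - y²)
yields φ_i φ_j = Σ c^k_{ij} φ_k + q_{ij}(x) ∂_xΛ (`monomialD_mul`). With ∂_xΛ = 0 this is the table
of the Saito algebra. With ∂_xΛ = w/s it is the table of the extended algebra: x and y act on w by
s²/2 and -v_N/s², so q_{ij}(s²/2)/s becomes the coefficient of w.

Flatness comes from residues. For γ < N, t^γ is, up to normalization, the residue at infinity of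
λ^{1-(2γ-1)/(2n)} x^{-1/2} dx. Differentiating such a residue twice in v produces φ_i φ_j; the table
applies, and the term q_{ij} λ' is integrated by parts (`hessian_residue`). The result has the form
Hess = Γ·grad + c·grad(next residue), where Γ depends on q_{ij} only and not on γ. The residue
following t^γ is constant, so t^γ is flat; the residue preceding t^γ is a component of the vector
potential. A general argument (`isFlatFManifold_of_vectorPotential`) then gives the flat F-manifold.

The entries of the metric are coefficients of 1/`critPoly` at infinity. Differentiating this series
shows that the metric is parallel (`pderiv_metric`), hence constant in the coordinates t. Invariance
makes the lowered structure constants totally symmetric, and Poincaré's lemma applied three times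
gives F.

For the extension, F^o is the primitive in s of λ(s²/2). Its mixed derivatives ∂_s∂_{v_j} are the
values of φ_j at x = s²/2, its second derivative in s is s λ'(s²/2), and in the v-directions the
covariant Hessian is q_{ij}(s²/2)/s. These are exactly the coefficients of w
(`hessian_openFunction`). -/

noncomputable section
namespace DSaito

/-! ### Partial derivatives on ℂⁿ, chain rules and matrices of functions. -/

section Calculus

variable {n m : ℕ}

theorem pd_congr {f g : (Fin n → ℂ) → ℂ} {p : Fin n → ℂ} (h : f =ᶠ[nhds p] g) (i : Fin n) :
    pd i f p = pd i g p := by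
  unfold pd; rw [h.fderiv_eq]

theorem pd_const (i : Fin n) (a : ℂ) (p : Fin n → ℂ) : pd i (fun _ => a) p = 0 := by
  simp [pd]

theorem pd_coord (i j : Fin n) (p : Fin n → ℂ) :
    pd i (fun q => q j) p = if i = j then 1 else 0 := by
  have h : HasFDerivAt (fun q : Fin n → ℂ => q j) (ContinuousLinearMap.proj j) p :=
    (ContinuousLinearMap.proj (R := ℂ) (φ := fun _ : Fin n => ℂ) j).hasFDerivAt
  rw [pd, h.fderiv]
  simp [Pi.single_apply, eq_comm]

theorem pd_add {f g : (Fin n → ℂ) → ℂ} {p : Fin n → ℂ} (hf : DifferentiableAt ℂ f p)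
    (hg : DifferentiableAt ℂ g p) (i : Fin n) :
    pd i (fun q => f q + g q) p = pd i f p + pd i g p := by
  unfold pd; rw [fderiv_fun_add hf hg]; rfl

theorem pd_mul {f g : (Fin n → ℂ) → ℂ} {p : Fin n → ℂ} (hf : DifferentiableAt ℂ f p)
    (hg : DifferentiableAt ℂ g p) (i : Fin n) :
    pd i (fun q => f q * g q) p = pd i f p * g p + f p * pd i g p := by
  unfold pd; rw [fderiv_fun_mul hf hg]
  simp only [add_apply, smul_apply, smul_eq_mul]
  ring

theorem pd_const_mul {f : (Fin n → ℂ) → ℂ} {p : Fin n → ℂ} (hf : DifferentiableAt ℂ f p)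
    (a : ℂ) (i : Fin n) : pd i (fun q => a * f q) p = a * pd i f p := by
  rw [pd_mul (differentiableAt_const a) hf, pd_const]; ring

theorem pd_sum {ι : Type*} (s : Finset ι) {f : ι → (Fin n → ℂ) → ℂ} {p : Fin n → ℂ}
    (hf : ∀ a ∈ s, DifferentiableAt ℂ (f a) p) (i : Fin n) :
    pd i (fun q => ∑ a ∈ s, f a q) p = ∑ a ∈ s, pd i (f a) p := by
  unfold pd; rw [fderiv_fun_sum hf]; simp

theorem analyticAt_pd {f : (Fin n → ℂ) → ℂ} {p : Fin n → ℂ} (hf : AnalyticAt ℂ f p) (i : Fin n) :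
    AnalyticAt ℂ (pd i f) p := by
  have h : AnalyticAt ℂ (ContinuousLinearMap.apply ℂ ℂ (Pi.single i (1 : ℂ) : Fin n → ℂ))
    (fderiv ℂ f p) := ContinuousLinearMap.analyticAt _ _
  exact h.comp hf.fderiv

theorem pd_comm {f : (Fin n → ℂ) → ℂ} {p : Fin n → ℂ} (hf : AnalyticAt ℂ f p) (i j : Fin n) :
    pd i (pd j f) p = pd j (pd i f) p := by
  have hs : IsSymmSndFDerivAt ℂ f p :=
    (hf.contDiffAt (n := 2)).isSymmSndFDerivAt (by simp)
  have key : ∀ a b : Fin n, pd a (pd b f) p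
      = fderiv ℂ (fderiv ℂ f) p (Pi.single a 1) (Pi.single b 1) := by
    intro a b
    set L := ContinuousLinearMap.apply ℂ ℂ (Pi.single b (1 : ℂ) : Fin n → ℂ)
    have h1 : HasFDerivAt L L (fderiv ℂ f p) := L.hasFDerivAt
    have h2 : HasFDerivAt (pd b f) (L.comp (fderiv ℂ (fderiv ℂ f) p)) p :=
      h1.comp p hf.fderiv.differentiableAt.hasFDerivAt
    rw [pd, h2.fderiv]; rfl
  rw [key, key]; exact hs _ _

theorem pd_comp {f : (Fin m → ℂ) → ℂ} {t : Fin m → (Fin n → ℂ) → ℂ} {p : Fin n → ℂ}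
    (hf : DifferentiableAt ℂ f fun a => t a p) (ht : ∀ a, DifferentiableAt ℂ (t a) p)
    (i : Fin n) :
    pd i (fun q => f fun a => t a q) p = ∑ b, pd b f (fun a => t a p) * pd i (t b) p := by
  have h1 : HasFDerivAt (fun q a => t a q) (ContinuousLinearMap.pi fun a => fderiv ℂ (t a) p) p :=
    hasFDerivAt_pi.2 fun a => (ht a).hasFDerivAt
  have h2 := hf.hasFDerivAt.comp p h1
  rw [pd]
  erw [h2.fderiv]
  simp only [ContinuousLinearMap.comp_apply, pd]
  rw [← ContinuousLinearMap.coe_coe, LinearMap.pi_apply_eq_sum_univ]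
  refine Finset.sum_congr rfl fun b _ => ?_
  simp only [ContinuousLinearMap.coe_pi', smul_eq_mul, ContinuousLinearMap.coe_coe]
  rw [mul_comm]
  congr 2
  ext j; simp [Pi.single_apply, eq_comm]

theorem analyticAt_comp_coord {f : (Fin m → ℂ) → ℂ} {t : Fin m → (Fin n → ℂ) → ℂ}
    {p : Fin n → ℂ} (hf : AnalyticAt ℂ f fun a => t a p) (ht : ∀ a, AnalyticAt ℂ (t a) p) :
    AnalyticAt ℂ (fun q => f fun a => t a q) p :=
  AnalyticAt.comp (f := fun q a => t a q) hf (analyticAt_pi_iff.2 ht)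

/-- The second derivatives of a composite function. -/
theorem pd_pd_comp {f : (Fin m → ℂ) → ℂ} {t : Fin m → (Fin n → ℂ) → ℂ} {p : Fin n → ℂ}
    (hf : AnalyticAt ℂ f fun a => t a p) (ht : ∀ a, AnalyticAt ℂ (t a) p) (i j : Fin n) :
    pd i (pd j fun q => f fun a => t a q) p =
      (∑ b, ∑ c, pd b (pd c f) (fun a => t a p) * pd i (t b) p * pd j (t c) p)
        + ∑ b, pd b f (fun a => t a p) * pd i (pd j (t b)) p := by
  have hT : AnalyticAt ℂ (fun q a => t a q) p := analyticAt_pi_iff.2 ht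
  have hev : (pd j fun q => f fun a => t a q) =ᶠ[nhds p]
      fun q => ∑ b, pd b f (fun a => t a q) * pd j (t b) q := by
    have e1 := hT.continuousAt.eventually hf.eventually_analyticAt
    filter_upwards [e1, hT.eventually_analyticAt] with q h1 h2
    exact pd_comp h1.differentiableAt
      (fun a => (analyticAt_pi_iff.1 h2 a).differentiableAt) j
  have hd : ∀ b, AnalyticAt ℂ (fun q => pd b f fun a => t a q) p :=
    fun b => analyticAt_comp_coord (analyticAt_pd hf b) ht
  rw [pd_congr hev, pd_sum]
  · rw [Finset.sum_comm, ← Finset.sum_add_distrib]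
    refine Finset.sum_congr rfl fun b _ => ?_
    rw [pd_mul (hd b).differentiableAt (analyticAt_pd (ht b) j).differentiableAt,
      pd_comp (analyticAt_pd hf b).differentiableAt fun a => (ht a).differentiableAt,
      Finset.sum_mul]
  · intro b _
    exact ((hd b).mul (analyticAt_pd (ht b) j)).differentiableAt

/-- The covariant Hessian of a function in flat coordinates. -/
theorem sum_pd_pd_eq_hessian {f : (Fin m → ℂ) → ℂ} {t : Fin m → (Fin n → ℂ) → ℂ} {p : Fin n → ℂ}
    (hf : AnalyticAt ℂ f fun a => t a p) (ht : ∀ a, AnalyticAt ℂ (t a) p) (i j : Fin n)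
    (Γ : Fin n → ℂ) (hΓ : ∀ a, pd i (pd j (t a)) p = ∑ k, Γ k * pd k (t a) p) :
    ∑ b, ∑ c, pd b (pd c f) (fun a => t a p) * pd i (t b) p * pd j (t c) p =
      pd i (pd j fun q => f fun a => t a q) p
        - ∑ k, Γ k * pd k (fun q => f fun a => t a q) p := by
  rw [pd_pd_comp hf ht, eq_sub_iff_add_eq, add_right_inj]
  -- The first-order term of the chain rule is absorbed by flatness: ∂_i∂_j t is Γ contracted with
  -- dt, and dt contracted with df is the v-gradient of f ∘ t.
  simp_rw [pd_comp hf.differentiableAt fun a => (ht a).differentiableAt, hΓ, Finset.mul_sum]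
  rw [Finset.sum_comm]
  exact Finset.sum_congr rfl fun b _ => Finset.sum_congr rfl fun k _ => by ring

theorem analyticAt_det {A : (Fin m → ℂ) → Matrix (Fin n) (Fin n) ℂ} {p : Fin m → ℂ}
    (hA : ∀ a b, AnalyticAt ℂ (fun q => A q a b) p) : AnalyticAt ℂ (fun q => (A q).det) p := by
  simp_rw [Matrix.det_apply']
  exact Finset.analyticAt_fun_sum _ fun σ _ =>
    analyticAt_const.mul (Finset.analyticAt_fun_prod _ fun i _ => hA _ _)

theorem analyticAt_inv_apply {A : (Fin m → ℂ) → Matrix (Fin n) (Fin n) ℂ} {p : Fin m → ℂ}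
    (hA : ∀ a b, AnalyticAt ℂ (fun q => A q a b) p) (h0 : (A p).det ≠ 0) (a b : Fin n) :
    AnalyticAt ℂ (fun q => (A q)⁻¹ a b) p := by
  simp_rw [Matrix.inv_def, Ring.inverse_eq_inv', Matrix.smul_apply, smul_eq_mul,
    Matrix.adjugate_apply]
  refine ((analyticAt_det hA).inv h0).mul (analyticAt_det fun c d => ?_)
  simp_rw [Matrix.updateRow_apply]
  split_ifs
  · exact analyticAt_const
  · exact hA _ _

/-- The entrywise partial derivative of a matrix of functions. -/
def pdMatrix (i : Fin n) (A : (Fin n → ℂ) → Matrix (Fin m) (Fin m) ℂ) (p : Fin n → ℂ) :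
    Matrix (Fin m) (Fin m) ℂ :=
  Matrix.of fun a b => pd i (fun q => A q a b) p

theorem pdMatrix_mul {A B : (Fin n → ℂ) → Matrix (Fin m) (Fin m) ℂ} {p : Fin n → ℂ}
    (hA : ∀ a b, AnalyticAt ℂ (fun q => A q a b) p) (hB : ∀ a b, AnalyticAt ℂ (fun q => B q a b) p)
    (i : Fin n) :
    pdMatrix i (fun q => A q * B q) p = pdMatrix i A p * B p + A p * pdMatrix i B p := by
  ext a b
  simp only [pdMatrix, Matrix.of_apply, Matrix.mul_apply, Matrix.add_apply]
  rw [pd_sum, ← Finset.sum_add_distrib]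
  · exact Finset.sum_congr rfl fun c _ => pd_mul (hA a c).differentiableAt (hB c b).differentiableAt i
  · exact fun c _ => ((hA a c).mul (hB c b)).differentiableAt

theorem pdMatrix_add {A B : (Fin n → ℂ) → Matrix (Fin m) (Fin m) ℂ} {p : Fin n → ℂ}
    (hA : ∀ a b, AnalyticAt ℂ (fun q => A q a b) p) (hB : ∀ a b, AnalyticAt ℂ (fun q => B q a b) p)
    (i : Fin n) :
    pdMatrix i (fun q => A q + B q) p = pdMatrix i A p + pdMatrix i B p := by
  ext a b
  exact pd_add (hA a b).differentiableAt (hB a b).differentiableAt i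

theorem pdMatrix_smul {A : (Fin n → ℂ) → Matrix (Fin m) (Fin m) ℂ} {p : Fin n → ℂ}
    (hA : ∀ a b, AnalyticAt ℂ (fun q => A q a b) p) (z : ℂ) (i : Fin n) :
    pdMatrix i (fun q => z • A q) p = z • pdMatrix i A p := by
  ext a b
  exact pd_const_mul (hA a b).differentiableAt z i

theorem pdMatrix_comm {A : (Fin n → ℂ) → Matrix (Fin m) (Fin m) ℂ} {p : Fin n → ℂ}
    (hA : ∀ a b, AnalyticAt ℂ (fun q => A q a b) p) (i j : Fin n) :
    pdMatrix i (pdMatrix j A) p = pdMatrix j (pdMatrix i A) p := by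
  ext a b
  exact pd_comm (hA a b) i j

theorem pdMatrix_congr {A B : (Fin n → ℂ) → Matrix (Fin m) (Fin m) ℂ} {p : Fin n → ℂ}
    (h : A =ᶠ[nhds p] B) (i : Fin n) : pdMatrix i A p = pdMatrix i B p := by
  ext a b
  exact pd_congr (h.fun_comp fun X => X a b) i

end Calculus

/-! ### Flat F-manifolds from a vector potential. -/

section General

variable {n : ℕ}

/-- The Jacobian matrix `(∂t^α/∂v_k)`. -/
def jacobianMatrix (t : Fin n → (Fin n → ℂ) → ℂ) (p : Fin n → ℂ) : Matrix (Fin n) (Fin n) ℂ :=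
  Matrix.of fun a k => pd k (t a) p

/-- The Christoffel symbols of the connection with flat coordinates `t`. -/
def christoffel (t : Fin n → (Fin n → ℂ) → ℂ) (k i j : Fin n) (p : Fin n → ℂ) : ℂ :=
  ((jacobianMatrix t p)⁻¹ * pdMatrix i (jacobianMatrix t) p) k j

/-- The matrix J is a gauge transformation carrying d + A to d + z dH. Since d(dH) = 0, the
curvature of the latter is z² [∂_iH, ∂_jH], and these matrices commute because J conjugates them to
the multiplication operators `c i`. -/
theorem curvature_of_potential {M : Set (Fin n → ℂ)} (hM : IsOpen M)
    {J H : (Fin n → ℂ) → Matrix (Fin n) (Fin n) ℂ} {A : Fin n → (Fin n → ℂ) → Matrix (Fin n) (Fin n) ℂ}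
    {c : Fin n → (Fin n → ℂ) → Matrix (Fin n) (Fin n) ℂ} {z : ℂ}
    (hJ : ∀ p ∈ M, ∀ a b, AnalyticAt ℂ (fun q => J q a b) p)
    (hH : ∀ p ∈ M, ∀ a b, AnalyticAt ℂ (fun q => H q a b) p)
    (hA : ∀ p ∈ M, ∀ i a b, AnalyticAt ℂ (fun q => A i q a b) p)
    (hJ0 : ∀ p ∈ M, (J p).det ≠ 0)
    (hc : ∀ p ∈ M, ∀ i, J p * c i p = pdMatrix i H p * J p)
    (hJA : ∀ p ∈ M, ∀ i, J p * A i p = pdMatrix i J p + z • (pdMatrix i H p * J p))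
    (hcc : ∀ p ∈ M, ∀ i j, c i p * c j p = c j p * c i p)
    {p : Fin n → ℂ} (hp : p ∈ M) (i j : Fin n) :
    pdMatrix i (A j) p - pdMatrix j (A i) p + (A i p * A j p - A j p * A i p) = 0 := by
  have hpd : ∀ (B : (Fin n → ℂ) → Matrix (Fin n) (Fin n) ℂ),
      (∀ a b, AnalyticAt ℂ (fun q => B q a b) p) → ∀ i a b,
      AnalyticAt ℂ (fun q => pdMatrix i B q a b) p := fun B hB i a b => analyticAt_pd (hB a b) i
  have hmul : ∀ (B C : (Fin n → ℂ) → Matrix (Fin n) (Fin n) ℂ),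
      (∀ a b, AnalyticAt ℂ (fun q => B q a b) p) → (∀ a b, AnalyticAt ℂ (fun q => C q a b) p) →
      ∀ a b, AnalyticAt ℂ (fun q => (B q * C q) a b) p := by
    intro B C hB hC a b
    simp_rw [Matrix.mul_apply]
    exact Finset.analyticAt_fun_sum _ fun k _ => (hB a k).mul (hC k b)
  have hJp := hJ p hp
  have hHp := hH p hp
  have hN := hM.mem_nhds hp
  -- The i-th derivative of the relation J A_j = ∂_jJ + z ∂_jH J.
  have d1 : ∀ i j, pdMatrix i J p * A j p + J p * pdMatrix i (A j) p =
      pdMatrix i (pdMatrix j J) p + z • (pdMatrix i (pdMatrix j H) p * J p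
        + pdMatrix j H p * pdMatrix i J p) := by
    intro i j
    rw [← pdMatrix_mul hJp (hA p hp j), ← pdMatrix_mul (hpd H hHp j) hJp,
      ← pdMatrix_smul (hmul _ _ (hpd H hHp j) hJp),
      ← pdMatrix_add (hpd J hJp j)]
    · refine pdMatrix_congr ?_ i
      filter_upwards [hN] with q hq using hJA q hq j
    · intro a b
      exact analyticAt_const.mul (hmul _ _ (hpd H hHp j) hJp a b)
  have d2 : ∀ i j, J p * (A i p * A j p) = pdMatrix i J p * A j p
      + z • (pdMatrix i H p * (pdMatrix j J p + z • (pdMatrix j H p * J p))) := by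
    intro i j
    rw [← Matrix.mul_assoc, hJA p hp i, ← hJA p hp j, Matrix.add_mul, Matrix.smul_mul,
      Matrix.mul_assoc (pdMatrix i H p)]
  -- Commutativity of the multiplication operators, transported to ∂_iH and ∂_jH by J.
  have d3 : pdMatrix i H p * (pdMatrix j H p * J p) = pdMatrix j H p * (pdMatrix i H p * J p) := by
    rw [← hc p hp, ← hc p hp, ← Matrix.mul_assoc, ← Matrix.mul_assoc, ← hc p hp, ← hc p hp,
      Matrix.mul_assoc, Matrix.mul_assoc, hcc p hp]
  have hu : IsUnit (J p).det := (hJ0 p hp).isUnit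
  have key : J p * (pdMatrix i (A j) p - pdMatrix j (A i) p
      + (A i p * A j p - A j p * A i p)) = 0 := by
    rw [Matrix.mul_add, Matrix.mul_sub, Matrix.mul_sub, d2, d2]
    have e1 := d1 i j
    have e2 := d1 j i
    rw [pdMatrix_comm hJp, pdMatrix_comm hHp] at e1
    rw [← eq_sub_iff_add_eq'] at e1 e2
    rw [e1, e2]
    simp only [Matrix.mul_add, Matrix.mul_smul, d3, smul_add]
    abel
  have := congrArg ((J p)⁻¹ * ·) key
  simpa [← Matrix.mul_assoc, Matrix.nonsing_inv_mul _ hu] using this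

/-- A commutative associative unital multiplication with a vector potential in coordinates `t`
with `∂/∂v_1 = ∂/∂t^1` the unit defines a flat F-manifold. -/
theorem isFlatFManifold_of_vectorPotential [NeZero n] {M : Set (Fin n → ℂ)} (hM : IsOpen M)
    {c : Fin n → Fin n → Fin n → (Fin n → ℂ) → ℂ} {t F : Fin n → (Fin n → ℂ) → ℂ}
    (hc : ∀ k i j, AnalyticOnNhd ℂ (c k i j) M)
    (ht : ∀ a, AnalyticOnNhd ℂ (t a) M)
    (hinj : Set.InjOn (fun p a => t a p) M)
    (hJ : ∀ p ∈ M, (jacobianMatrix t p).det ≠ 0)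
    (h1 : ∀ p ∈ M, ∀ a, pd 0 (t a) p = if a.val = 0 then 1 else 0)
    (hcomm : ∀ p ∈ M, ∀ k i j, c k i j p = c k j i p)
    (hassoc : ∀ p ∈ M, ∀ l i j k, ∑ m, c m i j p * c l m k p = ∑ m, c m j k p * c l i m p)
    (hone : ∀ p ∈ M, ∀ k j, c k 0 j p = if k = j then 1 else 0)
    (hF : IsVectorPotential M c t F) :
    IsFlatFManifold M (christoffel t) c (fun k _ => if k = 0 then 1 else 0) ∧
      IsFlatCoordinates M (christoffel t) (fun k _ => if k = 0 then 1 else 0) t := by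
  have hJa : ∀ p ∈ M, ∀ a b, AnalyticAt ℂ (fun q => jacobianMatrix t q a b) p :=
    fun p hp a b => analyticAt_pd (ht a p hp) b
  have hu : ∀ p ∈ M, IsUnit (jacobianMatrix t p).det := fun p hp => (hJ p hp).isUnit
  have hΓa : ∀ k i j, AnalyticOnNhd ℂ (christoffel t k i j) M := by
    intro k i j p hp
    unfold christoffel
    simp only [Matrix.mul_apply]
    exact Finset.analyticAt_fun_sum _ fun m _ =>
      (analyticAt_inv_apply (hJa p hp) (hJ p hp) _ _).mul (analyticAt_pd (hJa p hp _ _) _)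
  have hJΓ : ∀ p ∈ M, ∀ i, jacobianMatrix t p * Matrix.of (fun k j => christoffel t k i j p)
      = pdMatrix i (jacobianMatrix t) p := by
    intro p hp i
    have : Matrix.of (fun k j => christoffel t k i j p)
      = (jacobianMatrix t p)⁻¹ * pdMatrix i (jacobianMatrix t) p := rfl
    rw [this, ← Matrix.mul_assoc, Matrix.mul_nonsing_inv _ (hu p hp), Matrix.one_mul]
  have hsymm : ∀ p ∈ M, ∀ k i j, christoffel t k i j p = christoffel t k j i p := by
    intro p hp k i j
    simp only [christoffel, Matrix.mul_apply]
    refine Finset.sum_congr rfl fun m _ => ?_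
    congr 1
    exact pd_comm (ht m p hp) i j
  refine ⟨⟨hM, hΓa, hc, fun k => analyticOnNhd_const, hassoc, ?_, ?_, ?_, ?_, ?_⟩,
    ⟨ht, hinj, hJ, ?_, ?_⟩⟩
  · intro p hp k j
    simp [hone p hp]
  · intro p hp k j
    simp [hcomm p hp k j 0, hone p hp]
  · intro z p hp k i j
    simp only [hsymm p hp k i j, hcomm p hp k i j]
  · intro z p hp l i j k
    have key := curvature_of_potential (M := M) (J := jacobianMatrix t)
      -- H is the matrix ∂F^a/∂t^b pulled back to the coordinates v; the potential property says
      -- that ∂_iH J = J c_i.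
      (H := fun p => Matrix.of fun a b => pd b (F a) fun d => t d p)
      (A := fun i p => Matrix.of fun k j => christoffel t k i j p + z * c k i j p)
      (c := fun i p => Matrix.of fun k j => c k i j p) (z := z) hM hJa
      (fun p hp a b => analyticAt_comp_coord
        (analyticAt_pd (hF.analytic a _ ⟨p, hp, rfl⟩) b) fun d => ht d p hp)
      (fun p hp i a b => (hΓa a i b p hp).add (analyticAt_const.mul (hc a i b p hp)))
      hJ ?_ ?_ ?_ hp i j
    · have := congrFun (congrFun key l) k
      simp only [Matrix.add_apply, Matrix.sub_apply, Matrix.mul_apply, Matrix.of_apply, pdMatrix,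
        Matrix.zero_apply] at this
      rw [Finset.sum_sub_distrib]
      exact this
    all_goals
      have hcH : ∀ p ∈ M, ∀ i, jacobianMatrix t p * Matrix.of (fun k j => c k i j p)
          = pdMatrix i (fun p => Matrix.of fun a b => pd b (F a) fun d => t d p) p
            * jacobianMatrix t p := by
        intro p hp i
        ext a j
        simp only [Matrix.mul_apply, jacobianMatrix, pdMatrix, Matrix.of_apply]
        have hFa := hF.analytic a _ ⟨p, hp, rfl⟩
        have e := hF.structure_constants p hp a i j
        simp_rw [mul_comm (pd _ (t a) p), e]
        rw [Finset.sum_comm]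
        refine Finset.sum_congr rfl fun b _ => ?_
        rw [pd_comp (analyticAt_pd hFa b).differentiableAt
          fun d => (ht d p hp).differentiableAt, Finset.sum_mul]
    · exact hcH
    · intro p hp i
      rw [← hcH p hp i, ← hJΓ p hp i, ← Matrix.mul_smul, ← Matrix.mul_add]
      rfl
    · intro p hp i j
      ext l k
      simp only [Matrix.mul_apply, Matrix.of_apply]
      have := hassoc p hp l k i j
      have e2 := hassoc p hp l k j i
      have e3 := hassoc p hp l j i k
      have e4 := hassoc p hp l i j k
      calc ∑ m, c l i m p * c m j k p = ∑ m, c m j k p * c l i m p :=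
            Finset.sum_congr rfl fun _ _ => mul_comm _ _
        _ = ∑ m, c m i j p * c l m k p := e4.symm
        _ = ∑ m, c m j i p * c l m k p := Finset.sum_congr rfl fun m _ => by rw [hcomm p hp m i j]
        _ = ∑ m, c m i k p * c l j m p := e3
        _ = _ := Finset.sum_congr rfl fun _ _ => mul_comm _ _
  · intro p hp k i
    rw [pd_const]
    simp only [mul_ite, mul_one, mul_zero, Finset.sum_ite_eq', Finset.mem_univ, if_true, zero_add]
    simp only [christoffel, Matrix.mul_apply]
    refine Finset.sum_eq_zero fun m _ => ?_
    -- Since ∂/∂v_1 = ∂/∂t^1, the first column of the Jacobian matrix is constant.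
    have : pdMatrix i (jacobianMatrix t) p m 0 = 0 := by
      have hev : (fun q => jacobianMatrix t q m 0) =ᶠ[nhds p]
          fun _ => if m.val = 0 then 1 else 0 := by
        filter_upwards [hM.mem_nhds hp] with q hq using h1 q hq m
      exact (pd_congr hev i).trans (pd_const _ _ _)
    rw [this, mul_zero]
  · intro p hp a i j
    have := congrFun (congrFun (hJΓ p hp i) a) j
    simp only [Matrix.mul_apply, Matrix.of_apply, jacobianMatrix, pdMatrix] at this
    rw [← this]
    exact Finset.sum_congr rfl fun _ _ => mul_comm _ _
  · intro p hp a
    simp [h1 p hp]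

end General

end DSaito
end

noncomputable section
namespace DSaito

/-! ### Polynomial functions and Poincaré's lemma for polynomials. -/

section PolynomialFunctions

variable {n : ℕ}

open MvPolynomial

theorem analyticAt_eval (f : MvPolynomial (Fin n) ℂ) (p : Fin n → ℂ) :
    AnalyticAt ℂ (fun q => eval q f) p :=
  AnalyticOnNhd.eval_mvPolynomial f p (Set.mem_univ p)

theorem pd_eval (i : Fin n) (f : MvPolynomial (Fin n) ℂ) :
    pd i (fun q => eval q f) = fun q => eval q (pderiv i f) := by
  funext p
  induction f using MvPolynomial.induction_on with
  | C a => simp [pd_const]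
  | add f g hf hg =>
    simp only [map_add]
    rw [pd_add (analyticAt_eval f p).differentiableAt (analyticAt_eval g p).differentiableAt,
      hf, hg]
  | mul_X f j hf =>
    simp only [map_mul, eval_X, pderiv_mul, map_add]
    have hj : DifferentiableAt ℂ (fun q : Fin n → ℂ => q j) p := differentiableAt_apply j p
    rw [pd_mul (analyticAt_eval f p).differentiableAt hj, hf, pd_coord, pderiv_X]
    congr 2
    by_cases h : i = j <;> simp [h, eq_comm]

theorem eval_aeval (V : Fin n → MvPolynomial (Fin n) ℂ) (f : MvPolynomial (Fin n) ℂ)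
    (p : Fin n → ℂ) : eval p (aeval V f) = eval (fun a => eval p (V a)) f := by
  rw [← coe_aeval_eq_eval, ← coe_aeval_eq_eval]
  simp only [RingHom.coe_coe]
  rw [← AlgHom.comp_apply, comp_aeval]

theorem coeff_X_mul_pderiv {σ : Type*} (i : σ) (f : MvPolynomial σ ℂ) (m : σ →₀ ℕ) :
    coeff m (X i * pderiv i f) = m i * coeff m f := by
  classical
  rw [coeff_X_mul']
  split_ifs with h
  · have h1 : Finsupp.single i 1 ≤ m := by
      rw [Finsupp.single_le_iff]; exact Nat.one_le_iff_ne_zero.2 (Finsupp.mem_support_iff.1 h)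
    rw [coeff_pderiv, tsub_add_cancel_of_le h1]
    have h2 : (m - Finsupp.single i 1 : σ →₀ ℕ) i + 1 = m i := by
      have h3 := h1 i
      rw [Finsupp.single_eq_same] at h3
      rw [Finsupp.tsub_apply, Finsupp.single_eq_same, Nat.sub_add_cancel h3]
    rw [← h2]; push_cast; ring
  · simp [Finsupp.notMem_support_iff.1 h]

/-- Divides the homogeneous component of degree `d` by `d + 1`. -/
def eulerInverse (f : MvPolynomial (Fin n) ℂ) : MvPolynomial (Fin n) ℂ :=
  ∑ m ∈ f.support, monomial m (coeff m f / ((m.degree : ℂ) + 1))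

theorem coeff_eulerInverse (f : MvPolynomial (Fin n) ℂ) (m : Fin n →₀ ℕ) :
    coeff m (eulerInverse f) = coeff m f / ((m.degree : ℂ) + 1) := by
  classical
  simp only [eulerInverse, coeff_sum, coeff_monomial, Finset.sum_ite_eq']
  split_ifs with h
  · rfl
  · rw [notMem_support_iff.1 h, zero_div]

/-- The primitive of the closed form `∑ ω_i dX_i`. -/
def primitive (ω : Fin n → MvPolynomial (Fin n) ℂ) : MvPolynomial (Fin n) ℂ :=
  ∑ i, X i * eulerInverse (ω i)

/-- Poincaré's lemma by radial integration: on degree d, integrating along rays divides by d + 1.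
Closedness turns the derivative of the primitive into (1 + Euler operator) applied to `eulerInverse
(ω j)`, and the Euler operator acts on degree d as d. -/
theorem pderiv_primitive {ω : Fin n → MvPolynomial (Fin n) ℂ}
    (h : ∀ i j, pderiv i (ω j) = pderiv j (ω i)) (j : Fin n) : pderiv j (primitive ω) = ω j := by
  have h1 : ∀ i, pderiv j (eulerInverse (ω i)) = pderiv i (eulerInverse (ω j)) := by
    intro i
    ext m
    have := congrArg (coeff m) (h j i)
    simp only [coeff_pderiv, coeff_eulerInverse, map_add, Finsupp.degree_single] at this ⊢
    rw [div_mul_eq_mul_div, div_mul_eq_mul_div, this]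
  have h2 : pderiv j (primitive ω)
      = eulerInverse (ω j) + ∑ i, X i * pderiv i (eulerInverse (ω j)) := by
    simp only [primitive, map_sum, pderiv_mul, Finset.sum_add_distrib, h1, pderiv_X]
    congr 1
    simp [Pi.single_apply, eq_comm]
  rw [h2]
  ext m
  simp only [coeff_add, coeff_sum, coeff_X_mul_pderiv, coeff_eulerInverse]
  rw [← Finset.sum_mul]
  have h3 : (∑ i, (m i : ℂ)) = (m.degree : ℂ) := by
    rw [Finsupp.degree_eq_sum]; push_cast; rfl
  have h4 : (m.degree : ℂ) + 1 ≠ 0 := by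
    exact_mod_cast Nat.succ_ne_zero m.degree
  rw [h3]; field_simp; ring

/-- Each integration raises the order of vanishing at the origin by one; three of them account for
the absence of monomials of degree less than 3 in the potential. -/
theorem degree_of_mem_support_primitive {ω : Fin n → MvPolynomial (Fin n) ℂ} {k : ℕ}
    (h : ∀ i, ∀ m ∈ (ω i).support, k ≤ m.degree) :
    ∀ m ∈ (primitive ω).support, k + 1 ≤ m.degree := by
  classical
  intro m hm
  by_contra hlt
  refine mem_support_iff.1 hm ?_
  simp only [primitive, coeff_sum]
  refine Finset.sum_eq_zero fun i _ => ?_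
  rw [coeff_X_mul']
  split_ifs with hi
  · rw [coeff_eulerInverse]
    have h1 : Finsupp.single i 1 ≤ m := by
      rw [Finsupp.single_le_iff]; exact Nat.one_le_iff_ne_zero.2 (Finsupp.mem_support_iff.1 hi)
    have h2 : (m - Finsupp.single i 1).degree + 1 = m.degree := by
      conv_rhs => rw [← tsub_add_cancel_of_le h1, map_add, Finsupp.degree_single]
    have h3 : m - Finsupp.single i 1 ∉ (ω i).support := fun hmem => by
      have := h i _ hmem; omega
    rw [notMem_support_iff.1 h3, zero_div]
  · rfl

/-- A totally symmetric cubic tensor with totally symmetric derivative has a potential. -/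
theorem exists_potential {C : Fin n → Fin n → Fin n → MvPolynomial (Fin n) ℂ}
    (h12 : ∀ a b c, C a b c = C b a c) (h23 : ∀ a b c, C a b c = C a c b)
    (hd : ∀ a b c d, pderiv d (C a b c) = pderiv c (C a b d)) :
    ∃ F : MvPolynomial (Fin n) ℂ, (∀ m ∈ F.support, 3 ≤ m.degree) ∧
      ∀ a b c, pderiv a (pderiv b (pderiv c F)) = C a b c := by
  -- Three successive primitives. The closedness needed comes from the symmetric derivative of C,
  -- from the symmetry of C in its last two indices, and from the symmetry of H.
  set H : Fin n → Fin n → MvPolynomial (Fin n) ℂ := fun a b => primitive (C a b)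
  have hH : ∀ a b c, pderiv c (H a b) = C a b c := fun a b c =>
    pderiv_primitive (fun i j => hd a b j i) c
  have hH1 : ∀ a b, ∀ m ∈ (H a b).support, 1 ≤ m.degree := fun a b =>
    degree_of_mem_support_primitive (fun _ _ _ => Nat.zero_le _)
  have hHs : ∀ a b, H a b = H b a := fun a b => by
    simp only [H]; congr 1; funext c; exact h12 a b c
  set L : Fin n → MvPolynomial (Fin n) ℂ := fun a => primitive (H a)
  have hL : ∀ a b, pderiv b (L a) = H a b := fun a b =>
    pderiv_primitive (fun i j => by rw [hH, hH, h23]) b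
  have hL1 : ∀ a, ∀ m ∈ (L a).support, 2 ≤ m.degree := fun a =>
    degree_of_mem_support_primitive (hH1 a)
  refine ⟨primitive L, degree_of_mem_support_primitive hL1, fun a b c => ?_⟩
  rw [pderiv_primitive (fun i j => by rw [hL, hL, hHs]), hL, hH, h12, h23, h12]

/-- A trilinear form vanishing on all triples of vectors from a basis vanishes. -/
theorem eq_of_sum_mul_eq {J : Matrix (Fin n) (Fin n) ℂ} (hJ : J.det ≠ 0)
    {X Y : Fin n → Fin n → Fin n → ℂ}
    (h : ∀ i j k, ∑ a, ∑ b, ∑ c, X a b c * J a i * J b j * J c k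
      = ∑ a, ∑ b, ∑ c, Y a b c * J a i * J b j * J c k) : X = Y := by
  have key : ∀ Z : Fin n → ℂ, (∀ i, ∑ a, Z a * J a i = 0) → Z = 0 := by
    intro Z hZ
    refine Matrix.eq_zero_of_vecMul_eq_zero hJ ?_
    funext i
    exact hZ i
  have h0 : ∀ i j k, ∑ a, (∑ b, (∑ c, (X a b c - Y a b c) * J c k) * J b j) * J a i = 0 := by
    intro i j k
    rw [← sub_eq_zero.2 (h i j k), ← Finset.sum_sub_distrib]
    refine Finset.sum_congr rfl fun a _ => ?_
    rw [Finset.sum_mul, ← Finset.sum_sub_distrib]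
    refine Finset.sum_congr rfl fun b _ => ?_
    rw [Finset.sum_mul, Finset.sum_mul, ← Finset.sum_sub_distrib]
    exact Finset.sum_congr rfl fun c _ => by ring
  funext a b c
  -- Invertibility of J strips off the three indices one at a time.
  have h1 := fun j k => congrFun (key _ fun i => h0 i j k) a
  have h2 := fun k => congrFun (key _ fun j => h1 j k) b
  exact sub_eq_zero.1 (congrFun (key _ fun k => h2 k) c)

end PolynomialFunctions

end DSaito
end

noncomputable section
namespace DSaito

/-! ### Euclidean division by x(∂_xΛ - y²) and the multiplication table. -/

section Division

open Polynomial

variable {n : ℕ} {S : Type*} [CommRing S]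

/-- The polynomial `x (x^{N-2} + ∑ (k-1) v_k x^{k-2})` with `N = n + 1`. -/
def critPoly (v : Fin (n + 1) → S) : S[X] :=
  X ^ n + ∑ i : Fin n, C ((i : ℕ) * v i.castSucc) * X ^ (i : ℕ)

theorem critPoly_monic (v : Fin (n + 1) → S) : (critPoly v).Monic :=
  monic_X_pow_add (degree_sum_fin_lt _)

theorem natDegree_critPoly [Nontrivial S] (v : Fin (n + 1) → S) : (critPoly v).natDegree = n := by
  refine natDegree_eq_of_degree_eq_some ?_
  rw [critPoly, degree_add_eq_left_of_degree_lt] <;> rw [degree_X_pow]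
  exact degree_sum_fin_lt _

theorem coeff_critPoly (v : Fin (n + 1) → S) (k : Fin n) :
    (critPoly v).coeff k = (k : ℕ) * v k.castSucc := by
  simp only [critPoly, coeff_add, coeff_X_pow, k.2.ne, if_false, zero_add, finsetSum_coeff,
    coeff_C_mul, mul_ite, mul_one, mul_zero, Fin.val_inj, Finset.sum_ite_eq, Finset.mem_univ, if_true]

/-- The factor i in the coefficient of x^i removes the constant term; `divX` of the polynomial is
∂_xΛ - y². -/
theorem X_mul_divX_critPoly (hn : n ≠ 0) (v : Fin (n + 1) → S) :
    X * (critPoly v).divX = critPoly v := by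
  have h := X_mul_divX_add (critPoly v)
  have h0 := coeff_critPoly v ⟨0, Nat.pos_of_ne_zero hn⟩
  simp only [Nat.cast_zero, zero_mul] at h0
  rwa [h0, C_0, add_zero] at h

/-- The quotient of `x^m` by `critPoly v`. -/
def quotPoly (v : Fin (n + 1) → S) (m : ℕ) : S[X] := X ^ m /ₘ critPoly v

/-- The remainder of `x^m` modulo `critPoly v`. -/
def remPoly (v : Fin (n + 1) → S) (m : ℕ) : S[X] := X ^ m %ₘ critPoly v

theorem remPoly_add (v : Fin (n + 1) → S) (m : ℕ) :
    remPoly v m + critPoly v * quotPoly v m = X ^ m := modByMonic_add_div _ _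

theorem degree_remPoly [Nontrivial S] (v : Fin (n + 1) → S) (m : ℕ) :
    (remPoly v m).degree < n := by
  have := degree_modByMonic_lt (X ^ m) (critPoly_monic v)
  rwa [degree_eq_natDegree (critPoly_monic v).ne_zero, natDegree_critPoly] at this

theorem natDegree_quotPoly [Nontrivial S] (v : Fin (n + 1) → S) (m : ℕ) :
    (quotPoly v m).natDegree = m - n := by
  rw [quotPoly, natDegree_divByMonic _ (critPoly_monic v), natDegree_X_pow, natDegree_critPoly]

theorem quotPoly_of_lt [Nontrivial S] (v : Fin (n + 1) → S) {m : ℕ} (h : m < n) :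
    quotPoly v m = 0 := by
  rw [quotPoly, divByMonic_eq_zero_iff (critPoly_monic v),
    degree_eq_natDegree (critPoly_monic v).ne_zero, natDegree_critPoly, degree_X_pow]
  exact_mod_cast h

theorem coeff_quotPoly_eq_zero [Nontrivial S] (v : Fin (n + 1) → S) {m k : ℕ} (h : m < n + k)
    (hk : k ≠ 0) : (quotPoly v m).coeff k = 0 := by
  refine coeff_eq_zero_of_natDegree_lt ?_
  rw [natDegree_quotPoly]; omega

theorem monomialD_castSucc {R : Type*} [CommRing R] (x y : R) (i : Fin n) :
    monomialD (n + 1) x y i.castSucc = x ^ (i : ℕ) := by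
  simp [monomialD, i.2.ne]

theorem monomialD_last {R : Type*} [CommRing R] (x y : R) :
    monomialD (n + 1) x y (Fin.last n) = y := by
  simp [monomialD]

/-- The multiple of `∂_xΛ` by which `φ_i φ_j` differs from the combination of basis elements. -/
def mulQuot (v : Fin (n + 1) → S) (i j : Fin (n + 1)) : S[X] :=
  Fin.lastCases (motive := fun _ => S[X])
    (Fin.lastCases (motive := fun _ => S[X]) 1 (fun _ => 0) j)
    (fun i => Fin.lastCases (motive := fun _ => S[X]) 0 (fun j => X * quotPoly v (i + j)) j) i

@[simp] theorem mulQuot_last_last (v : Fin (n + 1) → S) :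
    mulQuot v (Fin.last n) (Fin.last n) = 1 := by simp [mulQuot]

@[simp] theorem mulQuot_last_castSucc (v : Fin (n + 1) → S) (j : Fin n) :
    mulQuot v (Fin.last n) j.castSucc = 0 := by simp [mulQuot]

@[simp] theorem mulQuot_castSucc_last (v : Fin (n + 1) → S) (i : Fin n) :
    mulQuot v i.castSucc (Fin.last n) = 0 := by simp [mulQuot]

@[simp] theorem mulQuot_castSucc_castSucc (v : Fin (n + 1) → S) (i j : Fin n) :
    mulQuot v i.castSucc j.castSucc = X * quotPoly v (i + j) := by simp [mulQuot]

theorem aeval_eq_sum_fin {A : Type*} [CommRing A] [Algebra S A] {p : S[X]} (h : p.natDegree < n) (x : A) :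
    aeval x p = ∑ k : Fin n, algebraMap S A (p.coeff k) * x ^ (k : ℕ) := by
  rw [aeval_eq_sum_range' h, Finset.sum_range]
  simp only [Algebra.smul_def]

variable [Algebra ℂ S]

/-- `v_N / 2` -/
def halfLast (v : Fin (n + 1) → S) : S := algebraMap ℂ S (1 / 2) * v (Fin.last n)

/-- The coordinates of `φ_i φ_j` in the basis `1, x, …, x^{N-2}, y`. -/
def mulCoord (v : Fin (n + 1) → S) (i j : Fin (n + 1)) : Fin (n + 1) → S :=
  Fin.lastCases (motive := fun _ => Fin (n + 1) → S)
    (Fin.lastCases (motive := fun _ => Fin (n + 1) → S)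
      (Fin.snoc (fun k : Fin n => -(critPoly v).coeff (k + 1)) 0)
      (fun j => Fin.snoc (fun k : Fin n => if (k : ℕ) + 1 = j then -halfLast v else 0)
        (if (j : ℕ) = 0 then 1 else 0)) j)
    (fun i => Fin.lastCases (motive := fun _ => Fin (n + 1) → S)
      (Fin.snoc (fun k : Fin n => if (k : ℕ) + 1 = i then -halfLast v else 0)
        (if (i : ℕ) = 0 then 1 else 0))
      (fun j => Fin.snoc
        (fun k : Fin n => (remPoly v (i + j)).coeff k
          - halfLast v ^ 2 * (quotPoly v (i + j)).coeff (k + 1))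
        (halfLast v * (quotPoly v (i + j)).coeff 0)) j) i

@[simp] theorem mulCoord_last_last (v : Fin (n + 1) → S) :
    mulCoord v (Fin.last n) (Fin.last n)
      = Fin.snoc (fun k : Fin n => -(critPoly v).coeff (k + 1)) 0 := by simp [mulCoord]

@[simp] theorem mulCoord_last_castSucc (v : Fin (n + 1) → S) (j : Fin n) :
    mulCoord v (Fin.last n) j.castSucc
      = Fin.snoc (fun k : Fin n => if (k : ℕ) + 1 = j then -halfLast v else 0)
        (if (j : ℕ) = 0 then 1 else 0) := by simp [mulCoord]

@[simp] theorem mulCoord_castSucc_last (v : Fin (n + 1) → S) (i : Fin n) :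
    mulCoord v i.castSucc (Fin.last n)
      = Fin.snoc (fun k : Fin n => if (k : ℕ) + 1 = i then -halfLast v else 0)
        (if (i : ℕ) = 0 then 1 else 0) := by simp [mulCoord]

@[simp] theorem mulCoord_castSucc_castSucc (v : Fin (n + 1) → S) (i j : Fin n) :
    mulCoord v i.castSucc j.castSucc = Fin.snoc
        (fun k : Fin n => (remPoly v (i + j)).coeff k
          - halfLast v ^ 2 * (quotPoly v (i + j)).coeff (k + 1))
        (halfLast v * (quotPoly v (i + j)).coeff 0) := by simp [mulCoord]

section Relations

variable {A : Type*} [CommRing A] [Algebra S A] {v : Fin (n + 1) → S} {x y L : A}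

/-- Each factor x against y is traded for -v_N/2, so x^i y is a multiple of x^{i-1} unless i = 0. -/
theorem pow_mul_last (hxy : x * y = -algebraMap S A (halfLast v)) (i : Fin n) :
    x ^ (i : ℕ) * y = (∑ k : Fin n, algebraMap S A (if (k : ℕ) + 1 = i then -halfLast v else 0)
        * x ^ (k : ℕ)) + algebraMap S A (if (i : ℕ) = 0 then 1 else 0) * y := by
  rcases Nat.eq_zero_or_pos (i : ℕ) with h | h
  · rw [h]; simp
  · obtain ⟨j, hj⟩ : ∃ j : Fin n, (j : ℕ) + 1 = i := ⟨⟨i - 1, by omega⟩, by simp; omega⟩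
    rw [Finset.sum_eq_single j, if_pos hj, if_neg (by omega), ← hj, pow_succ, mul_assoc, hxy]
    · simp; ring
    · intro k _ hk
      rw [if_neg (fun h' => hk (Fin.ext (by omega)))]; simp
    · simp

/-- The multiplication table of the monomials `1, x, …, x^{N-2}, y`. -/
theorem monomialD_mul [Nontrivial S] (hn : n ≠ 0)
    (hxy : x * y = -algebraMap S A (halfLast v)) (hL : L = aeval x (critPoly v).divX + y ^ 2)
    (i j : Fin (n + 1)) :
    monomialD (n + 1) x y i * monomialD (n + 1) x y j
      = ∑ k, algebraMap S A (mulCoord v i j k) * monomialD (n + 1) x y k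
        + aeval x (mulQuot v i j) * L := by
  rw [Fin.sum_univ_castSucc]
  simp only [monomialD_castSucc, monomialD_last]
  induction i using Fin.lastCases with
  | last =>
    induction j using Fin.lastCases with
    | last =>
      simp only [monomialD_last, mulCoord_last_last, mulQuot_last_last, Fin.snoc_castSucc,
        Fin.snoc_last, hL, map_one, one_mul, map_neg]
      rw [aeval_eq_sum_fin (n := n) (by
        rw [natDegree_divX_eq_natDegree_tsub_one, natDegree_critPoly]; omega)]
      simp only [coeff_divX, neg_mul, Finset.sum_neg_distrib, map_zero]
      ring
    | cast j =>
      simp only [monomialD_last, monomialD_castSucc, mulCoord_last_castSucc,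
        mulQuot_last_castSucc, Fin.snoc_castSucc, Fin.snoc_last, map_zero, zero_mul, add_zero]
      rw [mul_comm, pow_mul_last hxy]
  | cast i =>
    induction j using Fin.lastCases with
    | last =>
      simp only [monomialD_last, monomialD_castSucc, mulCoord_castSucc_last,
        mulQuot_castSucc_last, Fin.snoc_castSucc, Fin.snoc_last, map_zero, zero_mul, add_zero]
      rw [pow_mul_last hxy]
    | cast j =>
      simp only [monomialD_castSucc, mulCoord_castSucc_castSucc,
        mulQuot_castSucc_castSucc, Fin.snoc_castSucc, Fin.snoc_last]
      -- With crit = x(L - y²) and xy = -v_N/2, the product of crit with the quotient q is x q L +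
      -- (v_N/2) y q. Splitting q = x q' + q(0) rewrites y q as -(v_N/2) q' + q(0) y, where q' is
      -- `divX` of q.
      have h1 := congrArg (aeval x) (remPoly_add v (i + j))
      have h2 := congrArg (aeval x) (X_mul_divX_critPoly hn v)
      have h3 := congrArg (aeval x) (X_mul_divX_add (quotPoly v (i + j)))
      simp only [map_add, map_mul, aeval_X, map_pow, aeval_C] at h1 h2 h3
      have h4 : aeval x (remPoly v (i + j))
          = ∑ k : Fin n, algebraMap S A ((remPoly v (i + j)).coeff k) * x ^ (k : ℕ) := by
        refine aeval_eq_sum_fin ?_ x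
        have h6 := natDegree_modByMonic_lt (X ^ ((i : ℕ) + j)) (critPoly_monic v)
          (fun h => hn (by rw [← natDegree_critPoly v, h, natDegree_one]))
        rwa [natDegree_critPoly] at h6
      have h5 : aeval x (quotPoly v (i + j)).divX
          = ∑ k : Fin n, algebraMap S A ((quotPoly v (i + j)).coeff (k + 1)) * x ^ (k : ℕ) := by
        rw [aeval_eq_sum_fin (n := n)]
        · simp only [coeff_divX]
        · rw [natDegree_divX_eq_natDegree_tsub_one, natDegree_quotPoly]; omega
      simp only [map_sub, map_mul, map_pow, sub_mul, Finset.sum_sub_distrib, mul_assoc,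
        ← Finset.mul_sum, aeval_X]
      rw [← h4, ← h5, ← pow_add, ← h1, ← h2, hL]
      linear_combination (-(y * algebraMap S A (halfLast v))) * h3
        + (aeval x (quotPoly v (i + j)).divX * algebraMap S A (halfLast v) - y * (aeval x (quotPoly v (i + j)))) * hxy

end Relations

end Division

end DSaito
end

noncomputable section
namespace DSaito

/-! ### Structure constants of a commutative algebra with a basis. -/

section StructureConstants

variable {A R ι : Type*} [CommRing A] [CommRing R] [Algebra A R] {φ : ι → R}

theorem structureConstant_eq [Fintype ι] (h : IsModuleBasis A φ) {i j : ι} {a : ι → A}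
    (ha : φ i * φ j = ∑ k, a k • φ k) (k : ι) : structureConstant A φ k i j = a k := by
  classical
  rw [structureConstant, dif_pos h, ha]
  have : ∑ k, a k • φ k = ∑ k, a k • Module.Basis.mk h.1 h.2 k := by simp
  rw [this, Module.Basis.repr_sum_self]

theorem mul_eq_sum_structureConstant [Fintype ι] (h : IsModuleBasis A φ) (i j : ι) :
    φ i * φ j = ∑ k, structureConstant A φ k i j • φ k := by
  have := (Module.Basis.mk h.1 h.2).sum_repr (φ i * φ j)
  rw [← this]
  refine Finset.sum_congr rfl fun k _ => ?_
  rw [structureConstant, dif_pos h]; simp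

theorem structureConstant_comm (k i j : ι) :
    structureConstant A φ k i j = structureConstant A φ k j i := by
  simp only [structureConstant, mul_comm]

/-- Expand φ_i φ_j φ_k and its cyclic rearrangement φ_j φ_k φ_i by the same rule, then compare
coordinates. -/
theorem structureConstant_assoc [Fintype ι] (h : IsModuleBasis A φ) (l i j k : ι) :
    ∑ m, structureConstant A φ m i j * structureConstant A φ l m k
      = ∑ m, structureConstant A φ m j k * structureConstant A φ l i m := by
  have key : ∀ (i j k : ι), φ i * φ j * φ k
      = ∑ l, (∑ m, structureConstant A φ m i j * structureConstant A φ l m k) • φ l := by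
    intro i j k
    rw [mul_eq_sum_structureConstant h i j, Finset.sum_mul]
    simp only [smul_mul_assoc, mul_eq_sum_structureConstant h _ k, Finset.smul_sum, smul_smul,
      Finset.sum_smul]
    exact Finset.sum_comm
  have e : φ i * φ j * φ k = φ j * φ k * φ i := by ring
  rw [key, key, ← sub_eq_zero, ← Finset.sum_sub_distrib] at e
  simp only [← sub_smul] at e
  have := Fintype.linearIndependent_iff.1 h.1 _ e l
  rw [sub_eq_zero] at this
  rw [this]
  exact Finset.sum_congr rfl fun m _ => by rw [structureConstant_comm l m i]

theorem structureConstant_one [Fintype ι] [DecidableEq ι] (h : IsModuleBasis A φ) {i : ι}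
    (hi : φ i = 1) (k j : ι) : structureConstant A φ k i j = if k = j then 1 else 0 :=
  structureConstant_eq h (a := fun k => if k = j then 1 else 0) (by simp [hi]) k

end StructureConstants

/-! ### The partial derivatives of the unfolding. -/

section Unfolding

open Polynomial

variable {n : ℕ} {S : Type*} [CommRing S] [Algebra ℂ S]

theorem pderiv_unfoldingD_fst {σ : Type*} [Nontrivial S] (hn : n ≠ 0) {x y : σ} (hxy : x ≠ y)
    (v : Fin (n + 1) → S) :
    MvPolynomial.pderiv x (unfoldingD (n + 1) x y v)
      = aeval (MvPolynomial.X x) (critPoly v).divX + MvPolynomial.X y ^ 2 := by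
  classical
  rw [aeval_eq_sum_fin (n := n) (by
        rw [natDegree_divX_eq_natDegree_tsub_one, natDegree_critPoly]; omega)]
  obtain ⟨m, rfl⟩ : ∃ m, n = m + 1 := ⟨n - 1, by omega⟩
  have h1 : (critPoly v).coeff (m + 1) = 1 := by
    have := (critPoly_monic v).coeff_natDegree
    rwa [natDegree_critPoly] at this
  -- The normalization 1/(N-1) of the leading term cancels the exponent, which makes ∂_xΛ monic in
  -- x.
  have h2 : algebraMap ℂ S (1 / (((m + 1 + 1 : ℕ) : ℂ) - 1)) * ((m : S) + 1) = 1 := by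
    have h : (m : S) + 1 = algebraMap ℂ S ((m : ℂ) + 1) := by simp
    rw [h, ← map_mul, ← map_one (algebraMap ℂ S)]
    congr 1
    have : (m : ℂ) + 1 ≠ 0 := by exact_mod_cast Nat.succ_ne_zero m
    push_cast
    rw [add_sub_cancel_right]
    field_simp
  simp only [unfoldingD, map_add, MvPolynomial.pderiv_mul, MvPolynomial.pderiv_C,
    MvPolynomial.pderiv_pow, MvPolynomial.pderiv_X_self, MvPolynomial.pderiv_X_of_ne hxy.symm,
    map_sum, zero_mul, zero_add, mul_zero, add_zero, mul_one, one_mul]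
  rw [Fin.sum_univ_castSucc, Fin.sum_univ_succ, Fin.sum_univ_castSucc (n := m)]
  simp only [monomialD_castSucc, monomialD_last, MvPolynomial.pderiv_pow,
    MvPolynomial.pderiv_X_self, MvPolynomial.pderiv_X_of_ne hxy.symm, coeff_divX, Fin.val_last,
    Fin.val_succ, Fin.val_castSucc, Fin.val_zero, h1]
  have h3 : ∀ i : Fin m, (critPoly v).coeff (i + 1) = ((i : ℕ) + 1 : ℕ) * v i.succ.castSucc :=
    fun i => coeff_critPoly v i.succ
  simp only [h3]
  have h4 := congrArg (MvPolynomial.C (σ := σ)) h2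
  simp only [map_mul, map_add, map_one, map_natCast] at h4
  simp only [MvPolynomial.algebraMap_eq, map_mul, map_natCast, map_one, mul_one,
    Nat.cast_zero, zero_mul, mul_zero, zero_add, add_zero, Nat.add_sub_cancel, one_mul, Nat.cast_add, Nat.cast_one,
    map_add] at h4 ⊢
  have h5 : ∀ i : Fin m, (MvPolynomial.C (v i.succ.castSucc) : MvPolynomial σ S)
      * ((((i : ℕ) : MvPolynomial σ S) + 1) * MvPolynomial.X x ^ (i : ℕ))
      = (((i : ℕ) : MvPolynomial σ S) + 1) * MvPolynomial.C (v i.succ.castSucc)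
        * MvPolynomial.X x ^ (i : ℕ) := fun i => by ring
  simp only [h5]
  linear_combination MvPolynomial.X x ^ m * h4

theorem pderiv_unfoldingD_snd {σ : Type*} {x y : σ} (hxy : x ≠ y) (v : Fin (n + 1) → S) :
    MvPolynomial.pderiv y (unfoldingD (n + 1) x y v)
      = 2 * MvPolynomial.X x * MvPolynomial.X y + MvPolynomial.C (v (Fin.last n)) := by
  classical
  simp only [unfoldingD, map_add, MvPolynomial.pderiv_mul, MvPolynomial.pderiv_C,
    MvPolynomial.pderiv_pow, MvPolynomial.pderiv_X_self, MvPolynomial.pderiv_X_of_ne hxy,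
    map_sum, zero_mul, zero_add, mul_zero, add_zero, mul_one]
  rw [Fin.sum_univ_castSucc]
  simp only [monomialD_castSucc, monomialD_last, MvPolynomial.pderiv_pow,
    MvPolynomial.pderiv_X_self, MvPolynomial.pderiv_X_of_ne hxy, mul_zero,
    Finset.sum_const_zero, zero_add, mul_one]
  push_cast
  ring

theorem half_add_half (A : Type*) [CommRing A] [Algebra ℂ A] :
    algebraMap ℂ A (1 / 2) + algebraMap ℂ A (1 / 2) = 1 := by
  rw [← map_add]; norm_num

theorem two_mul_halfLast (v : Fin (n + 1) → S) : 2 * halfLast v = v (Fin.last n) := by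
  rw [halfLast]; linear_combination v (Fin.last n) * half_add_half S

end Unfolding

/-! ### Linear independence on the curve 2xy + v_N = 0. -/

section Laurent

open LaurentPolynomial Polynomial

variable {n : ℕ} {S : Type*} [CommRing S] [Algebra ℂ S]

theorem aeval_T_one {S : Type*} [CommRing S] (p : S[X]) : aeval (T 1 : S[T;T⁻¹]) p = toLaurent p := by
  have : (aeval (T 1 : S[T;T⁻¹]) : S[X] →ₐ[S] S[T;T⁻¹]) = toLaurentAlg := by
    ext; simp
  rw [this]; simp

/-- The value of `y` on the curve `2xy + v_N = 0`. -/
def laurentY (v : Fin (n + 1) → S) : S[T;T⁻¹] := -(LaurentPolynomial.C (halfLast v) * T (-1))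

theorem T_one_mul_laurentY (v : Fin (n + 1) → S) :
    T 1 * laurentY v = -algebraMap S S[T;T⁻¹] (halfLast v) := by
  rw [laurentY, ← LaurentPolynomial.C_eq_algebraMap, mul_neg, mul_left_comm, ← T_add]
  simp

/-- The restriction of `∂_xΛ` to the curve `2xy + v_N = 0`. -/
def laurentCrit (v : Fin (n + 1) → S) : S[T;T⁻¹] :=
  aeval (T 1 : S[T;T⁻¹]) (critPoly v).divX + laurentY v ^ 2

/-- The functions `1, x, …, x^{N-2}, y` on the curve `2xy + v_N = 0` are linearly independent
modulo `∂_xΛ`. -/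
theorem eq_zero_of_sum_eq_mul_laurentCrit [IsDomain S] (hn : n ≠ 0) {v : Fin (n + 1) → S}
    (hv : v (Fin.last n) ≠ 0) {b : Fin (n + 1) → S} {g : S[T;T⁻¹]}
    (h : ∑ k, algebraMap S S[T;T⁻¹] (b k) * monomialD (n + 1) (T 1) (laurentY v) k
      = g * laurentCrit v) : b = 0 := by
  have hv' : halfLast v ≠ 0 := fun h0 => hv (by rw [← two_mul_halfLast v, h0, mul_zero])
  obtain ⟨m, g₀, hg⟩ := exists_T_pow g
  set s : S[X] := ∑ k : Fin n, Polynomial.C (b k.castSucc) * X ^ ((k : ℕ) + 1)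
    - Polynomial.C (b (Fin.last n) * halfLast v) with hs
  set M : S[X] := X * critPoly v + Polynomial.C (halfLast v ^ 2) with hM
  -- Clearing denominators: s is x times the given combination and M is x² ∂_xΛ on the curve, while
  -- x^m makes g a polynomial.
  have key : X ^ m * (X * s) = g₀ * M := by
    apply toLaurent_injective
    have hc := congrArg toLaurent (X_mul_divX_critPoly hn v)
    simp only [map_mul, map_add, map_sub, map_sum, toLaurent_X, toLaurent_C, hs, hM, map_pow] at hc ⊢
    rw [Fin.sum_univ_castSucc, laurentCrit, aeval_T_one] at h
    simp only [monomialD_castSucc, monomialD_last, laurentY, ← LaurentPolynomial.C_eq_algebraMap] at h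
    have hT : (T 1 * T (-1) : S[T;T⁻¹]) = 1 := by rw [← T_add]; simp
    have hTm : (T (m : ℤ) : S[T;T⁻¹]) = T 1 ^ m := by rw [T_pow, mul_one]
    rw [hg, hTm]
    have hsum : ∑ x : Fin n, LaurentPolynomial.C (b x.castSucc) * T 1 ^ ((x : ℕ) + 1)
        = (∑ x : Fin n, LaurentPolynomial.C (b x.castSucc) * T 1 ^ (x : ℕ)) * T 1 := by
      rw [Finset.sum_mul]; exact Finset.sum_congr rfl fun _ _ => by ring
    rw [hsum, ← hc]
    linear_combination T 1 ^ m * T 1 ^ 2 * h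
      + (T 1 ^ m * T 1 * LaurentPolynomial.C (b (Fin.last n)) * LaurentPolynomial.C (halfLast v)
        + g * T 1 ^ m * LaurentPolynomial.C (halfLast v) ^ 2 * (T 1 * T (-1) + 1)) * hT
  -- The constant term of M is (v_N/2)² ≠ 0; hence all the powers of the prime x divide g₀.
  have hM0 : ¬ X ∣ M := by
    rw [X_dvd_iff, hM, coeff_add, coeff_X_mul_zero, coeff_C_zero, zero_add]
    exact pow_ne_zero _ hv'
  obtain ⟨g₁, hg₁⟩ : X ^ (m + 1) ∣ g₀ :=
    prime_X.pow_dvd_of_dvd_mul_right _ hM0 ⟨s, by rw [← key]; ring⟩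
  have key2 : s = g₁ * M := by
    have h2 : X ^ (m + 1) * s = X ^ (m + 1) * (g₁ * M) := by
      rw [← mul_assoc, ← hg₁, ← key]; ring
    exact mul_left_cancel₀ (pow_ne_zero _ X_ne_zero) h2
  have hMm : M.natDegree = n + 1 := by
    rw [hM, natDegree_add_C, natDegree_X_mul (critPoly_monic v).ne_zero, natDegree_critPoly]
  have hsd : s.natDegree ≤ n := by
    refine (natDegree_sub_C).le.trans ?_
    refine natDegree_sum_le_of_forall_le _ _ fun k _ => ?_
    exact (natDegree_C_mul_X_pow_le _ _).trans (by omega)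
  -- Now s is a multiple of M although deg s ≤ n < n + 1 = deg M.
  have hg0 : g₁ = 0 := by
    by_contra hne
    have hM0' : M ≠ 0 := fun h0 => by rw [h0] at hMm; simp at hMm
    have := natDegree_mul hne hM0'
    rw [← key2, hMm] at this
    omega
  rw [hg0, zero_mul] at key2
  funext k
  induction k using Fin.lastCases with
  | last =>
    have := congrArg (fun p => Polynomial.coeff p 0) key2
    simp [hs, hv'] at this
    exact this
  | cast k =>
    have := congrArg (fun p => Polynomial.coeff p (k + 1)) key2
    simp only [hs, coeff_sub, finsetSum_coeff, coeff_C_mul, coeff_X_pow, coeff_C_succ,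
      Polynomial.coeff_zero, sub_zero, add_left_inj, Fin.val_inj] at this
    simpa using this

end Laurent

end DSaito
end

noncomputable section
namespace DSaito

/-! ### Criteria for a family to span a quotient of a polynomial ring. -/

section Span

variable {S σ A ι : Type*} [CommRing S] [CommRing A] [Algebra S A]

/-- A submodule containing 1 and stable under the generators is an ideal containing 1. Thus a
multiplication table that closes up on a family proves that the family spans. -/
theorem top_le_of_mul_X_mem {π : MvPolynomial σ S →ₐ[S] A} (hπ : Function.Surjective π)
    {W : Submodule S A} (h1 : 1 ∈ W) (hX : ∀ i, ∀ a ∈ W, a * π (MvPolynomial.X i) ∈ W) :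
    ⊤ ≤ W := by
  intro a _
  obtain ⟨p, rfl⟩ := hπ a
  induction p using MvPolynomial.induction_on with
  | C a =>
    have : π (MvPolynomial.C a) = a • (1 : A) := by
      rw [Algebra.smul_def, mul_one]; exact π.commutes a
    rw [this]; exact W.smul_mem _ h1
  | add p q hp hq => rw [map_add]; exact W.add_mem (hp trivial) (hq trivial)
  | mul_X p i hp => rw [map_mul]; exact hX i _ (hp trivial)

theorem mul_mem_span {φ : ι → A} {b : A}
    (h : ∀ i, φ i * b ∈ Submodule.span S (Set.range φ)) {a : A}
    (ha : a ∈ Submodule.span S (Set.range φ)) : a * b ∈ Submodule.span S (Set.range φ) := by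
  induction ha using Submodule.span_induction with
  | mem a ha => obtain ⟨i, rfl⟩ := ha; exact h i
  | zero => rw [zero_mul]; exact Submodule.zero_mem _
  | add a a' _ _ h1 h2 => rw [add_mul]; exact Submodule.add_mem _ h1 h2
  | smul s a _ h1 => rw [smul_mul_assoc]; exact Submodule.smul_mem _ _ h1

theorem sum_smul_mem_span [Fintype ι] (φ : ι → A)
    (a : ι → S) : ∑ k, a k • φ k ∈ Submodule.span S (Set.range φ) :=
  Submodule.sum_mem _ fun k _ => Submodule.smul_mem _ _ (Submodule.subset_span ⟨k, rfl⟩)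

end Span

open MvPolynomial

/-! ### The algebra of the D_N-singularity. -/

section Saito

variable {n : ℕ} {S A : Type*} [CommRing S] [Algebra ℂ S] [CommRing A] [Algebra S A]

theorem monomialD_zero {R : Type*} [CommRing R] (hn : n ≠ 0) (x y : R) :
    monomialD (n + 1) x y 0 = 1 := by
  simp [monomialD, hn]

theorem monomialD_one {R : Type*} [CommRing R] (hn : 2 ≤ n) (x y : R) :
    monomialD (n + 1) x y (Fin.castSucc ⟨1, hn⟩) = x := by
  rw [monomialD_castSucc]; simp

theorem map_monomialD {R R' F : Type*} [CommRing R] [CommRing R'] [FunLike F R R']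
    [RingHomClass F R R'] (f : F) (x y : R) (k : Fin (n + 1)) :
    f (monomialD (n + 1) x y k) = monomialD (n + 1) (f x) (f y) k := by
  simp only [monomialD]; split_ifs <;> simp

/-- `A` is the quotient of `S[x, y]` by the derivatives of the unfolding. -/
structure IsJacobianAlgebra (v : Fin (n + 1) → S) (π : MvPolynomial (Fin 2) S →ₐ[S] A) : Prop where
  surjective : Function.Surjective π
  ker : ∀ f, π f = 0 ↔ f ∈ Ideal.span {pderiv 0 (unfoldingD (n + 1) 0 1 v),
    pderiv 1 (unfoldingD (n + 1) 0 1 v)}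

namespace IsJacobianAlgebra

variable {v : Fin (n + 1) → S} {π : MvPolynomial (Fin 2) S →ₐ[S] A}

theorem xy (h : IsJacobianAlgebra v π) :
    π (X 0) * π (X 1) = -algebraMap S A (halfLast v) := by
  have h1 : π (pderiv 1 (unfoldingD (n + 1) 0 1 v)) = 0 := (h.ker _).2 (Ideal.subset_span (by simp))
  have hC : ∀ a, π (C a) = algebraMap S A a := π.commutes
  rw [pderiv_unfoldingD_snd (by decide), ← two_mul_halfLast v] at h1
  simp only [map_add, map_mul, map_ofNat, hC] at h1
  have e := congrArg (algebraMap S A) (half_add_half S)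
  rw [map_add, map_one] at e
  linear_combination (algebraMap S A (algebraMap ℂ S (1 / 2))) * h1
    - (π (X 0) * π (X 1) + algebraMap S A (halfLast v)) * e

theorem crit [Nontrivial S] (h : IsJacobianAlgebra v π) (hn : n ≠ 0) :
    0 = Polynomial.aeval (π (X 0)) (critPoly v).divX + π (X 1) ^ 2 := by
  have h1 : π (pderiv 0 (unfoldingD (n + 1) 0 1 v)) = 0 := (h.ker _).2 (Ideal.subset_span (by simp))
  rw [pderiv_unfoldingD_fst hn (by decide), map_add, map_pow, ← Polynomial.aeval_algHom_apply] at h1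
  exact h1.symm

theorem monomialD_mul [Nontrivial S] (h : IsJacobianAlgebra v π) (hn : n ≠ 0) (i j : Fin (n + 1)) :
    monomialD (n + 1) (π (X 0)) (π (X 1)) i * monomialD (n + 1) (π (X 0)) (π (X 1)) j
      = ∑ k, mulCoord v i j k • monomialD (n + 1) (π (X 0)) (π (X 1)) k := by
  rw [DSaito.monomialD_mul hn h.xy (h.crit hn) i j]
  simp only [mul_zero, add_zero, Algebra.smul_def]

/-- Spanning follows from the multiplication table. For independence, x ↦ T, y ↦ -v_N/(2T) kills
∂_yΛ, so a relation becomes a multiple of ∂_xΛ on the curve. Nothing is lost over the ring of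
parameters, where v_N is not zero. -/
theorem isModuleBasis [IsDomain S] (h : IsJacobianAlgebra v π) (hn : 2 ≤ n)
    (hv : v (Fin.last n) ≠ 0) :
    IsModuleBasis S (monomialD (n + 1) (π (X 0)) (π (X 1))) := by
  have hn0 : n ≠ 0 := by omega
  constructor
  · rw [Fintype.linearIndependent_iff]
    intro b hb
    have h1 : π (∑ k, C (b k) * monomialD (n + 1) (X 0) (X 1) k) = 0 := by
      rw [← hb, map_sum]
      refine Finset.sum_congr rfl fun k _ => ?_
      rw [map_mul, Algebra.smul_def, map_monomialD]
      congr 1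
      exact π.commutes _
    rw [h.ker, Ideal.mem_span_pair] at h1
    obtain ⟨g₁, g₂, hg⟩ := h1
    let ψ : MvPolynomial (Fin 2) S →ₐ[S] LaurentPolynomial S :=
      aeval ![LaurentPolynomial.T 1, laurentY v]
    have hx : ψ (X 0) = LaurentPolynomial.T 1 := by simp [ψ]
    have hy : ψ (X 1) = laurentY v := by simp [ψ]
    have hC : ∀ a, ψ (C a) = algebraMap _ _ a := fun a => ψ.commutes a
    have h2 : ψ (pderiv 0 (unfoldingD (n + 1) 0 1 v)) = laurentCrit v := by
      rw [pderiv_unfoldingD_fst hn0 (by decide), map_add, map_pow, hy,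
        ← Polynomial.aeval_algHom_apply, hx]
      rfl
    have h3 : ψ (pderiv 1 (unfoldingD (n + 1) 0 1 v)) = 0 := by
      rw [pderiv_unfoldingD_snd (by decide), map_add, map_mul, map_mul, hx, hy, hC,
        ← two_mul_halfLast v, mul_assoc, T_one_mul_laurentY, map_mul]
      simp only [map_ofNat]
      ring
    have h4 := congrArg ψ hg
    rw [map_add, map_mul, map_mul, h2, h3, mul_zero, add_zero, map_sum] at h4
    refine congrFun (eq_zero_of_sum_eq_mul_laurentCrit (v := v) hn0 hv (g := ψ g₁) ?_)
    rw [h4]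
    refine Finset.sum_congr rfl fun k _ => ?_
    rw [map_mul, hC, map_monomialD, hx, hy]
  · have key : ∀ j, ∀ a ∈ Submodule.span S (Set.range (monomialD (n + 1) (π (X 0)) (π (X 1)))),
        a * monomialD (n + 1) (π (X 0)) (π (X 1)) j
          ∈ Submodule.span S (Set.range (monomialD (n + 1) (π (X 0)) (π (X 1)))) := by
      intro j a ha
      refine mul_mem_span (fun i => ?_) ha
      rw [h.monomialD_mul hn0]
      exact sum_smul_mem_span _ _
    refine top_le_of_mul_X_mem h.surjective (Submodule.subset_span ⟨0, monomialD_zero hn0 _ _⟩)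
      fun i a ha => ?_
    fin_cases i
    · have := key (Fin.castSucc ⟨1, hn⟩) a ha
      rwa [monomialD_one hn] at this
    · have := key (Fin.last n) a ha
      rwa [monomialD_last] at this

theorem structureConstant_eq [IsDomain S] (h : IsJacobianAlgebra v π) (hn : 2 ≤ n)
    (hv : v (Fin.last n) ≠ 0) (k i j : Fin (n + 1)) :
    structureConstant S (monomialD (n + 1) (π (X 0)) (π (X 1))) k i j = mulCoord v i j k :=
  DSaito.structureConstant_eq (h.isModuleBasis hn hv) (h.monomialD_mul (by omega) i j) k

end IsJacobianAlgebra

/-- The coordinates `v_1, …, v_N` as polynomials. -/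
abbrev paramX (n : ℕ) : Fin (n + 1) → Params (n + 1) := fun i => X i

theorem saitoBasis_eq (n : ℕ) :
    saitoBasis (n + 1) = monomialD (n + 1) (Ideal.Quotient.mkₐ (Params (n + 1)) _ (X 0))
      (Ideal.Quotient.mkₐ (Params (n + 1)) _ (X 1)) := by
  funext i
  exact map_monomialD (Ideal.Quotient.mk _) _ _ i

theorem isJacobianAlgebra_saito (n : ℕ) :
    IsJacobianAlgebra (A := SaitoAlgebra (n + 1)) (paramX n) (Ideal.Quotient.mkₐ _ _) :=
  ⟨Ideal.Quotient.mk_surjective, fun _ => Ideal.Quotient.eq_zero_iff_mem⟩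

theorem saitoBasis_isModuleBasis {N : ℕ} (hN : 3 ≤ N) :
    IsModuleBasis (Params N) (saitoBasis N) := by
  obtain ⟨n, rfl⟩ : ∃ n, N = n + 1 := ⟨N - 1, by omega⟩
  have hn : 2 ≤ n := by omega
  rw [saitoBasis_eq]
  exact (isJacobianAlgebra_saito n).isModuleBasis hn (X_ne_zero _)

theorem saitoStructureConstant_eq (hn : 2 ≤ n) (k i j : Fin (n + 1)) :
    structureConstant (Params (n + 1)) (saitoBasis (n + 1)) k i j = mulCoord (paramX n) i j k := by
  rw [saitoBasis_eq]
  exact (isJacobianAlgebra_saito n).structureConstant_eq hn (X_ne_zero _) k i j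

theorem saitoMul_eq (hn : 2 ≤ n) (k i j : Fin (n + 1)) (p : Fin (n + 1) → ℂ) :
    saitoMul (n + 1) k i j p = eval p (mulCoord (paramX n) i j k) := by
  rw [saitoMul, saitoStructureConstant_eq hn]

end Saito

/-! ### The extended algebra. -/

section Ext

variable {n : ℕ} {S A : Type*} [CommRing S] [Algebra ℂ S] [CommRing A] [Algebra S A]

/-- `s² / 2`, the value of `x` at `w`. -/
def extX (s : S) : S := algebraMap ℂ S (1 / 2) * s ^ 2

/-- `-v_N / s²`, the value of `y` at `w`, where `s t = 1`. -/
def extY (v : Fin (n + 1) → S) (t : S) : S := -(v (Fin.last n) * t ^ 2)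

theorem extX_mul_extY (v : Fin (n + 1) → S) {s t : S} (hst : s * t = 1) :
    extX s * extY v t = -halfLast v := by
  rw [extX, extY, halfLast]
  linear_combination (-(algebraMap ℂ S (1 / 2)) * v (Fin.last n) * (s * t + 1)) * hst

theorem two_mul_extX {s t : S} (hst : s * t = 1) : 2 * t ^ 2 * extX s = 1 := by
  rw [extX]
  linear_combination (t ^ 2 * s ^ 2) * half_add_half S + (s * t + 1) * hst

/-- The value of `∂_xΛ` at `w`. -/
def extCrit (v : Fin (n + 1) → S) (s t : S) : S :=
  Polynomial.eval (extX s) (critPoly v).divX + extY v t ^ 2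

/-- The coordinates of products in the basis `1, x, …, x^{N-2}, y, w`. -/
def extMulCoord (v : Fin (n + 1) → S) (s t : S) (i j : Fin (n + 1 + 1)) : Fin (n + 1 + 1) → S :=
  Fin.lastCases (motive := fun _ => Fin (n + 1 + 1) → S)
    (Fin.lastCases (motive := fun _ => Fin (n + 1 + 1) → S)
      (Fin.snoc 0 (s * extCrit v s t))
      (fun j => Fin.snoc 0 (monomialD (n + 1) (extX s) (extY v t) j)) j)
    (fun i => Fin.lastCases (motive := fun _ => Fin (n + 1 + 1) → S)
      (Fin.snoc 0 (monomialD (n + 1) (extX s) (extY v t) i))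
      (fun j => Fin.snoc (mulCoord v i j)
        (t * Polynomial.eval (extX s) (mulQuot v i j))) j) i

section

variable (v : Fin (n + 1) → S) (s t : S)

@[simp] theorem extMulCoord_last_last : extMulCoord v s t (Fin.last _) (Fin.last _)
    = Fin.snoc (α := fun _ => S) 0 (s * extCrit v s t) := by simp [extMulCoord]

@[simp] theorem extMulCoord_last_castSucc (j : Fin (n + 1)) :
    extMulCoord v s t (Fin.last _) j.castSucc
      = Fin.snoc (α := fun _ => S) 0 (monomialD (n + 1) (extX s) (extY v t) j) := by
  simp [extMulCoord]

@[simp] theorem extMulCoord_castSucc_last (i : Fin (n + 1)) :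
    extMulCoord v s t i.castSucc (Fin.last _)
      = Fin.snoc (α := fun _ => S) 0 (monomialD (n + 1) (extX s) (extY v t) i) := by
  simp [extMulCoord]

@[simp] theorem extMulCoord_castSucc_castSucc (i j : Fin (n + 1)) :
    extMulCoord v s t i.castSucc j.castSucc = Fin.snoc (α := fun _ => S)
      (mulCoord v i j) (t * Polynomial.eval (extX s) (mulQuot v i j)) := by
  simp [extMulCoord]

end

/-- `A` is the quotient of `S[x, y, w]` by `w - s ∂_xΛ`, `∂_yΛ` and `2wx - s²w`. -/
structure IsExtJacobianAlgebra (v : Fin (n + 1) → S) (s : S)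
    (π : MvPolynomial (Fin 3) S →ₐ[S] A) : Prop where
  surjective : Function.Surjective π
  ker : ∀ f, π f = 0 ↔ f ∈ Ideal.span {X 2 - C s * pderiv 0 (unfoldingD (n + 1) 0 1 v),
    pderiv 1 (unfoldingD (n + 1) 0 1 v), 2 * X 2 * X 0 - C s ^ 2 * X 2}

/-- The family `1, x, …, x^{N-2}, y, w`. -/
def extMonomial (n : ℕ) {R : Type*} [CommRing R] (x y w : R) : Fin (n + 1 + 1) → R :=
  Fin.snoc (α := fun _ => R) (monomialD (n + 1) x y) w

theorem extMonomial_castSucc {R : Type*} [CommRing R] (x y w : R) (i : Fin (n + 1)) :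
    extMonomial n x y w i.castSucc = monomialD (n + 1) x y i := by simp [extMonomial]

theorem extMonomial_last {R : Type*} [CommRing R] (x y w : R) :
    extMonomial n x y w (Fin.last _) = w := by simp [extMonomial]

namespace IsExtJacobianAlgebra

variable {v : Fin (n + 1) → S} {s t : S} {π : MvPolynomial (Fin 3) S →ₐ[S] A}

theorem xy (h : IsExtJacobianAlgebra v s π) :
    π (X 0) * π (X 1) = -algebraMap S A (halfLast v) := by
  have h1 : π (pderiv 1 (unfoldingD (n + 1) 0 1 v)) = 0 := (h.ker _).2 (Ideal.subset_span (by simp))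
  have hC : ∀ a, π (C a) = algebraMap S A a := π.commutes
  rw [pderiv_unfoldingD_snd (by decide), ← two_mul_halfLast v] at h1
  simp only [map_add, map_mul, map_ofNat, hC] at h1
  have e := congrArg (algebraMap S A) (half_add_half S)
  rw [map_add, map_one] at e
  linear_combination (algebraMap S A (algebraMap ℂ S (1 / 2))) * h1
    - (π (X 0) * π (X 1) + algebraMap S A (halfLast v)) * e

theorem crit [Nontrivial S] (h : IsExtJacobianAlgebra v s π) (hst : s * t = 1) (hn : n ≠ 0) :
    algebraMap S A t * π (X 2)
      = Polynomial.aeval (π (X 0)) (critPoly v).divX + π (X 1) ^ 2 := by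
  have h1 : π (X 2 - C s * pderiv 0 (unfoldingD (n + 1) 0 1 v)) = 0 :=
    (h.ker _).2 (Ideal.subset_span (by simp))
  have hC : ∀ a, π (C a) = algebraMap S A a := π.commutes
  rw [pderiv_unfoldingD_fst hn (by decide), map_sub, map_mul, map_add, map_pow,
    ← Polynomial.aeval_algHom_apply, hC] at h1
  have e := congrArg (algebraMap S A) hst
  rw [map_mul, map_one] at e
  linear_combination algebraMap S A t * h1
    + (Polynomial.aeval (π (X 0)) (critPoly v).divX + π (X 1) ^ 2) * e

theorem x_mul_w (h : IsExtJacobianAlgebra v s π) :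
    π (X 0) * π (X 2) = algebraMap S A (extX s) * π (X 2) := by
  have h1 : π (2 * X 2 * X 0 - C s ^ 2 * X 2) = 0 := (h.ker _).2 (Ideal.subset_span (by simp))
  have hC : ∀ a, π (C a) = algebraMap S A a := π.commutes
  simp only [map_sub, map_mul, map_pow, map_ofNat, hC] at h1
  have e := congrArg (algebraMap S A) (half_add_half S)
  rw [map_add, map_one] at e
  rw [extX, map_mul, map_pow]
  linear_combination (algebraMap S A (algebraMap ℂ S (1 / 2))) * h1 - π (X 0) * π (X 2) * e

/-- Evaluate xyw in two ways: xy is the scalar -v_N/2, and x acts on w by s²/2, which is invertible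
and can be cancelled. -/
theorem y_mul_w (h : IsExtJacobianAlgebra v s π) (hst : s * t = 1) :
    π (X 1) * π (X 2) = algebraMap S A (extY v t) * π (X 2) := by
  have h1 := h.xy
  have h2 := h.x_mul_w
  have h3 := congrArg (algebraMap S A) (extX_mul_extY v hst)
  have h5 := congrArg (algebraMap S A) (two_mul_extX hst)
  rw [map_mul, map_neg] at h3
  rw [map_mul, map_one] at h5
  linear_combination algebraMap S A (2 * t ^ 2) * (π (X 2) * h1
    - π (X 1) * h2 - π (X 2) * h3)
    - (π (X 1) * π (X 2) - algebraMap S A (extY v t) * π (X 2)) * h5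

theorem aeval_mul_w (h : IsExtJacobianAlgebra v s π) (q : Polynomial S) :
    Polynomial.aeval (π (X 0)) q * π (X 2)
      = algebraMap S A (Polynomial.eval (extX s) q) * π (X 2) := by
  induction q using Polynomial.induction_on' with
  | add p q hp hq => simp only [map_add, add_mul, hp, hq, Polynomial.eval_add]
  | monomial k a =>
    have h : ∀ k : ℕ, π (X 0) ^ k * π (X 2) = algebraMap S A (extX s) ^ k * π (X 2) := by
      intro k
      induction k with
      | zero => simp
      | succ k ih =>
        linear_combination π (X 0) * ih + algebraMap S A (extX s) ^ k * h.x_mul_w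
    simp only [Polynomial.aeval_monomial, Polynomial.eval_monomial, map_mul, map_pow, mul_assoc, h]

theorem monomialD_mul_w (h : IsExtJacobianAlgebra v s π) (hst : s * t = 1) (i : Fin (n + 1)) :
    monomialD (n + 1) (π (X 0)) (π (X 1)) i * π (X 2)
      = algebraMap S A (monomialD (n + 1) (extX s) (extY v t) i) * π (X 2) := by
  induction i using Fin.lastCases with
  | last => simp only [monomialD_last]; exact h.y_mul_w hst
  | cast i =>
    have := h.aeval_mul_w (Polynomial.X ^ (i : ℕ))
    simpa only [monomialD_castSucc, map_pow, Polynomial.aeval_X, Polynomial.eval_pow,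
      Polynomial.eval_X] using this

/-- The general table is used with L = w/s instead of L = 0. Since x acts on w by a scalar, the
polynomial multiplying L collapses to its value at that scalar. -/
theorem extMonomial_mul [Nontrivial S] (h : IsExtJacobianAlgebra v s π) (hst : s * t = 1)
    (hn : n ≠ 0) (i j : Fin (n + 1 + 1)) :
    extMonomial n (π (X 0)) (π (X 1)) (π (X 2)) i * extMonomial n (π (X 0)) (π (X 1)) (π (X 2)) j
      = ∑ k, extMulCoord v s t i j k • extMonomial n (π (X 0)) (π (X 1)) (π (X 2)) k := by
  rw [Fin.sum_univ_castSucc]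
  simp only [Algebra.smul_def]
  induction i using Fin.lastCases with
  | last =>
    induction j using Fin.lastCases with
    | last =>
      simp only [extMulCoord_last_last, Fin.snoc_castSucc, Fin.snoc_last, Pi.zero_apply, map_zero,
        zero_mul, Finset.sum_const_zero, zero_add, extMonomial_last]
      have e := congrArg (algebraMap S A) hst
      rw [map_mul, map_one] at e
      have h1 := h.crit hst hn
      have h2 := h.aeval_mul_w (critPoly v).divX
      have h3 := h.y_mul_w hst
      rw [map_mul, extCrit, map_add, map_pow]
      linear_combination -(π (X 2) ^ 2) * e + algebraMap S A s * π (X 2) * h1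
        + algebraMap S A s * (h2 + (π (X 1) + algebraMap S A (extY v t)) * h3)
    | cast j =>
      simp only [extMulCoord_last_castSucc, Fin.snoc_castSucc, Fin.snoc_last, Pi.zero_apply,
        map_zero, zero_mul, Finset.sum_const_zero, zero_add, extMonomial_last,
        extMonomial_castSucc]
      rw [mul_comm]
      exact h.monomialD_mul_w hst j
  | cast i =>
    induction j using Fin.lastCases with
    | last =>
      simp only [extMulCoord_castSucc_last, Fin.snoc_castSucc, Fin.snoc_last, Pi.zero_apply,
        map_zero, zero_mul, Finset.sum_const_zero, zero_add, extMonomial_last,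
        extMonomial_castSucc]
      exact h.monomialD_mul_w hst i
    | cast j =>
      simp only [extMulCoord_castSucc_castSucc, Fin.snoc_castSucc, Fin.snoc_last, extMonomial_last,
        extMonomial_castSucc]
      rw [DSaito.monomialD_mul hn h.xy (h.crit hst hn) i j, mul_left_comm, h.aeval_mul_w, map_mul,
        mul_assoc]

/-- On the curve, w is s ∂_xΛ, so modulo ∂_xΛ the coefficients of 1, …, y vanish as before. The
coefficient of w is then caught by dividing out ∂_xΛ and evaluating at x = s²/2, where the last
relation vanishes. -/
theorem isModuleBasis [IsDomain S] (h : IsExtJacobianAlgebra v s π) (hst : s * t = 1) (hn : 2 ≤ n)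
    (hv : v (Fin.last n) ≠ 0) :
    IsModuleBasis S (extMonomial n (π (X 0)) (π (X 1)) (π (X 2))) := by
  have hn0 : n ≠ 0 := by omega
  constructor
  · rw [Fintype.linearIndependent_iff]
    intro b hb
    rw [Fin.sum_univ_castSucc] at hb
    simp only [extMonomial_castSucc, extMonomial_last, Algebra.smul_def] at hb
    have hCπ : ∀ a, π (C a) = algebraMap S A a := π.commutes
    have h1 : π (∑ k : Fin (n + 1), C (b k.castSucc) * monomialD (n + 1) (X 0) (X 1) k
        + C (b (Fin.last _)) * X 2) = 0 := by
      rw [← hb, map_add, map_sum, map_mul, hCπ]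
      congr 1
      refine Finset.sum_congr rfl fun k _ => ?_
      rw [map_mul, map_monomialD, hCπ]
    rw [h.ker, Ideal.mem_span_insert] at h1
    obtain ⟨g₁, z, hz, hg⟩ := h1
    obtain ⟨g₂, g₃, rfl⟩ := Ideal.mem_span_pair.1 hz
    -- This homomorphism kills the first two relations, but not 2wx - s²w.
    let ψ : MvPolynomial (Fin 3) S →ₐ[S] LaurentPolynomial S :=
      aeval ![LaurentPolynomial.T 1, laurentY v, algebraMap _ _ s * laurentCrit v]
    have hx : ψ (X 0) = LaurentPolynomial.T 1 := by simp [ψ]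
    have hy : ψ (X 1) = laurentY v := by simp [ψ]
    have hw : ψ (X 2) = algebraMap _ _ s * laurentCrit v := by simp [ψ]
    have hC : ∀ a, ψ (C a) = algebraMap _ _ a := fun a => ψ.commutes a
    have h2 : ψ (pderiv 0 (unfoldingD (n + 1) 0 1 v)) = laurentCrit v := by
      rw [pderiv_unfoldingD_fst hn0 (by decide), map_add, map_pow, hy,
        ← Polynomial.aeval_algHom_apply, hx]
      rfl
    have h3 : ψ (pderiv 1 (unfoldingD (n + 1) 0 1 v)) = 0 := by
      rw [pderiv_unfoldingD_snd (by decide), map_add, map_mul, map_mul, hx, hy, hC,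
        ← two_mul_halfLast v, mul_assoc, T_one_mul_laurentY, map_mul]
      simp only [map_ofNat]
      ring
    have h4 := congrArg ψ hg
    simp only [map_add, map_sub, map_mul, map_pow, map_sum, h2, h3, mul_zero, zero_add, hC, hx, hw,
      sub_self, map_ofNat, map_monomialD, hy] at h4
    have h6 := eq_zero_of_sum_eq_mul_laurentCrit (v := v) hn0 hv
      (b := fun k => b k.castSucc)
      (g := ψ g₃ * (2 * LaurentPolynomial.T 1 - algebraMap _ _ s ^ 2) * algebraMap _ _ s
        - algebraMap _ _ (b (Fin.last _)) * algebraMap _ _ s) (by linear_combination h4)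
    have h7 : ∀ k : Fin (n + 1), b k.castSucc = 0 := fun k => congrFun h6 k
    intro k
    induction k using Fin.lastCases with
    | cast k => exact h7 k
    | last =>
      simp only [h7, map_zero, zero_mul, Finset.sum_const_zero, zero_add] at h4
      -- x² times this element is a polynomial with constant term (v_N/2)².
      have hcrit : laurentCrit v ≠ 0 := by
        intro h
        have h8 : Polynomial.toLaurent
            (Polynomial.X ^ 2 * (critPoly v).divX + Polynomial.C (halfLast v ^ 2)) = 0 := by
          rw [laurentCrit, aeval_T_one] at h
          have h9 := T_one_mul_laurentY v
          rw [← LaurentPolynomial.C_eq_algebraMap] at h9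
          simp only [map_add, map_mul, map_pow, Polynomial.toLaurent_X, Polynomial.toLaurent_C]
          linear_combination LaurentPolynomial.T 1 ^ 2 * h
            - (LaurentPolynomial.T 1 * laurentY v - LaurentPolynomial.C (halfLast v)) * h9
        rw [Polynomial.toLaurent_eq_zero] at h8
        have h9 := congrArg (fun p => Polynomial.coeff p 0) h8
        simp only [Polynomial.coeff_add, Polynomial.mul_coeff_zero, Polynomial.coeff_X_pow,
          Polynomial.coeff_C_zero, Polynomial.coeff_zero] at h9
        norm_num at h9
        exact hv (by rw [← two_mul_halfLast v, h9, mul_zero])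
      have e := congrArg (algebraMap S (LaurentPolynomial S)) hst
      rw [map_mul, map_one] at e
      have h8 : algebraMap _ _ (b (Fin.last _))
          = ψ g₃ * (2 * LaurentPolynomial.T 1 - algebraMap _ _ s ^ 2) := by
        refine mul_right_cancel₀ hcrit ?_
        linear_combination algebraMap _ _ t * h4 - (algebraMap _ _ (b (Fin.last _)) - ψ g₃ *
          (2 * LaurentPolynomial.T 1 - algebraMap _ _ s ^ 2)) * laurentCrit v * e
      -- Evaluation of Laurent polynomials requires a unit, and s²/2 is one because s is inverted.
      have hxu : IsUnit (extX s) := IsUnit.of_mul_eq_one _ ((mul_comm _ _).trans (two_mul_extX hst))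
      have h9 := congrArg (fun f => LaurentPolynomial.eval₂ (RingHom.id _) hxu.unit f) h8
      simp only [← LaurentPolynomial.C_eq_algebraMap, LaurentPolynomial.eval₂_C, map_mul,
        map_sub, map_pow, map_ofNat, LaurentPolynomial.eval₂_T, zpow_one, IsUnit.unit_spec,
        RingHom.id_apply] at h9
      have h10 : extX s = algebraMap ℂ S (1 / 2) * s ^ 2 := rfl
      linear_combination h9 + (LaurentPolynomial.eval₂ (RingHom.id _) hxu.unit (ψ g₃))
        * (2 * h10 + s ^ 2 * half_add_half S)
  · have key : ∀ j, ∀ a ∈ Submodule.span S (Set.range (extMonomial n (π (X 0)) (π (X 1)) (π (X 2)))),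
        a * (extMonomial n (π (X 0)) (π (X 1)) (π (X 2))) j ∈ Submodule.span S (Set.range (extMonomial n (π (X 0)) (π (X 1)) (π (X 2)))) := by
      intro j a ha
      refine mul_mem_span (fun i => ?_) ha
      rw [h.extMonomial_mul hst hn0]
      exact sum_smul_mem_span _ _
    refine top_le_of_mul_X_mem h.surjective (Submodule.subset_span ⟨Fin.castSucc 0, ?_⟩)
      fun i a ha => ?_
    · rw [extMonomial_castSucc, monomialD_zero hn0]
    · fin_cases i
      · have := key (Fin.castSucc (Fin.castSucc ⟨1, hn⟩)) a ha
        rwa [extMonomial_castSucc, monomialD_one hn] at this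
      · have := key (Fin.castSucc (Fin.last n)) a ha
        rwa [extMonomial_castSucc, monomialD_last] at this
      · have := key (Fin.last _) a ha
        rwa [extMonomial_last] at this

theorem structureConstant_eq [IsDomain S] (h : IsExtJacobianAlgebra v s π) (hst : s * t = 1)
    (hn : 2 ≤ n) (hv : v (Fin.last n) ≠ 0) (k i j : Fin (n + 1 + 1)) :
    structureConstant S (extMonomial n (π (X 0)) (π (X 1)) (π (X 2))) k i j
      = extMulCoord v s t i j k :=
  DSaito.structureConstant_eq (h.isModuleBasis hst hn hv) (h.extMonomial_mul hst (by omega) i j) k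

end IsExtJacobianAlgebra

/-- The coordinates `v_1, …, v_N` as elements of `ℂ[v_1, …, v_N, v_{N+1}^{±1}]`. -/
abbrev extV (n : ℕ) : Fin (n + 1) → ExtParams (n + 1) := fun i => extParam (n + 1) i.castSucc

/-- `v_{N+1}` -/
abbrev extS (n : ℕ) : ExtParams (n + 1) := extParam (n + 1) (Fin.last (n + 1))

/-- `v_{N+1}⁻¹` -/
def extSInv (n : ℕ) : ExtParams (n + 1) :=
  IsLocalization.Away.invSelf (X (Fin.last (n + 1)) : MvPolynomial (Fin (n + 1 + 1)) ℂ)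

theorem extS_mul_inv (n : ℕ) : extS n * extSInv n = 1 :=
  IsLocalization.Away.mul_invSelf _

instance : IsDomain (ExtParams (n + 1)) :=
  IsLocalization.isDomain_localization (powers_le_nonZeroDivisors_of_noZeroDivisors (X_ne_zero _))

theorem extParam_ne_zero (i : Fin (n + 1 + 1)) : extParam (n + 1) i ≠ 0 := by
  intro h
  have hinj : Function.Injective
      (algebraMap (MvPolynomial (Fin (n + 1 + 1)) ℂ) (ExtParams (n + 1))) :=
    IsLocalization.injective _ (powers_le_nonZeroDivisors_of_noZeroDivisors
      (X_ne_zero (Fin.last (n + 1))))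
  exact X_ne_zero i (hinj (h.trans (map_zero _).symm))

theorem extBasis_eq (n : ℕ) :
    extBasis (n + 1) = extMonomial n (Ideal.Quotient.mkₐ (ExtParams (n + 1)) _ (X 0))
      (Ideal.Quotient.mkₐ (ExtParams (n + 1)) _ (X 1))
      (Ideal.Quotient.mkₐ (ExtParams (n + 1)) _ (X 2)) := by
  have h : ∀ i : Fin (n + 1), (Ideal.Quotient.mk _ (monomialD (n + 1) (X 0) (X 1) i)
      : ExtAlgebra (n + 1)) = monomialD (n + 1) (Ideal.Quotient.mk _ (X 0))
        (Ideal.Quotient.mk _ (X 1)) i := fun i => map_monomialD (Ideal.Quotient.mk _) _ _ i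
  rw [extBasis, funext h]
  rfl

theorem isExtJacobianAlgebra_ext (n : ℕ) :
    IsExtJacobianAlgebra (A := ExtAlgebra (n + 1)) (extV n) (extS n) (Ideal.Quotient.mkₐ _ _) :=
  ⟨Ideal.Quotient.mk_surjective, fun _ => Ideal.Quotient.eq_zero_iff_mem⟩

theorem extBasis_isModuleBasis {N : ℕ} (hN : 3 ≤ N) :
    IsModuleBasis (ExtParams N) (extBasis N) := by
  obtain ⟨n, rfl⟩ : ∃ n, N = n + 1 := ⟨N - 1, by omega⟩
  have hn : 2 ≤ n := by omega
  rw [extBasis_eq]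
  exact (isExtJacobianAlgebra_ext n).isModuleBasis (extS_mul_inv n) hn (extParam_ne_zero _)

theorem extStructureConstant_eq (hn : 2 ≤ n) (k i j : Fin (n + 1 + 1)) :
    structureConstant (ExtParams (n + 1)) (extBasis (n + 1)) k i j
      = extMulCoord (extV n) (extS n) (extSInv n) i j k := by
  rw [extBasis_eq]
  exact (isExtJacobianAlgebra_ext n).structureConstant_eq (extS_mul_inv n) hn
    (extParam_ne_zero _) k i j

end Ext

end DSaito
end

noncomputable section
namespace DSaito

open MvPolynomial

variable {n : ℕ}

/-! ### Weighted homogeneous parts of an exponential-type series. -/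

section WeightedExponential

/-- The weights `N - i` of `v_1, …, v_{N-1}` and the weight `N` of `-v_N² / 4`. -/
def paramWeight (n : ℕ) (k : Fin (n + 1)) : ℕ :=
  Fin.lastCases (motive := fun _ => ℕ) (n + 1) (fun k => n - k) k

@[simp] theorem paramWeight_last : paramWeight n (Fin.last n) = n + 1 := by simp [paramWeight]

@[simp] theorem paramWeight_castSucc (k : Fin n) : paramWeight n k.castSucc = n - k := by
  simp [paramWeight]

theorem paramWeight_ne_zero (k : Fin (n + 1)) : paramWeight n k ≠ 0 := by
  induction k using Fin.lastCases with
  | last => simp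
  | cast k => simp only [paramWeight_castSucc]; omega

/-- The coefficients `∏_k (-(2γ - 1 + 2k(N-1)) / 2)` of the flat coordinates, extended by two steps
to the left, where `g = γ - 1`. -/
def expCoeff (n g q : ℕ) : ℂ :=
  (∏ j ∈ Finset.range q, -(((j : ℂ) - 2) * n + g + 1 / 2))
    / ∏ j ∈ Finset.range 2, -(((j : ℂ) - 2) * n + g + 1 / 2)

theorem expCoeff_succ (n g q : ℕ) :
    expCoeff n g (q + 1) = -(((q : ℂ) - 2) * n + g + 1 / 2) * expCoeff n g q := by
  simp only [expCoeff, Finset.prod_range_succ]; ring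

/-- 2z + 1 is odd. This keeps the normalizing denominator of `expCoeff` different from zero. -/
theorem add_half_ne_zero (z : ℤ) : (z : ℂ) + 1 / 2 ≠ 0 := by
  intro h
  have h1 : ((2 * z + 1 : ℤ) : ℂ) = 0 := by push_cast; linear_combination 2 * h
  have := Int.cast_eq_zero.1 h1
  omega

theorem expCoeff_two (n g : ℕ) : expCoeff n g 2 = 1 := by
  refine div_self (Finset.prod_ne_zero_iff.2 fun j _ => neg_ne_zero.2 ?_)
  have := add_half_ne_zero (((j : ℤ) - 2) * n + g)
  push_cast at this
  exact this

/-- The component of weight `m` of `∑_a B_{|a|+r} X^a / a!`. -/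
def expPart (n g r : ℕ) (m : ℤ) : MvPolynomial (Fin (n + 1)) ℂ :=
  ∑ a ∈ (Finsupp.finite_of_nat_weight_le (paramWeight n) paramWeight_ne_zero m.toNat).toFinset.filter
      fun a => (Finsupp.weight (paramWeight n) a : ℤ) = m,
    monomial a (expCoeff n g (a.degree + r) / ∏ i, ((a i).factorial : ℂ))

theorem coeff_expPart (n g r : ℕ) (m : ℤ) (a : Fin (n + 1) →₀ ℕ) :
    coeff a (expPart n g r m) = if (Finsupp.weight (paramWeight n) a : ℤ) = m then
      expCoeff n g (a.degree + r) / ∏ i, ((a i).factorial : ℂ) else 0 := by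
  classical
  simp only [expPart, coeff_sum, coeff_monomial, Finset.sum_ite_eq']
  by_cases h : (Finsupp.weight (paramWeight n) a : ℤ) = m
  · rw [if_pos h, if_pos]
    simp only [Finset.mem_filter, Set.Finite.mem_toFinset, Set.mem_ofPred_eq, h, and_true]
    omega
  · rw [if_neg h, if_neg]
    simp [h]

/-- Differentiating X^a/a! lowers a_k by one. The drop of |a| is compensated by raising r, and the
weight decreases by that of the variable. -/
theorem pderiv_expPart (n g r : ℕ) (m : ℤ) (k : Fin (n + 1)) :
    pderiv k (expPart n g r m) = expPart n g (r + 1) (m - paramWeight n k) := by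
  ext a
  have hw : (Finsupp.weight (paramWeight n) (a + Finsupp.single k 1) : ℤ) = m ↔
      (Finsupp.weight (paramWeight n) a : ℤ) = m - paramWeight n k := by
    rw [map_add, Finsupp.weight_single]
    push_cast
    simp only [smul_eq_mul, one_mul]
    omega
  have hf : ∏ i, ((((a + Finsupp.single k 1 : Fin (n + 1) →₀ ℕ) i).factorial : ℕ) : ℂ)
      = (a k + 1) * ∏ i, ((a i).factorial : ℂ) := by
    rw [← Finset.mul_prod_erase _ _ (Finset.mem_univ k),
      ← Finset.mul_prod_erase Finset.univ (fun i => ((a i).factorial : ℂ)) (Finset.mem_univ k),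
      ← mul_assoc]
    congr 1
    · simp [Nat.factorial_succ]
    · refine Finset.prod_congr rfl fun i hi => ?_
      rw [Finsupp.add_apply, Finsupp.single_eq_of_ne (Finset.ne_of_mem_erase hi), add_zero]
  rw [coeff_pderiv, coeff_expPart, coeff_expPart]
  simp only [hw]
  split_ifs
  · rw [hf, map_add, Finsupp.degree_single, add_right_comm, add_assoc _ r 1]
    have h1 : (a k : ℂ) + 1 ≠ 0 := by exact_mod_cast Nat.succ_ne_zero (a k)
    have h2 : ∏ i, ((a i).factorial : ℂ) ≠ 0 :=
      Finset.prod_ne_zero_iff.2 fun i _ => by exact_mod_cast Nat.factorial_ne_zero _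
    field_simp
  · simp

theorem weight_paramWeight (a : Fin (n + 1) →₀ ℕ) :
    (Finsupp.weight (paramWeight n) a : ℂ)
      = n * a.degree - ∑ i : Fin n, (i : ℕ) * (a i.castSucc : ℂ) + a (Fin.last n) := by
  rw [Finsupp.weight_apply, Finsupp.sum_fintype _ _ (by simp), Finsupp.degree_eq_sum,
    Fin.sum_univ_castSucc, Fin.sum_univ_castSucc]
  simp only [paramWeight_castSucc, paramWeight_last, smul_eq_mul]
  have h : ∑ i : Fin n, (a i.castSucc : ℂ) * ((n - (i : ℕ) : ℕ) : ℂ)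
      = n * ∑ i : Fin n, (a i.castSucc : ℂ) - ∑ i : Fin n, (i : ℕ) * (a i.castSucc : ℂ) := by
    rw [Finset.mul_sum, ← Finset.sum_sub_distrib]
    refine Finset.sum_congr rfl fun i _ => ?_
    rw [Nat.cast_sub i.2.le]; ring
  push_cast
  rw [h]
  ring

/-- The Euler relation and the recursion of the coefficients combined. -/
theorem expPart_relation (n g r : ℕ) (m : ℤ) :
    C ((m : ℂ) + ((r : ℂ) - 2) * n + g + 1 / 2) * expPart n g r m =
      -(expPart n g (r + 1) m
        + ∑ i : Fin n, C ((i : ℕ) : ℂ) * (X i.castSucc * expPart n g (r + 1) (m - n + i))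
        - X (Fin.last n) * expPart n g (r + 1) (m - n - 1)) := by
  have h1 : ∀ i : Fin n, X i.castSucc * expPart n g (r + 1) (m - n + i)
      = X i.castSucc * pderiv i.castSucc (expPart n g r m) := by
    intro i
    rw [pderiv_expPart, paramWeight_castSucc, Nat.cast_sub i.2.le]
    congr 2; ring
  have h2 : X (Fin.last n) * expPart n g (r + 1) (m - n - 1)
      = X (Fin.last n) * pderiv (Fin.last n) (expPart n g r m) := by
    rw [pderiv_expPart, paramWeight_last]
    congr 2; push_cast; ring
  rw [h2]
  simp only [h1]
  ext a
  simp only [coeff_C_mul, coeff_neg, coeff_sub, coeff_add, coeff_sum, coeff_X_mul_pderiv,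
    coeff_expPart]
  by_cases h : (Finsupp.weight (paramWeight n) a : ℤ) = m
  -- On a monomial X^a the operators X_i ∂_i act by a_i, so the right-hand side is the recursion of
  -- `expCoeff` at |a| + r plus Σ i a_i - a_N. The weight n|a| - Σ i a_i + a_N supplies precisely
  -- this correction.
  · simp only [h, if_true, ← mul_assoc, ← Finset.sum_mul]
    have hm : (m : ℂ) = (Finsupp.weight (paramWeight n) a : ℂ) := by rw [← h]; simp
    rw [hm, weight_paramWeight, ← add_assoc a.degree r 1, expCoeff_succ]
    push_cast
    ring
  · simp [h]

end WeightedExponential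

/-! ### Substituting -v_N²/4 for the variable of weight N. -/

section Substitution

/-- The substitution `v_i ↦ v_i` for `i < N` and `v_N ↦ -v_N² / 4`. -/
def substLast (n : ℕ) : MvPolynomial (Fin (n + 1)) ℂ →ₐ[ℂ] Params (n + 1) :=
  aeval (Fin.snoc (α := fun _ => Params (n + 1)) (fun i => X i.castSucc) (-halfLast (paramX n) ^ 2))

@[simp] theorem substLast_X_castSucc (i : Fin n) : substLast n (X i.castSucc) = X i.castSucc := by
  simp [substLast]

@[simp] theorem substLast_X_last : substLast n (X (Fin.last n)) = -halfLast (paramX n) ^ 2 := by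
  simp [substLast]

theorem substLast_C (a : ℂ) : substLast n (C a) = C a := (substLast n).commutes a

theorem halfLast_paramX (n : ℕ) : halfLast (paramX n) = C (1 / 2) * X (Fin.last n) := rfl

theorem pderiv_castSucc_halfLast (i : Fin n) : pderiv i.castSucc (halfLast (paramX n)) = 0 := by
  rw [halfLast_paramX, pderiv_C_mul, pderiv_X_of_ne (Fin.castSucc_lt_last i).ne', mul_zero]

theorem pderiv_last_halfLast : pderiv (Fin.last n) (halfLast (paramX n)) = C (1 / 2) := by
  rw [halfLast_paramX, pderiv_C_mul, pderiv_X_self, mul_one]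

theorem pderiv_castSucc_substLast (i : Fin n) (f : MvPolynomial (Fin (n + 1)) ℂ) :
    pderiv i.castSucc (substLast n f) = substLast n (pderiv i.castSucc f) := by
  classical
  induction f using MvPolynomial.induction_on with
  | C a => simp
  | add f g hf hg => simp only [map_add, hf, hg]
  | mul_X f j hf =>
    rw [map_mul, pderiv_mul, hf, pderiv_mul, map_add, map_mul, map_mul]
    congr 2
    induction j using Fin.lastCases with
    | last =>
      rw [substLast_X_last, pderiv_X_of_ne (Fin.castSucc_lt_last i).ne', map_neg, pderiv_pow,
        pderiv_castSucc_halfLast]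
      simp
    | cast j =>
      rw [substLast_X_castSucc, pderiv_X]
      by_cases h : i.castSucc = j.castSucc
      · rw [h]; simp
      · rw [Pi.single_eq_of_ne' h]; simp

/-- Chain rule: the derivative of -v_N²/4 is -v_N/2. -/
theorem pderiv_last_substLast (f : MvPolynomial (Fin (n + 1)) ℂ) :
    pderiv (Fin.last n) (substLast n f)
      = -halfLast (paramX n) * substLast n (pderiv (Fin.last n) f) := by
  classical
  induction f using MvPolynomial.induction_on with
  | C a => simp
  | add f g hf hg => simp only [map_add, hf, hg, mul_add]
  | mul_X f j hf =>
    rw [map_mul, pderiv_mul, hf, pderiv_mul, map_add, map_mul, map_mul]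
    have h : pderiv (Fin.last n) (substLast n (X j))
        = -halfLast (paramX n) * substLast n (pderiv (Fin.last n) (X j)) := by
      induction j using Fin.lastCases with
      | last =>
        rw [substLast_X_last, pderiv_X_self, map_neg, pderiv_pow, pderiv_last_halfLast, map_one]
        have : (C (1 / 2) + C (1 / 2) : Params (n + 1)) = 1 := half_add_half _
        push_cast
        linear_combination -(halfLast (paramX n)) * this
      | cast j =>
        rw [substLast_X_castSucc, pderiv_X_of_ne (Fin.castSucc_lt_last j).ne]; simp
    rw [h]; ring

end Substitution

/-! ### Residues of powers of the superpotential and their covariant Hessian. -/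

section Residues

/-- The residue at infinity of `x^k` times a power of the superpotential. -/
def residue (n g r : ℕ) (k : ℤ) : Params (n + 1) :=
  substLast n (expPart n g r (k + 2 * n - g - r * n))

/-- Formally `residue n g r k` is a fixed normalization of Res x^{k-1/2} f^{(r)}(λ) dx, where f is a
multiple of λ^p with p = 2 - (2g+1)/(2n) and λ = x^n/n + Σ v_i x^i - v_N²/(4x). Expanding around
x^n/n gives the coefficients `expCoeff`, and the weight is fixed by the power of x. As ∂λ/∂v_i = x^i
(indices from 0), differentiation raises r by 1 and k by i. -/
theorem pderiv_castSucc_residue (g r : ℕ) (k : ℤ) (i : Fin n) :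
    pderiv i.castSucc (residue n g r k) = residue n g (r + 1) (k + i) := by
  rw [residue, pderiv_castSucc_substLast, pderiv_expPart, residue, paramWeight_castSucc,
    Nat.cast_sub i.2.le]
  congr 2; push_cast; ring

/-- Here ∂λ/∂v_N = -v_N/(2x), which is y on the curve. -/
theorem pderiv_last_residue (g r : ℕ) (k : ℤ) :
    pderiv (Fin.last n) (residue n g r k)
      = -halfLast (paramX n) * residue n g (r + 1) (k - 1) := by
  rw [residue, pderiv_last_substLast, pderiv_expPart, residue, paramWeight_last]
  congr 3; push_cast; ring

/-- The total derivative of x^{k-1/2} f^{(r)}(λ) has no residue; the right-hand side is the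
expansion of λ'. -/
theorem residue_relation (g r : ℕ) (k : ℤ) :
    C ((k : ℂ) - 1 / 2) * residue n g r (k - 1) =
      -(residue n g (r + 1) (k - 1 + n)
        + ∑ i : Fin n, ((i : ℕ) : Params (n + 1)) * (X i.castSucc * residue n g (r + 1) (k - 1 + i))
        + halfLast (paramX n) ^ 2 * residue n g (r + 1) (k - 2)) := by
  have e1 : ((((k - 1 + 2 * n - g - r * n : ℤ)) : ℂ) + ((r : ℂ) - 2) * n + g + 1 / 2)
      = (k : ℂ) - 1 / 2 := by push_cast; ring
  have h := expPart_relation n g r (k - 1 + 2 * n - g - r * n)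
  rw [e1] at h
  generalize (k : ℂ) - 1 / 2 = c at h ⊢
  replace h := congrArg (substLast n) h
  simp only [map_mul, map_neg, map_add, map_sub, map_sum, substLast_C, substLast_X_castSucc,
    substLast_X_last, map_natCast] at h
  simp only [residue]
  have e2 : k - 1 + (n : ℤ) + 2 * n - g - ((r + 1 : ℕ) : ℤ) * n
      = k - 1 + 2 * n - g - r * n := by push_cast; ring
  have e3 : k - 2 + 2 * (n : ℤ) - g - ((r + 1 : ℕ) : ℤ) * n
      = k - 1 + 2 * n - g - r * n - n - 1 := by push_cast; ring
  have e4 : ∀ i : Fin n, k - 1 + ((i : ℕ) : ℤ) + 2 * (n : ℤ) - g - ((r + 1 : ℕ) : ℤ) * n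
      = k - 1 + 2 * n - g - r * n - n + i := by intro i; push_cast; ring
  simp only [e2, e3, e4]
  rw [h]
  ring

/-- The linear extension of `residue` to Laurent polynomials in `x`. -/
def residueLaurent (n g r : ℕ) : LaurentPolynomial (Params (n + 1)) →ₗ[Params (n + 1)] Params (n + 1) :=
  Finsupp.linearCombination (Params (n + 1)) (residue n g r)
    ∘ₗ (AddMonoidAlgebra.coeffLinearEquiv (Params (n + 1))).toLinearMap

open LaurentPolynomial in
theorem residueLaurent_C_mul_T (g r : ℕ) (a : Params (n + 1)) (k : ℤ) :
    residueLaurent n g r (LaurentPolynomial.C a * T k) = a * residue n g r k := by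
  rw [← single_eq_C_mul_T, residueLaurent, LinearMap.comp_apply]
  change Finsupp.linearCombination _ _ (Finsupp.single k a) = _
  simp

open LaurentPolynomial in
theorem residueLaurent_T (g r : ℕ) (k : ℤ) :
    residueLaurent n g r (T k) = residue n g r k := by
  have := residueLaurent_C_mul_T (n := n) g r 1 k
  rwa [map_one, one_mul, one_mul] at this

open LaurentPolynomial in
theorem laurentCrit_eq (hn : n ≠ 0) : laurentCrit (paramX n) = T ((n : ℤ) - 1)
    + ∑ i : Fin n, LaurentPolynomial.C (((i : ℕ) : Params (n + 1)) * X i.castSucc) * T ((i : ℤ) - 1)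
    + LaurentPolynomial.C (halfLast (paramX n) ^ 2) * T (-2) := by
  have h := congrArg Polynomial.toLaurent (X_mul_divX_critPoly hn (paramX n))
  have hT : (T (-1) * T 1 : LaurentPolynomial (Params (n + 1))) = 1 := by rw [← T_add]; simp
  rw [map_mul, Polynomial.toLaurent_X] at h
  conv_rhs at h => rw [critPoly]
  simp only [map_add, map_sum, Polynomial.toLaurent_X_pow, Polynomial.toLaurent_C_mul_X_pow] at h
  rw [laurentCrit, aeval_T_one, laurentY, neg_sq, mul_pow, T_pow, map_pow]
  have h2 : Polynomial.toLaurent (critPoly (paramX n)).divX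
      = T (-1) * (T (n : ℤ) + ∑ i : Fin n,
        LaurentPolynomial.C (((i : ℕ) : Params (n + 1)) * X i.castSucc) * T (i : ℤ)) := by
    rw [← h, ← mul_assoc, hT, one_mul]
  have h3 : ∀ k : ℤ, (T (-1) * T k : LaurentPolynomial (Params (n + 1))) = T (k - 1) := by
    intro k; rw [← T_add]; congr 1; ring
  rw [h2, mul_add, h3, Finset.mul_sum]
  simp only [mul_left_comm _ (LaurentPolynomial.C _), h3]
  rfl

/-- Integration by parts. -/
theorem residueLaurent_mul_crit (hn : n ≠ 0) (g r : ℕ) (q : Polynomial (Params (n + 1))) :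
    residueLaurent n g (r + 1) (Polynomial.toLaurent q * laurentCrit (paramX n))
      = -q.sum fun k a => a * (C ((k : ℂ) - 1 / 2) * residue n g r (k - 1)) := by
  induction q using Polynomial.induction_on' with
  | add p q hp hq =>
    rw [map_add, add_mul, map_add, hp, hq, Polynomial.sum_add_index]
    · ring
    · simp
    · intro k a b; ring
  | monomial k a =>
    have hr := residue_relation (n := n) g r (k : ℤ)
    rw [Int.cast_natCast] at hr
    rw [Polynomial.sum_monomial_index _ _ (by simp), hr, ← Polynomial.C_mul_X_pow_eq_monomial,
      Polynomial.toLaurent_C_mul_X_pow, laurentCrit_eq hn]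
    simp only [mul_add, Finset.mul_sum, map_add, map_sum]
    have h : ∀ (b : Params (n + 1)) (m : ℤ), residueLaurent n g (r + 1)
        (LaurentPolynomial.C a * LaurentPolynomial.T (k : ℤ)
          * (LaurentPolynomial.C b * LaurentPolynomial.T m))
        = a * b * residue n g (r + 1) (k + m) := by
      intro b m
      rw [mul_mul_mul_comm, ← map_mul, ← LaurentPolynomial.T_add, residueLaurent_C_mul_T]
    have h1 := h 1 ((n : ℤ) - 1)
    rw [map_one, one_mul] at h1
    rw [h1]
    simp only [h]
    rw [mul_neg, neg_neg]
    simp only [mul_add, Finset.mul_sum]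
    refine congrArg₂ _ (congrArg₂ _ ?_ ?_) ?_
    · rw [mul_one, show (k : ℤ) + ((n : ℤ) - 1) = k - 1 + n by ring]
    · refine Finset.sum_congr rfl fun i _ => ?_
      rw [show (k : ℤ) + ((i : ℤ) - 1) = k - 1 + i by ring]; ring
    · rw [show (k : ℤ) + (-2) = k - 2 by ring]; ring

/-- The Christoffel symbols of the flat coordinates. -/
def flatChristoffel (n : ℕ) (k i j : Fin (n + 1)) : Params (n + 1) :=
  Fin.lastCases (motive := fun _ => Params (n + 1)) 0
    (fun i => Fin.lastCases (motive := fun _ => Params (n + 1)) 0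
      (fun j => Fin.lastCases (motive := fun _ => Params (n + 1)) 0
        (fun k => -(C (((k : ℕ) : ℂ) + 1 / 2) * (quotPoly (paramX n) (i + j)).coeff k)) k) j) i

@[simp] theorem flatChristoffel_last_left (k j : Fin (n + 1)) :
    flatChristoffel n k (Fin.last n) j = 0 := by simp [flatChristoffel]

@[simp] theorem flatChristoffel_last_right (k i : Fin (n + 1)) :
    flatChristoffel n k i (Fin.last n) = 0 := by
  induction i using Fin.lastCases <;> simp [flatChristoffel]

@[simp] theorem flatChristoffel_last_up (i j : Fin (n + 1)) :
    flatChristoffel n (Fin.last n) i j = 0 := by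
  induction i using Fin.lastCases <;> induction j using Fin.lastCases <;> simp [flatChristoffel]

@[simp] theorem flatChristoffel_castSucc (k i j : Fin n) :
    flatChristoffel n k.castSucc i.castSucc j.castSucc
      = -(C (((k : ℕ) : ℂ) + 1 / 2) * (quotPoly (paramX n) (i + j)).coeff k) := by
  simp [flatChristoffel]

/-- The derivatives of λ in the parameters are the basis elements φ_i restricted to the curve. -/
theorem pderiv_residue_zero (g r : ℕ) (i : Fin (n + 1)) :
    pderiv i (residue n g r 0) = residueLaurent n g (r + 1)
      (monomialD (n + 1) (LaurentPolynomial.T 1) (laurentY (paramX n)) i) := by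
  induction i using Fin.lastCases with
  | last =>
    rw [monomialD_last, laurentY, map_neg, residueLaurent_C_mul_T, pderiv_last_residue]
    simp
  | cast i =>
    rw [monomialD_castSucc, LaurentPolynomial.T_pow, mul_one, residueLaurent_T,
      pderiv_castSucc_residue, zero_add]

/-- The second derivative brings down φ_i φ_j. Only y depends on the parameters, with ∂y/∂v_N =
-1/(2x), whence the extra term. -/
theorem pderiv_pderiv_residue_zero (g r : ℕ) (i j : Fin (n + 1)) :
    pderiv i (pderiv j (residue n g r 0)) = residueLaurent n g (r + 2)
      (monomialD (n + 1) (LaurentPolynomial.T 1) (laurentY (paramX n)) i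
        * monomialD (n + 1) (LaurentPolynomial.T 1) (laurentY (paramX n)) j)
      + if i = Fin.last n ∧ j = Fin.last n then -(C (1 / 2) * residue n g (r + 1) (-1)) else 0 := by
  induction j using Fin.lastCases with
  | last =>
    rw [pderiv_last_residue, pderiv_mul, map_neg]
    induction i using Fin.lastCases with
    | last =>
      rw [pderiv_last_halfLast, pderiv_last_residue, monomialD_last, laurentY, neg_mul_neg,
        mul_mul_mul_comm, ← map_mul, ← LaurentPolynomial.T_add, residueLaurent_C_mul_T]
      simp
      ring
    | cast i =>
      rw [pderiv_castSucc_halfLast, pderiv_castSucc_residue, monomialD_last, monomialD_castSucc,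
        laurentY, mul_neg, LaurentPolynomial.T_pow, mul_left_comm, ← LaurentPolynomial.T_add,
        map_neg, residueLaurent_C_mul_T, if_neg (fun h => (Fin.castSucc_lt_last i).ne h.1)]
      rw [show ((i : ℕ) : ℤ) * 1 + -1 = 0 - 1 + i by ring]
      ring
  | cast j =>
    rw [pderiv_castSucc_residue, if_neg (fun h => (Fin.castSucc_lt_last j).ne h.2), add_zero,
      monomialD_castSucc, LaurentPolynomial.T_pow]
    induction i using Fin.lastCases with
    | last =>
      rw [pderiv_last_residue, monomialD_last, laurentY, neg_mul, neg_mul,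
        mul_assoc (LaurentPolynomial.C _), ← LaurentPolynomial.T_add, map_neg, residueLaurent_C_mul_T]
      rw [show (-1 : ℤ) + ((j : ℕ) : ℤ) * 1 = 0 + j - 1 by ring]
    | cast i =>
      rw [pderiv_castSucc_residue, monomialD_castSucc, LaurentPolynomial.T_pow,
        ← LaurentPolynomial.T_add, residueLaurent_T]
      congr 1; ring

/-- The covariant Hessian of the residues. -/
theorem hessian_residue (hn : n ≠ 0) (g r : ℕ) (i j : Fin (n + 1)) :
    pderiv i (pderiv j (residue n g r 0))
      = ∑ k, flatChristoffel n k i j * pderiv k (residue n g r 0)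
        + ∑ k, mulCoord (paramX n) i j k * pderiv k (residue n g (r + 1) 0) := by
  -- The table replaces φ_i φ_j by a combination of the φ_k, giving the next residue, plus a
  -- multiple of λ', which integration by parts returns to the original r.
  rw [pderiv_pderiv_residue_zero, DSaito.monomialD_mul hn (T_one_mul_laurentY (paramX n))
    (L := laurentCrit (paramX n)) rfl, map_add, map_sum, aeval_T_one,
    residueLaurent_mul_crit hn]
  have h1 : ∀ k, residueLaurent n g (r + 2) (algebraMap _ _ (mulCoord (paramX n) i j k)
      * monomialD (n + 1) (LaurentPolynomial.T 1) (laurentY (paramX n)) k)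
      = mulCoord (paramX n) i j k * pderiv k (residue n g (r + 1) 0) := by
    intro k
    rw [← Algebra.smul_def, map_smul, smul_eq_mul, pderiv_residue_zero]
  simp only [h1]
  have h2 : ∑ k, flatChristoffel n k i j * pderiv k (residue n g r 0)
      = ∑ k : Fin n, flatChristoffel n k.castSucc i j * residue n g (r + 1) (k : ℕ) := by
    rw [Fin.sum_univ_castSucc, flatChristoffel_last_up, zero_mul, add_zero]
    simp only [pderiv_castSucc_residue, zero_add]
  rw [h2]
  generalize ∑ k, mulCoord (paramX n) i j k * pderiv k (residue n g (r + 1) 0) = B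
  rw [add_assoc B, add_comm B]
  congr 1
  induction i using Fin.lastCases with
  | last =>
    induction j using Fin.lastCases with
    | last =>
      -- For y² the multiple of λ' is 1. Its boundary term (1/2) Res(r+1, -1) cancels the extra term
      -- from ∂y/∂v_N, so these Christoffel symbols vanish.
      rw [mulQuot_last_last, ← Polynomial.C_1, Polynomial.sum_C_index (by simp)]
      simp
    | cast j => simp [(Fin.castSucc_lt_last j).ne]
  | cast i =>
    induction j using Fin.lastCases with
    | last => simp [(Fin.castSucc_lt_last i).ne]
    | cast j =>
      rw [if_neg (fun h => (Fin.castSucc_lt_last i).ne h.1), add_zero, mulQuot_castSucc_castSucc]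
      have hd : (Polynomial.X * quotPoly (paramX n) (i + j)).natDegree < n + 1 := by
        have h1 := Polynomial.natDegree_mul_le (p := Polynomial.X) (q := quotPoly (paramX n) (i + j))
        have h2 := Polynomial.natDegree_X_le (R := Params (n + 1))
        rw [natDegree_quotPoly] at h1
        omega
      -- The factor x in x q shifts the exponents, so the coefficient q_k meets (k+1) - 1/2 = k +
      -- 1/2.
      rw [Polynomial.sum_over_range' _ (by simp) (n + 1) hd, Finset.sum_range_succ', Finset.sum_range]
      simp only [Polynomial.coeff_X_mul, Polynomial.coeff_X_mul_zero, zero_mul, add_zero,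
        flatChristoffel_castSucc]
      rw [← Finset.sum_neg_distrib]
      refine Finset.sum_congr rfl fun k _ => ?_
      rw [show (((k : ℕ) + 1 : ℕ) : ℂ) - 1 / 2 = (k : ℕ) + 1 / 2 by push_cast; ring,
        show (((k : ℕ) + 1 : ℕ) : ℤ) - 1 = (k : ℕ) by push_cast; ring]
      ring

end Residues

end DSaito
end

noncomputable section
namespace DSaito

open MvPolynomial

variable {n : ℕ}

/-! ### Flat coordinates and vector potential in the coordinates v. -/

section FlatCoordinates

theorem weight_mono_apply (a : Fin (n + 1) →₀ ℕ) (i : Fin (n + 1)) (h : a i ≠ 0) :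
    ∃ b, a = Finsupp.single i 1 + b ∧
      Finsupp.weight (paramWeight n) a = paramWeight n i + Finsupp.weight (paramWeight n) b := by
  have h1 : Finsupp.single i 1 ≤ a := Finsupp.single_le_iff.2 (Nat.one_le_iff_ne_zero.2 h)
  refine ⟨a - Finsupp.single i 1, (add_tsub_cancel_of_le h1).symm, ?_⟩
  conv_lhs => rw [← add_tsub_cancel_of_le h1]
  rw [map_add, Finsupp.weight_single, one_smul]

theorem weight_paramWeight_eq_zero {a : Fin (n + 1) →₀ ℕ}
    (h : Finsupp.weight (paramWeight n) a = 0) : a = 0 := by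
  ext i
  by_contra hi
  obtain ⟨b, -, hb⟩ := weight_mono_apply a i hi
  have := paramWeight_ne_zero i
  omega

theorem expPart_of_neg (g r : ℕ) {m : ℤ} (hm : m < 0) : expPart n g r m = 0 := by
  ext a
  rw [coeff_expPart, if_neg (by omega), coeff_zero]

theorem expPart_zero (g r : ℕ) : expPart n g r 0 = C (expCoeff n g r) := by
  classical
  ext a
  rw [coeff_expPart, coeff_C]
  by_cases h : a = 0
  · subst h; simp
  · rw [if_neg (fun h' => h (weight_paramWeight_eq_zero (by exact_mod_cast h'))),
      if_neg (Ne.symm h)]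

theorem expCoeff_add_two (n g e : ℕ) : expCoeff n g (e + 2) = (-1 / 2 : ℂ) ^ e
    * ∏ k ∈ Finset.range e, (2 * ((g : ℂ) + 1) - 1 + 2 * (k : ℂ) * n) := by
  induction e with
  | zero => simp [expCoeff_two]
  | succ e ih =>
    rw [show e + 1 + 2 = (e + 2) + 1 by ring, expCoeff_succ, ih, Finset.prod_range_succ]
    push_cast
    ring

/-- The last variable alone has weight n + 1 > n - g. Thus the first N - 1 flat coordinates do not
involve v_N. -/
theorem apply_last_of_weight_eq {a : Fin (n + 1) →₀ ℕ} {g : ℕ}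
    (h : (Finsupp.weight (paramWeight n) a : ℤ) = n - g) : a (Fin.last n) = 0 := by
  by_contra hi
  obtain ⟨b, -, hb⟩ := weight_mono_apply a _ hi
  rw [paramWeight_last] at hb
  omega

theorem weight_paramWeight_eq_sum (a : Fin (n + 1) →₀ ℕ) (h : a (Fin.last n) = 0) :
    Finsupp.weight (paramWeight n) a = ∑ i : Fin n, (n - i) * a i.castSucc := by
  rw [Finsupp.weight_apply, Finsupp.sum_fintype _ _ (by simp), Fin.sum_univ_castSucc]
  simp [h, mul_comm]

/-- The flat coordinates as homogeneous parts of a weighted exponential. -/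
theorem flatCoord_castSucc (g : Fin n) :
    flatCoord (n + 1) g.castSucc = expPart n g 1 (n - g) := by
  have hg := g.2
  rw [flatCoord, if_neg (by simp; omega), expPart]
  refine Finset.sum_nbij' (fun a : Fin n → ℕ => Finsupp.equivFunOnFinite.symm
    (Fin.snoc (α := fun _ => ℕ) a 0 : Fin (n + 1) → ℕ)) (fun b (i : Fin n) => b i.castSucc) ?_ ?_ ?_ ?_ ?_
  · intro a ha
    have h1 := (Finset.mem_filter.1 ha).2
    have h2 : Finsupp.weight (paramWeight n) (Finsupp.equivFunOnFinite.symm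
        (Fin.snoc (α := fun _ => ℕ) a 0 : Fin (n + 1) → ℕ)) = n - g := by
      rw [weight_paramWeight_eq_sum _ (by simp)]
      simp only [Finsupp.equivFunOnFinite_symm_apply_apply, Fin.snoc_castSucc]
      refine Eq.trans (Finset.sum_congr rfl fun i _ => ?_) (h1.trans ?_)
      · rw [Nat.add_sub_add_right]
      · rw [Fin.val_castSucc, Nat.add_sub_add_right]
    simp only [Finset.mem_filter, Set.Finite.mem_toFinset, Set.mem_ofPred_eq]
    rw [h2]
    omega
  · intro b hb
    have h1 := (Finset.mem_filter.1 hb).2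
    have h0 := apply_last_of_weight_eq h1
    rw [weight_paramWeight_eq_sum b h0] at h1
    have h2 : ∑ i : Fin n, (n - i) * b i.castSucc = n - g := by omega
    refine Finset.mem_filter.2 ⟨Fintype.mem_piFinset.2 fun i => Finset.mem_range.2 ?_, ?_⟩
    · have h3 := Finset.single_le_sum (f := fun i : Fin n => (n - i) * b i.castSucc)
        (fun i _ => Nat.zero_le _) (Finset.mem_univ i)
      rw [h2] at h3
      have h4 : 1 * b i.castSucc ≤ (n - i) * b i.castSucc :=
        Nat.mul_le_mul_right _ (by have := i.2; omega)
      omega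
    · rw [Fin.val_castSucc, Nat.add_sub_add_right n 1 g, ← h2]
      exact Finset.sum_congr rfl fun i _ => by rw [Nat.add_sub_add_right]
  · intro a _
    funext i
    simp
  · intro b hb
    have h0 := apply_last_of_weight_eq (Finset.mem_filter.1 hb).2
    ext i
    induction i using Fin.lastCases with
    | last => simp [h0]
    | cast i => simp
  · intro a ha
    have h1 := (Finset.mem_filter.1 ha).2
    have h2 : (Finsupp.equivFunOnFinite.symm
        (Fin.snoc (α := fun _ => ℕ) a 0 : Fin (n + 1) → ℕ)).degree = ∑ i, a i := by
      rw [Finsupp.degree_eq_sum, Fin.sum_univ_castSucc]; simp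
    -- The weight n - g is positive, hence |a| ≥ 1 and the truncated difference |a| - 1 is a genuine
    -- one.
    obtain ⟨e, he⟩ : ∃ e, ∑ i, a i = e + 1 := by
      refine Nat.exists_eq_succ_of_ne_zero fun h0 => ?_
      have h3 : ∀ i, a i = 0 := fun i => Finset.sum_eq_zero_iff.1 h0 i (Finset.mem_univ i)
      simp only [h3, mul_zero, Finset.sum_const_zero, Fin.val_castSucc] at h1
      omega
    rw [h2, he, expCoeff_add_two, monomial_eq, Finsupp.prod_fintype _ _ (by simp),
      Fin.prod_univ_castSucc, Fin.prod_univ_castSucc]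
    simp only [Finsupp.equivFunOnFinite_symm_apply_apply, Fin.snoc_castSucc, Fin.snoc_last,
      pow_zero, mul_one, Nat.factorial_zero, Nat.cast_one, Nat.add_sub_cancel, Nat.cast_add,
      add_sub_cancel_right]
    rfl

theorem flatCoord_last (n : ℕ) : flatCoord (n + 1) (Fin.last n) = X (Fin.last n) := by
  simp [flatCoord]

theorem substLast_expPart (g : ℕ) : substLast n (expPart n g 1 (n - g)) = expPart n g 1 (n - g) := by
  rw [expPart, map_sum]
  refine Finset.sum_congr rfl fun a ha => ?_
  have h0 := apply_last_of_weight_eq (Finset.mem_filter.1 ha).2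
  rw [monomial_eq, Finsupp.prod_fintype _ _ (by simp), map_mul, substLast_C,
    map_prod]
  congr 1
  rw [Fin.prod_univ_castSucc, Fin.prod_univ_castSucc, h0]
  simp

theorem flatCoord_castSucc_eq_residue (g : Fin n) :
    flatCoord (n + 1) g.castSucc = residue n g 1 0 := by
  rw [residue, flatCoord_castSucc, ← substLast_expPart]
  congr 2
  push_cast
  ring

/-- The weight in question is -g: only the constant monomial at g = 0 survives. -/
theorem residue_two_zero (g : ℕ) : residue n g 2 0 = if g = 0 then 1 else 0 := by
  rw [residue]
  split_ifs with h
  · rw [show ((0 : ℤ) + 2 * n - g - ((2 : ℕ) : ℤ) * n) = 0 by push_cast; omega, expPart_zero,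
      expCoeff_two, substLast_C, C_1]
  · rw [expPart_of_neg _ _ (by push_cast; omega), map_zero]

theorem exists_eq_single_of_degree_eq_one {m : Fin n →₀ ℕ} (h : m.degree = 1) :
    ∃ j, m = Finsupp.single j 1 := by
  obtain ⟨j, hj⟩ : ∃ j, m j ≠ 0 := by
    by_contra! h0
    rw [show m = 0 from Finsupp.ext h0, map_zero] at h
    exact zero_ne_one h
  have h1 : Finsupp.single j 1 ≤ m := Finsupp.single_le_iff.2 (Nat.one_le_iff_ne_zero.2 hj)
  have h2 := congrArg Finsupp.degree (add_tsub_cancel_of_le h1)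
  rw [map_add, Finsupp.degree_single, h] at h2
  have h3 : m - Finsupp.single j 1 = 0 := (Finsupp.degree_eq_zero_iff _).1 (by omega)
  refine ⟨j, ?_⟩
  rw [← add_tsub_cancel_of_le h1, h3, add_zero]

/-- The weights of the variables are distinct, so v_{g+1} is the only linear monomial of weight n -
g, and its coefficient is `expCoeff n g 2` = 1. -/
theorem coeff_flatCoord (α : Fin (n + 1)) (m : Fin (n + 1) →₀ ℕ) (hm : m.degree ≤ 1) :
    coeff m (flatCoord (n + 1) α) = coeff m (X α : Params (n + 1)) := by
  classical
  induction α using Fin.lastCases with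
  | last => rw [flatCoord_last]
  | cast g =>
    have hg := g.2
    rw [flatCoord_castSucc, coeff_expPart, coeff_X]
    rcases Nat.eq_zero_or_pos m.degree with h | h
    · rw [Finsupp.degree_eq_zero_iff] at h
      rw [h, if_neg, if_neg]
      · simp
      · rw [map_zero]; push_cast; omega
    · obtain ⟨j, rfl⟩ := exists_eq_single_of_degree_eq_one (show m.degree = 1 by omega)
      rw [Finsupp.degree_single, expCoeff_two, Finsupp.weight_single, one_smul]
      have h1 : ∏ i, (((Finsupp.single j 1 : Fin (n + 1) →₀ ℕ) i).factorial : ℂ) = 1 := by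
        refine Finset.prod_eq_one fun i _ => ?_
        rw [Finsupp.single_apply]; split_ifs <;> simp
      rw [h1, div_one]
      refine if_congr ?_ rfl rfl
      rw [Finsupp.single_left_inj one_ne_zero]
      induction j using Fin.lastCases with
      | last =>
        rw [paramWeight_last]
        refine iff_of_false (by push_cast; omega) (Fin.castSucc_lt_last g).ne
      | cast j =>
        have hj := j.2
        rw [paramWeight_castSucc, Fin.castSucc_inj, Fin.ext_iff]
        omega

theorem pderiv_zero_flatCoord (hn : n ≠ 0) (α : Fin (n + 1)) :
    pderiv 0 (flatCoord (n + 1) α) = if (α : ℕ) = 0 then 1 else 0 := by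
  have : NeZero n := ⟨hn⟩
  induction α using Fin.lastCases with
  | last =>
    rw [flatCoord_last, pderiv_X_of_ne, if_neg (by simpa using hn)]
    rw [Ne, Fin.ext_iff]; simpa using hn
  | cast g =>
    rw [flatCoord_castSucc_eq_residue, ← Fin.castSucc_zero', pderiv_castSucc_residue]
    simp [residue_two_zero]

/-- The coordinates `t` are flat. -/
theorem hessian_flatCoord (hn : n ≠ 0) (α i j : Fin (n + 1)) :
    pderiv i (pderiv j (flatCoord (n + 1) α))
      = ∑ k, flatChristoffel n k i j * pderiv k (flatCoord (n + 1) α) := by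
  classical
  induction α using Fin.lastCases with
  | last =>
    rw [flatCoord_last, Fin.sum_univ_castSucc, flatChristoffel_last_up, zero_mul, add_zero, pderiv_X]
    simp only [pderiv_X_of_ne (Fin.castSucc_lt_last _).ne', mul_zero, Finset.sum_const_zero]
    rw [Pi.single_apply]
    split_ifs <;> simp
  | cast g =>
    -- At r = 1 the next residue is constant, so only the Christoffel term remains.
    rw [flatCoord_castSucc_eq_residue, hessian_residue hn, residue_two_zero]
    have h : ∀ k : Fin (n + 1), pderiv k (if (g : ℕ) = 0 then (1 : Params (n + 1)) else 0) = 0 := by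
      intro k; split_ifs <;> simp
    simp [h]

/-- The vector potential of the Saito manifold in the coordinates `v`. -/
def saitoPotential (n : ℕ) (α : Fin (n + 1)) : Params (n + 1) :=
  Fin.lastCases (motive := fun _ => Params (n + 1)) (X 0 * X (Fin.last n))
    (fun g => residue n g 0 0) α

/-- For γ < N this is `hessian_residue` at r = 0, the next residue being t^γ. The component v_1 v_N
is checked against the coefficient of y in the table. -/
theorem hessian_saitoPotential (hn : n ≠ 0) (α i j : Fin (n + 1)) :
    pderiv i (pderiv j (saitoPotential n α))
      = ∑ k, flatChristoffel n k i j * pderiv k (saitoPotential n α)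
        + ∑ k, mulCoord (paramX n) i j k * pderiv k (flatCoord (n + 1) α) := by
  classical
  have : NeZero n := ⟨hn⟩
  have h0 : (0 : Fin (n + 1)) ≠ Fin.last n := by
    rw [Ne, Fin.ext_iff]; simpa using hn.symm
  induction α using Fin.lastCases with
  | cast g =>
    rw [flatCoord_castSucc_eq_residue, saitoPotential, Fin.lastCases_castSucc, hessian_residue hn]
  | last =>
    rw [flatCoord_last, saitoPotential, Fin.lastCases_last]
    have hp : ∀ k : Fin (n + 1), pderiv k (X 0 * X (Fin.last n) : Params (n + 1))
        = (if k = 0 then X (Fin.last n) else 0) + if k = Fin.last n then X 0 else 0 := by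
      intro k
      rw [pderiv_mul, pderiv_X, pderiv_X, Pi.single_apply, Pi.single_apply]
      simp only [eq_comm (b := k)]
      split_ifs <;> simp
    have hX : ∀ k : Fin (n + 1), pderiv k (X (Fin.last n) : Params (n + 1))
        = if k = Fin.last n then 1 else 0 := by
      intro k
      rw [pderiv_X, Pi.single_apply]; simp only [eq_comm (b := k)]
    simp only [hp, hX, mul_add, mul_ite, mul_zero, mul_one, Finset.sum_add_distrib,
      Finset.sum_ite_eq', Finset.mem_univ, if_true, flatChristoffel_last_up, zero_mul, add_zero]
    have hz : ∀ j : Fin n, j.castSucc = (0 : Fin (n + 1)) ↔ (j : ℕ) = 0 := by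
      intro j; rw [Fin.ext_iff]; simp
    induction j using Fin.lastCases with
    | last =>
      rw [if_neg h0.symm, if_pos rfl, zero_add, flatChristoffel_last_right, zero_mul, zero_add,
        pderiv_X, Pi.single_apply]
      induction i using Fin.lastCases with
      | last => rw [if_neg h0, mulCoord_last_last, Fin.snoc_last]
      | cast i => rw [mulCoord_castSucc_last, Fin.snoc_last]; simp only [eq_comm (a := (0 : Fin (n + 1))), hz]
    | cast j =>
      rw [if_neg (Fin.castSucc_lt_last j).ne, add_zero]
      have h2 : pderiv i (if j.castSucc = (0 : Fin (n + 1)) then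
          (X (Fin.last n) : Params (n + 1)) else 0)
          = if i = Fin.last n ∧ (j : ℕ) = 0 then 1 else 0 := by
        simp only [hz, ite_and]
        split_ifs with h3 h4 h4 <;> simp [hX, h4]
      rw [h2]
      induction i using Fin.lastCases with
      | last =>
        rw [flatChristoffel_last_left, zero_mul, zero_add, mulCoord_last_castSucc, Fin.snoc_last]
        simp
      | cast i =>
        -- The Christoffel symbol with upper index 1 is -q(0)/2; times v_N it cancels the
        -- coefficient (v_N/2) q(0) of y in x^{i+j}.
        rw [if_neg (fun h => (Fin.castSucc_lt_last i).ne h.1), ← Fin.castSucc_zero',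
          flatChristoffel_castSucc, mulCoord_castSucc_castSucc, Fin.snoc_last, halfLast_paramX]
        simp
        ring

end FlatCoordinates

/-! ### The polynomial inverse of the flat coordinates. -/

section Inverse

/-- The change of coordinates is triangular: t^γ - v_γ involves only variables of strictly smaller
weight, which are in the range by induction on the weight. -/
theorem surjective_aeval_flatCoord (n : ℕ) : Function.Surjective
    (aeval (flatCoord (n + 1)) : Params (n + 1) →ₐ[ℂ] Params (n + 1)) := by
  classical
  rw [← AlgHom.range_eq_top, eq_top_iff, ← adjoin_range_X, Algebra.adjoin_le_iff]
  rintro _ ⟨i, rfl⟩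
  have hmem : ∀ α, flatCoord (n + 1) α ∈
      (aeval (flatCoord (n + 1)) : Params (n + 1) →ₐ[ℂ] Params (n + 1)).range :=
    fun α => ⟨X α, aeval_X _ _⟩
  generalize (aeval (flatCoord (n + 1)) : Params (n + 1) →ₐ[ℂ] Params (n + 1)).range = R at hmem ⊢
  change X i ∈ R
  induction i using Fin.lastCases with
  | last => rw [← flatCoord_last]; exact hmem _
  | cast g =>
    obtain ⟨d, hd⟩ : ∃ d, n - (g : ℕ) = d := ⟨_, rfl⟩
    induction d using Nat.strong_induction_on generalizing g with
    | _ d ih =>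
      have hg := g.2
      have h1 := hmem g.castSucc
      have h2 : (X g.castSucc : Params (n + 1))
          = flatCoord (n + 1) g.castSucc - (flatCoord (n + 1) g.castSucc - X g.castSucc) := by ring
      rw [h2]
      refine R.sub_mem h1 ?_
      rw [as_sum (flatCoord (n + 1) g.castSucc - X g.castSucc)]
      refine R.sum_mem fun a ha => ?_
      rw [monomial_eq]
      refine R.mul_mem (R.algebraMap_mem _) (R.prod_mem fun i hi => R.pow_mem ?_ _)
      rw [mem_support_iff, coeff_sub, coeff_X, flatCoord_castSucc, coeff_expPart] at ha
      have hga : Finsupp.single g.castSucc 1 ≠ a := by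
        rintro rfl
        refine ha ?_
        have := coeff_flatCoord g.castSucc (Finsupp.single g.castSucc 1) (by simp)
        rw [flatCoord_castSucc, coeff_expPart, coeff_X] at this
        rw [this, sub_self]
      rw [if_neg hga, sub_zero] at ha
      have hw : (Finsupp.weight (paramWeight n) a : ℤ) = n - g := by
        by_contra h; exact ha (if_neg h)
      obtain ⟨b, hb, hwb⟩ := weight_mono_apply a i (Finsupp.mem_support_iff.1 hi)
      induction i using Fin.lastCases with
      | last => rw [paramWeight_last] at hwb; omega
      | cast i =>
        have hi := i.2
        rw [paramWeight_castSucc] at hwb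
        refine ih _ ?_ i rfl
        by_contra h
        have h3 : Finsupp.weight (paramWeight n) b = 0 := by omega
        have h4 : i = g := Fin.ext (by omega)
        rw [weight_paramWeight_eq_zero h3, add_zero, h4] at hb
        exact hga hb.symm

/-- The kernels of the iterates stabilize at some m. An element of the kernel is f^m(y), so y lies
in the kernel of f^{m+1}, which equals that of f^m. -/
theorem injective_of_surjective_of_isNoetherianRing {R : Type*} [CommRing R] [IsNoetherianRing R]
    (f : R →+* R) (hf : Function.Surjective f) : Function.Injective f := by
  rw [RingHom.injective_iff_ker_eq_bot]
  let K : ℕ →o Ideal R := ⟨fun k => RingHom.ker (f ^ k), by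
    refine monotone_nat_of_le_succ fun k x hx => ?_
    rw [RingHom.mem_ker] at hx ⊢
    rw [pow_succ', RingHom.mul_def, RingHom.comp_apply, hx, map_zero]⟩
  obtain ⟨m, hm⟩ := monotone_stabilizes_iff_noetherian.2 ‹IsNoetherianRing R› K
  rw [eq_bot_iff]
  intro x hx
  have hs : Function.Surjective (f ^ m) := by
    rw [RingHom.coe_pow]; exact hf.iterate m
  obtain ⟨y, rfl⟩ := hs x
  have h1 : y ∈ K (m + 1) := by
    change y ∈ RingHom.ker (f ^ (m + 1))
    rw [RingHom.mem_ker, pow_succ', RingHom.mul_def, RingHom.comp_apply]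
    exact hx
  rw [← hm (m + 1) (Nat.le_succ m)] at h1
  exact h1

theorem injective_aeval_flatCoord (n : ℕ) : Function.Injective
    (aeval (flatCoord (n + 1)) : Params (n + 1) →ₐ[ℂ] Params (n + 1)) :=
  injective_of_surjective_of_isNoetherianRing (aeval (flatCoord (n + 1))).toRingHom
    (surjective_aeval_flatCoord n)

/-- The inverse of the coordinate change `t`. -/
def invCoord (n : ℕ) (α : Fin (n + 1)) : Params (n + 1) :=
  (surjective_aeval_flatCoord n (X α)).choose

theorem aeval_flatCoord_invCoord (α : Fin (n + 1)) :
    aeval (flatCoord (n + 1)) (invCoord n α) = X α :=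
  (surjective_aeval_flatCoord n (X α)).choose_spec

theorem aeval_invCoord_flatCoord (α : Fin (n + 1)) :
    aeval (invCoord n) (flatCoord (n + 1) α) = X α := by
  refine injective_aeval_flatCoord n ?_
  rw [← AlgHom.comp_apply, comp_aeval]
  simp only [aeval_flatCoord_invCoord, aeval_X]
  exact aeval_X_left_apply _

theorem invCoord_last (n : ℕ) : invCoord n (Fin.last n) = X (Fin.last n) := by
  refine injective_aeval_flatCoord n ?_
  rw [aeval_flatCoord_invCoord, aeval_X, flatCoord_last]

theorem eval_invCoord (p : Fin (n + 1) → ℂ) (α : Fin (n + 1)) :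
    eval (fun a => saitoCoord (n + 1) a p) (invCoord n α) = p α := by
  have := congrArg (eval p) (aeval_flatCoord_invCoord (n := n) α)
  rwa [eval_aeval, eval_X] at this

theorem saitoCoord_invCoord (τ : Fin (n + 1) → ℂ) (α : Fin (n + 1)) :
    saitoCoord (n + 1) α (fun a => eval τ (invCoord n a)) = τ α := by
  have := congrArg (eval τ) (aeval_invCoord_flatCoord (n := n) α)
  rwa [eval_aeval, eval_X] at this

theorem pd_saitoCoord (i α : Fin (n + 1)) (p : Fin (n + 1) → ℂ) :
    pd i (saitoCoord (n + 1) α) p = eval p (pderiv i (flatCoord (n + 1) α)) :=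
  congrFun (pd_eval i (flatCoord (n + 1) α)) p

/-- Coordinates with a differentiable left inverse have an invertible Jacobian matrix. -/
theorem det_jacobianMatrix_ne_zero {m : ℕ} {t W : Fin m → (Fin m → ℂ) → ℂ} {p : Fin m → ℂ}
    (ht : ∀ a, DifferentiableAt ℂ (t a) p) (hW : ∀ k, DifferentiableAt ℂ (W k) fun a => t a p)
    (h : ∀ q k, W k (fun a => t a q) = q k) : (jacobianMatrix t p).det ≠ 0 := by
  have h1 : (Matrix.of fun k b => pd b (W k) fun a => t a p) * jacobianMatrix t p = 1 := by
    ext k i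
    simp only [Matrix.mul_apply, Matrix.of_apply, jacobianMatrix]
    rw [← pd_comp (hW k) ht, show (fun q => W k fun a => t a q) = fun q => q k from
      funext fun q => h q k, pd_coord, Matrix.one_apply]
    simp only [eq_comm]
  intro h0
  have h2 := congrArg Matrix.det h1
  rw [Matrix.det_mul, h0, mul_zero, Matrix.det_one] at h2
  exact zero_ne_one h2

theorem det_jacobianMatrix_saitoCoord (p : Fin (n + 1) → ℂ) :
    (jacobianMatrix (saitoCoord (n + 1)) p).det ≠ 0 :=
  det_jacobianMatrix_ne_zero (W := fun k τ => eval τ (invCoord n k))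
    (fun _ => (analyticAt_eval _ _).differentiableAt)
    (fun _ => (analyticAt_eval _ _).differentiableAt) eval_invCoord

theorem injective_saitoCoord (n : ℕ) :
    Function.Injective fun p a => saitoCoord (n + 1) a p := by
  intro p q h
  funext k
  rw [← eval_invCoord p k, ← eval_invCoord q k]
  exact congrArg (fun τ => eval τ (invCoord n k)) h

end Inverse

end DSaito
end

noncomputable section
namespace DSaito

variable {n : ℕ}

/-! ### Associativity and unit of the explicit multiplication table. -/

section Laws

theorem mulCoord_comm {S : Type*} [CommRing S] [Algebra ℂ S] (v : Fin (n + 1) → S)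
    (i j k : Fin (n + 1)) : mulCoord v i j k = mulCoord v j i k := by
  induction i using Fin.lastCases <;> induction j using Fin.lastCases <;> simp [add_comm]

namespace IsJacobianAlgebra

variable {S A : Type*} [CommRing S] [Algebra ℂ S] [CommRing A] [Algebra S A] [IsDomain S]
  {v : Fin (n + 1) → S} {π : MvPolynomial (Fin 2) S →ₐ[S] A}

theorem mulCoord_assoc (h : IsJacobianAlgebra v π) (hn : 2 ≤ n) (hv : v (Fin.last n) ≠ 0)
    (l i j k : Fin (n + 1)) : ∑ m, mulCoord v i j m * mulCoord v m k l
      = ∑ m, mulCoord v j k m * mulCoord v i m l := by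
  simp only [← h.structureConstant_eq hn hv]
  exact structureConstant_assoc (h.isModuleBasis hn hv) l i j k

theorem mulCoord_zero_left (h : IsJacobianAlgebra v π) (hn : 2 ≤ n) (hv : v (Fin.last n) ≠ 0)
    (j k : Fin (n + 1)) : mulCoord v 0 j k = if k = j then 1 else 0 := by
  rw [← h.structureConstant_eq hn hv]
  exact structureConstant_one (h.isModuleBasis hn hv) (monomialD_zero (by omega) _ _) k j

end IsJacobianAlgebra

theorem mulCoord_paramX_assoc (hn : 2 ≤ n) (l i j k : Fin (n + 1)) :
    ∑ m, mulCoord (paramX n) i j m * mulCoord (paramX n) m k l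
      = ∑ m, mulCoord (paramX n) j k m * mulCoord (paramX n) i m l :=
  (isJacobianAlgebra_saito n).mulCoord_assoc hn (MvPolynomial.X_ne_zero _) l i j k

theorem mulCoord_paramX_zero_left (hn : 2 ≤ n) (j k : Fin (n + 1)) :
    mulCoord (paramX n) 0 j k = if k = j then 1 else 0 :=
  (isJacobianAlgebra_saito n).mulCoord_zero_left hn (MvPolynomial.X_ne_zero _) j k

end Laws

/-! ### The expansion of 1/`critPoly` at infinity. -/

section Sequence

open Polynomial

variable {S : Type*} [CommRing S] [Nontrivial S]

/-- One step of long division: x times the old remainder overflows in degree n only. -/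
theorem quotPoly_succ (hn : n ≠ 0) (v : Fin (n + 1) → S) (m : ℕ) :
    quotPoly v (m + 1) = X * quotPoly v m + C ((remPoly v m).coeff (n - 1)) := by
  set e := (remPoly v m).coeff (n - 1)
  refine (div_modByMonic_unique (X * quotPoly v m + C e) (X * remPoly v m - C e * critPoly v)
    (critPoly_monic v) ⟨?_, ?_⟩).1
  · rw [pow_succ', ← remPoly_add v m]; ring
  · rw [degree_eq_natDegree (critPoly_monic v).ne_zero, natDegree_critPoly, degree_lt_iff_coeff_zero]
    have hr := (degree_lt_iff_coeff_zero _ _).1 (degree_remPoly v m)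
    intro k hk
    obtain ⟨k, rfl⟩ : ∃ l, k = l + 1 := ⟨k - 1, by omega⟩
    rw [coeff_sub, coeff_X_mul, coeff_C_mul]
    rcases hk.eq_or_lt with h | h
    · have h1 : (critPoly v).coeff (k + 1) = 1 := by
        have := (critPoly_monic v).coeff_natDegree
        rw [natDegree_critPoly] at this
        exact (congrArg _ h.symm).trans this
      rw [h1, mul_one, show k = n - 1 by omega, sub_self]
    · rw [hr k (by omega), coeff_eq_zero_of_natDegree_lt (p := critPoly v), mul_zero, sub_zero]
      rw [natDegree_critPoly]; omega

/-- The coefficients of the expansion of `1 / critPoly v` at infinity. -/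
def pairing (v : Fin (n + 1) → S) (m : ℕ) : S := (quotPoly v (m + 1)).coeff 0

theorem coeff_remPoly (hn : n ≠ 0) (v : Fin (n + 1) → S) (m : ℕ) :
    (remPoly v m).coeff (n - 1) = pairing v m := by
  rw [pairing, quotPoly_succ hn]; simp

/-- All the quotients are polynomial parts of x^m/`critPoly`, hence windows of one sequence indexed
by m - k - 1. The condition k < m guards the truncated subtraction. -/
theorem coeff_quotPoly (hn : n ≠ 0) (v : Fin (n + 1) → S) (m k : ℕ) :
    (quotPoly v m).coeff k = if k < m then pairing v (m - k - 1) else 0 := by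
  induction k generalizing m with
  | zero =>
    cases m with
    | zero => rw [quotPoly_of_lt v (Nat.pos_of_ne_zero hn)]; simp
    | succ m => simp [pairing]
  | succ k ih =>
    cases m with
    | zero => rw [quotPoly_of_lt v (Nat.pos_of_ne_zero hn)]; simp
    | succ m =>
      rw [quotPoly_succ hn, coeff_add, coeff_X_mul, coeff_C_succ, add_zero, ih]
      simp only [add_lt_add_iff_right, Nat.add_sub_add_right]

theorem pairing_of_lt (v : Fin (n + 1) → S) {m : ℕ} (h : m + 1 < n) : pairing v m = 0 := by
  rw [pairing, quotPoly_of_lt v h, coeff_zero]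

/-- The reverse of `critPoly v`. -/
def revCrit (v : Fin (n + 1) → S) : PowerSeries S :=
  1 + ∑ i : Fin n, PowerSeries.C ((i : ℕ) * v i.castSucc) * PowerSeries.X ^ (n - (i : ℕ))

/-- Compare the coefficients of x^n in the division of x^{q+1}; the remainder has degree less than n
and does not contribute. -/
theorem revCrit_mul_mk_pairing (hn : n ≠ 0) (v : Fin (n + 1) → S) :
    revCrit v * PowerSeries.mk (pairing v) = PowerSeries.X ^ (n - 1) := by
  ext q
  have h := congrArg (fun f => coeff f n) (remPoly_add v (q + 1))
  simp only [coeff_add] at h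
  rw [coeff_eq_zero_of_degree_lt (degree_remPoly v (q + 1)), zero_add] at h
  conv_lhs at h => rw [critPoly]
  simp only [add_mul, Finset.sum_mul, coeff_add, finsetSum_coeff, mul_assoc, coeff_C_mul,
    coeff_X_pow_mul', le_refl, if_true, Nat.sub_self, coeff_X_pow] at h
  simp only [revCrit, add_mul, one_mul, Finset.sum_mul, map_add, map_sum, mul_assoc,
    PowerSeries.coeff_C_mul, PowerSeries.coeff_X_pow_mul', PowerSeries.coeff_mk,
    PowerSeries.coeff_X_pow]
  refine Eq.trans (congrArg₂ _ rfl (Finset.sum_congr rfl fun i _ => ?_)) (h.trans ?_)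
  · have hi := i.2
    rw [if_pos i.2.le, coeff_quotPoly hn]
    refine congrArg _ (congrArg _ ?_)
    refine if_congr (by omega) (congrArg _ (by omega)) rfl
  · exact if_congr (by omega) rfl rfl

/-- Coefficientwise application of a derivation. -/
def mapDerivation {R : Type*} [CommRing R] [Algebra R S] (δ : Derivation R S S)
    (f : PowerSeries S) : PowerSeries S := PowerSeries.mk fun m => δ (PowerSeries.coeff m f)

omit [Nontrivial S] in
theorem mapDerivation_mul {R : Type*} [CommRing R] [Algebra R S] (δ : Derivation R S S)
    (f g : PowerSeries S) :
    mapDerivation δ (f * g) = mapDerivation δ f * g + f * mapDerivation δ g := by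
  ext m
  simp only [mapDerivation, PowerSeries.coeff_mk, PowerSeries.coeff_mul, map_add, map_sum,
    Derivation.leibniz, smul_eq_mul, ← Finset.sum_add_distrib]
  exact Finset.sum_congr rfl fun x _ => by ring

/-- The rule δ(1/f) = -δf/f² without division: apply δ to R P = X^{n-1} and multiply by P. -/
theorem X_pow_mul_mapDerivation_pairing {R : Type*} [CommRing R] [Algebra R S]
    (hn : n ≠ 0) (v : Fin (n + 1) → S) (δ : Derivation R S S) :
    PowerSeries.X ^ (n - 1) * mapDerivation δ (PowerSeries.mk (pairing v))
      = -(mapDerivation δ (revCrit v) * PowerSeries.mk (pairing v) ^ 2) := by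
  have h := congrArg (mapDerivation δ) (revCrit_mul_mk_pairing hn v)
  rw [mapDerivation_mul] at h
  have h0 : mapDerivation δ (PowerSeries.X ^ (n - 1)) = 0 := by
    ext m
    simp only [mapDerivation, PowerSeries.coeff_mk, PowerSeries.coeff_X_pow, map_zero]
    split_ifs <;> simp
  rw [h0] at h
  rw [← revCrit_mul_mk_pairing hn v]
  linear_combination PowerSeries.mk (pairing v) * h

end Sequence

/-! ### The Saito metric is parallel, hence constant in the flat coordinates. -/

section Metric

open MvPolynomial

theorem mapDerivation_revCrit_last :
    mapDerivation (pderiv (Fin.last n)) (revCrit (paramX n)) = 0 := by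
  ext m
  simp only [mapDerivation, revCrit, PowerSeries.coeff_mk, map_add, map_sum,
    PowerSeries.coeff_C_mul, PowerSeries.coeff_one, PowerSeries.coeff_X_pow]
  rw [Finset.sum_eq_zero, add_zero]
  · split_ifs <;> simp
  · intro i _
    split_ifs <;> simp [Derivation.leibniz, pderiv_X_of_ne (Fin.castSucc_lt_last i).ne]

theorem mapDerivation_revCrit_castSucc (k : Fin n) :
    mapDerivation (pderiv k.castSucc) (revCrit (paramX n))
      = PowerSeries.C ((k : ℕ) : Params (n + 1)) * PowerSeries.X ^ (n - (k : ℕ)) := by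
  classical
  ext m
  simp only [mapDerivation, revCrit, PowerSeries.coeff_mk, map_add, map_sum,
    PowerSeries.coeff_C_mul, PowerSeries.coeff_one, PowerSeries.coeff_X_pow]
  rw [Finset.sum_eq_single k]
  · split_ifs <;> simp [Derivation.leibniz]
  · intro i _ hi
    have : i.castSucc ≠ k.castSucc := fun h => hi (Fin.castSucc_injective _ h)
    split_ifs <;> simp [Derivation.leibniz, pderiv_X_of_ne this]
  · simp

theorem pderiv_last_pairing (hn : n ≠ 0) (m : ℕ) :
    pderiv (Fin.last n) (pairing (paramX n) m) = 0 := by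
  have h := X_pow_mul_mapDerivation_pairing hn (paramX n) (pderiv (Fin.last n))
  rw [mapDerivation_revCrit_last, zero_mul, neg_zero] at h
  have h2 := congrArg (PowerSeries.coeff (m + (n - 1))) h
  rwa [PowerSeries.coeff_X_pow_mul, mapDerivation, PowerSeries.coeff_mk, PowerSeries.coeff_mk,
    map_zero] at h2

/-- The square of the generating series produces the sum over the antidiagonal. If k = 0 the factor
k makes the truncated index irrelevant. -/
theorem pderiv_castSucc_pairing (hn : n ≠ 0) (m : ℕ) (k : Fin n) :
    pderiv k.castSucc (pairing (paramX n) m) = -(((k : ℕ) : Params (n + 1))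
      * ∑ x ∈ Finset.HasAntidiagonal.antidiagonal (m + (k : ℕ) - 1), pairing (paramX n) x.1 * pairing (paramX n) x.2) := by
  have hk := k.2
  have h := X_pow_mul_mapDerivation_pairing hn (paramX n) (pderiv k.castSucc)
  rw [mapDerivation_revCrit_castSucc] at h
  have h2 := congrArg (PowerSeries.coeff (m + (n - 1))) h
  rw [PowerSeries.coeff_X_pow_mul, mapDerivation, PowerSeries.coeff_mk, PowerSeries.coeff_mk,
    map_neg, mul_assoc, PowerSeries.coeff_C_mul] at h2
  rw [h2]
  rcases Nat.eq_zero_or_pos (k : ℕ) with h0 | h0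
  · rw [h0]; simp
  · rw [PowerSeries.coeff_X_pow_mul', if_pos (by omega), sq, PowerSeries.coeff_mul,
      show m + (n - 1) - (n - k) = m + k - 1 by omega]
    simp only [PowerSeries.coeff_mk]

/-- The Saito metric in the coordinates `v`. -/
def metric (n : ℕ) (i j : Fin (n + 1)) : Params (n + 1) :=
  Fin.lastCases (motive := fun _ => Params (n + 1))
    (Fin.lastCases (motive := fun _ => Params (n + 1)) (-1) (fun _ => 0) j)
    (fun i => Fin.lastCases (motive := fun _ => Params (n + 1)) 0
      (fun j => pairing (paramX n) (i + j)) j) i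

@[simp] theorem metric_last_last : metric n (Fin.last n) (Fin.last n) = -1 := by simp [metric]

@[simp] theorem metric_last_castSucc (j : Fin n) : metric n (Fin.last n) j.castSucc = 0 := by
  simp [metric]

@[simp] theorem metric_castSucc_last (i : Fin n) : metric n i.castSucc (Fin.last n) = 0 := by
  simp [metric]

@[simp] theorem metric_castSucc_castSucc (i j : Fin n) :
    metric n i.castSucc j.castSucc = pairing (paramX n) (i + j) := by simp [metric]

theorem metric_comm (i j : Fin (n + 1)) : metric n i j = metric n j i := by
  induction i using Fin.lastCases <;> induction j using Fin.lastCases <;> simp [add_comm]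

theorem mulCoord_eq_metric (i j : Fin (n + 1)) {l : Fin n} (hl : (l : ℕ) + 1 = n) :
    mulCoord (paramX n) i j l.castSucc = metric n i j := by
  have hn : n ≠ 0 := by omega
  induction i using Fin.lastCases with
  | last =>
    induction j using Fin.lastCases with
    | last =>
      rw [mulCoord_last_last, Fin.snoc_castSucc, hl, metric_last_last]
      have := (critPoly_monic (paramX n)).coeff_natDegree
      rw [natDegree_critPoly] at this
      rw [this]
    | cast j =>
      have := j.2
      rw [mulCoord_last_castSucc, Fin.snoc_castSucc, if_neg (by omega), metric_last_castSucc]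
  | cast i =>
    have hi := i.2
    induction j using Fin.lastCases with
    | last => rw [mulCoord_castSucc_last, Fin.snoc_castSucc, if_neg (by omega), metric_castSucc_last]
    | cast j =>
      have hj := j.2
      rw [mulCoord_castSucc_castSucc, Fin.snoc_castSucc, hl,
        coeff_quotPoly_eq_zero _ (by omega) hn, mul_zero, sub_zero, metric_castSucc_castSucc,
        ← coeff_remPoly hn, show (l : ℕ) = n - 1 by omega]

/-- Since `pairing` vanishes below n - 1, a sum over a window extends to the full antidiagonal. This
makes it symmetric enough to be added to its mirror image in `pderiv_metric`. -/
theorem sum_flatChristoffel_mul_pairing (hn : 2 ≤ n) (k i j : Fin n) :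
    ∑ m, flatChristoffel n m k.castSucc i.castSucc * metric n m j.castSucc
      = -∑ x ∈ Finset.HasAntidiagonal.antidiagonal ((i : ℕ) + (j : ℕ) + (k : ℕ) - 1),
        C ((x.1 : ℂ) - j + 1 / 2) * (pairing (paramX n) x.1 * pairing (paramX n) x.2) := by
  have hi := i.2
  have hj := j.2
  have hk := k.2
  rw [Fin.sum_univ_castSucc, flatChristoffel_last_up, zero_mul, add_zero]
  simp only [flatChristoffel_castSucc, metric_castSucc_castSucc, neg_mul]
  rw [Finset.sum_neg_distrib, neg_inj]
  set s : ℕ := (i : ℕ) + j + k - 1 with hs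
  have hz : ∀ a, a < n - 1 → pairing (paramX n) a = 0 := fun a ha => pairing_of_lt _ (by omega)
  -- Both sums are cut down to their possibly nonzero terms, which m ↦ (m + j, k + i - m - 1)
  -- matches.
  rw [← Finset.sum_filter_of_ne (p := fun x : ℕ × ℕ => (j : ℕ) ≤ x.1 ∧ n - 1 ≤ x.2),
    ← Finset.sum_filter_of_ne (s := Finset.univ) (p := fun m : Fin n => (m : ℕ) + n ≤ k + i)]
  · refine Finset.sum_bij' (fun m _ => ((m : ℕ) + j, (k : ℕ) + i - m - 1))
      (fun x hx => ⟨x.1 - j, by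
        simp only [Finset.mem_filter, Finset.HasAntidiagonal.mem_antidiagonal] at hx
        omega⟩) ?_ ?_ ?_ ?_ ?_
    · intro m hm
      simp only [Finset.mem_filter, Finset.mem_univ, true_and] at hm
      simp only [Finset.mem_filter, Finset.HasAntidiagonal.mem_antidiagonal]
      omega
    · intro x hx
      simp only [Finset.mem_filter, Finset.HasAntidiagonal.mem_antidiagonal] at hx
      simp only [Finset.mem_filter, Finset.mem_univ, true_and]
      omega
    · intro m _
      simp
    · intro x hx
      simp only [Finset.mem_filter, Finset.HasAntidiagonal.mem_antidiagonal] at hx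
      refine Prod.ext ?_ ?_ <;> simp only <;> omega
    · intro m hm
      simp only [Finset.mem_filter, Finset.mem_univ, true_and] at hm
      rw [coeff_quotPoly (by omega), if_pos (by omega)]
      push_cast
      rw [add_sub_cancel_right]
      ring
  · intro m _ h
    by_contra hm
    refine h ?_
    rw [coeff_quotPoly (by omega)]
    split_ifs
    · rw [hz _ (by omega), mul_zero, zero_mul]
    · rw [mul_zero, zero_mul]
  · intro x _ h
    by_contra hx
    refine h ?_
    by_cases h1 : x.2 < n - 1
    · rw [hz x.2 h1, mul_zero, mul_zero]
    · rw [hz x.1 (by omega), zero_mul, mul_zero]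

/-- The metric is parallel. -/
theorem pderiv_metric (hn : 2 ≤ n) (k i j : Fin (n + 1)) :
    pderiv k (metric n i j) = ∑ m, (flatChristoffel n m k i * metric n m j
      + flatChristoffel n m k j * metric n i m) := by
  have hz : ∀ a b : Fin (n + 1), ∑ m, flatChristoffel n m a b * metric n m (Fin.last n) = 0 := by
    intro a b
    rw [Fin.sum_univ_castSucc]; simp
  rw [Finset.sum_add_distrib]
  simp only [metric_comm i]
  induction k using Fin.lastCases with
  | last =>
    simp only [flatChristoffel_last_left, zero_mul, Finset.sum_const_zero, add_zero]
    induction i using Fin.lastCases <;> induction j using Fin.lastCases <;>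
      simp [pderiv_last_pairing (n := n) (by omega)]
  | cast k =>
    induction i using Fin.lastCases with
    | last =>
      simp only [hz, flatChristoffel_last_right, zero_mul, Finset.sum_const_zero, add_zero]
      induction j using Fin.lastCases <;> simp
    | cast i =>
      induction j using Fin.lastCases with
      | last =>
        simp only [hz, flatChristoffel_last_right, zero_mul, Finset.sum_const_zero, add_zero]
        simp
      | cast j =>
        rw [sum_flatChristoffel_mul_pairing hn, sum_flatChristoffel_mul_pairing hn, metric_comm,
          metric_castSucc_castSucc, pderiv_castSucc_pairing (by omega), add_comm (j : ℕ) i]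
        set s : ℕ := (i : ℕ) + j + k - 1 with hs
        -- After the swap the two weights at (x₁, x₂) add up to x₁ + x₂ + 1 - i - j = k, the factor
        -- in the derivative of `pairing`.
        have hswap : ∑ x ∈ Finset.HasAntidiagonal.antidiagonal s, C ((x.1 : ℂ) - i + 1 / 2)
              * (pairing (paramX n) x.1 * pairing (paramX n) x.2)
            = ∑ x ∈ Finset.HasAntidiagonal.antidiagonal s, C ((x.2 : ℂ) - i + 1 / 2)
              * (pairing (paramX n) x.1 * pairing (paramX n) x.2) := by
          refine Finset.sum_nbij' Prod.swap Prod.swap (by simp [add_comm]) (by simp [add_comm])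
            (by simp) (by simp) fun x _ => ?_
          rw [mul_comm (pairing _ _)]; rfl
        rw [hswap, ← neg_add, ← Finset.sum_add_distrib,
          Finset.mul_sum]
        refine congrArg _ (Finset.sum_congr rfl fun x hx => ?_)
        rw [Finset.HasAntidiagonal.mem_antidiagonal] at hx
        -- For i = j = k = 0 the index i + j + k - 1 is truncated, but then `pairing` at 0 vanishes
        -- because n ≥ 2.
        rcases Nat.eq_zero_or_pos ((i : ℕ) + j + k) with h0 | h0
        · rw [pairing_of_lt (m := x.1) _ (by omega)]; simp
        have h1 : ((x.1 : ℂ) - j + 1 / 2) + (x.2 - i + 1 / 2) = (k : ℕ) := by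
          have h2 : (x.1 : ℂ) + x.2 + 1 = i + j + k := by
            exact_mod_cast (by omega : x.1 + x.2 + 1 = (i : ℕ) + j + k)
          linear_combination h2
        rw [← add_mul, ← C_add, h1, map_natCast]

/-- A formal solution of a linear system of differential equations is determined by its value at
the origin. -/
theorem eq_zero_of_pderiv_eq_sum {m : ℕ} {ι : Type*} [Fintype ι]
    {Z : ι → MvPolynomial (Fin m) ℂ} {B : Fin m → ι → ι → MvPolynomial (Fin m) ℂ}
    (h0 : ∀ a, constantCoeff (Z a) = 0) (h : ∀ k a, pderiv k (Z a) = ∑ b, B k a b * Z b) (a : ι) :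
    Z a = 0 := by
  classical
  suffices hs : ∀ d, ∀ a, ∀ e : Fin m →₀ ℕ, e.degree = d → coeff e (Z a) = 0 by
    ext e; exact hs _ a e rfl
  intro d
  induction d using Nat.strong_induction_on with
  | _ d ih =>
    intro a e he
    by_cases h1 : e = 0
    · rw [h1]; exact h0 a
    obtain ⟨k, hk⟩ : ∃ k, e k ≠ 0 := by
      by_contra! h2; exact h1 (Finsupp.ext h2)
    have hs : Finsupp.single k 1 ≤ e := Finsupp.single_le_iff.2 (Nat.one_le_iff_ne_zero.2 hk)
    have hd := congrArg Finsupp.degree (tsub_add_cancel_of_le hs)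
    rw [map_add, Finsupp.degree_single, he] at hd
    -- The coefficient at e - e_k of the k-th equation expresses the coefficient of Z at e through
    -- coefficients of smaller degree.
    have h2 := congrArg (coeff (e - Finsupp.single k 1)) (h k a)
    rw [coeff_pderiv, tsub_add_cancel_of_le hs, coeff_sum, Finset.sum_eq_zero] at h2
    · refine (mul_eq_zero.1 h2).resolve_right ?_
      exact Nat.cast_add_one_ne_zero _
    · intro b _
      rw [coeff_mul]
      refine Finset.sum_eq_zero fun x hx => ?_
      have hx := congrArg Finsupp.degree (Finset.HasAntidiagonal.mem_antidiagonal.1 hx)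
      rw [map_add] at hx
      rw [ih _ (by omega) b x.2 rfl, mul_zero]

/-- The matrix of the Saito metric in the flat coordinates. -/
def flatMetric (n : ℕ) : Matrix (Fin (n + 1)) (Fin (n + 1)) ℂ :=
  Matrix.of fun i j => constantCoeff (metric n i j)

/-- The Saito metric is constant in the flat coordinates. -/
theorem metric_eq_sum (hn : 2 ≤ n) (i j : Fin (n + 1)) :
    metric n i j = ∑ α, ∑ β, C (flatMetric n α β) * pderiv i (flatCoord (n + 1) α)
      * pderiv j (flatCoord (n + 1) β) := by
  classical
  have hn0 : n ≠ 0 := by omega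
  set Y : Fin (n + 1) → Fin (n + 1) → Params (n + 1) := fun i j => ∑ α, ∑ β,
    C (flatMetric n α β) * pderiv i (flatCoord (n + 1) α) * pderiv j (flatCoord (n + 1) β) with hY
  -- A form with constant coefficients in flat coordinates is parallel, so it satisfies the same
  -- linear system as the metric.
  have hYd : ∀ k i j, pderiv k (Y i j) = ∑ m, (flatChristoffel n m k i * Y m j
      + flatChristoffel n m k j * Y i m) := by
    intro k i j
    have h1 : ∀ α β, pderiv k (C (flatMetric n α β) * pderiv i (flatCoord (n + 1) α)
        * pderiv j (flatCoord (n + 1) β)) = ∑ m, (flatChristoffel n m k i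
          * (C (flatMetric n α β) * pderiv m (flatCoord (n + 1) α) * pderiv j (flatCoord (n + 1) β))
        + flatChristoffel n m k j
          * (C (flatMetric n α β) * pderiv i (flatCoord (n + 1) α)
            * pderiv m (flatCoord (n + 1) β))) := by
      intro α β
      rw [pderiv_mul, pderiv_C_mul, hessian_flatCoord hn0, hessian_flatCoord hn0,
        Finset.sum_add_distrib, Finset.mul_sum, Finset.mul_sum, Finset.sum_mul]
      exact congrArg₂ _ (Finset.sum_congr rfl fun _ _ => by ring)
        (Finset.sum_congr rfl fun _ _ => by ring)
    simp only [hY, map_sum, h1, Finset.mul_sum]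
    rw [Finset.sum_congr rfl fun α _ => Finset.sum_comm, Finset.sum_comm]
    simp only [Finset.sum_add_distrib]
  have hJ0 : ∀ i α, constantCoeff (pderiv i (flatCoord (n + 1) α)) = if i = α then 1 else 0 := by
    intro i α
    change coeff 0 _ = _
    rw [coeff_pderiv, zero_add, coeff_flatCoord _ _ (by simp), coeff_X,
      Finsupp.zero_apply, Nat.cast_zero, zero_add, mul_one]
    exact if_congr ((Finsupp.single_left_inj one_ne_zero).trans eq_comm) rfl rfl
  have hY0 : ∀ i j, constantCoeff (Y i j) = constantCoeff (metric n i j) := by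
    intro i j
    simp only [hY, map_sum, map_mul, constantCoeff_C, hJ0]
    simp [flatMetric]
  -- The Jacobian matrix at the origin is the identity, so both forms agree there. Their difference
  -- solves a homogeneous linear system indexed by pairs.
  have hz := eq_zero_of_pderiv_eq_sum (Z := fun a : Fin (n + 1) × Fin (n + 1) =>
      metric n a.1 a.2 - Y a.1 a.2)
    (B := fun k a b => (if b.2 = a.2 then flatChristoffel n b.1 k a.1 else 0)
      + if b.1 = a.1 then flatChristoffel n b.2 k a.2 else 0)
    (fun a => by rw [map_sub, hY0, sub_self]) (fun k a => by
      rw [map_sub, pderiv_metric hn, hYd, ← Finset.sum_sub_distrib, Fintype.sum_prod_type]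
      simp only [add_mul, ite_mul, zero_mul, Finset.sum_add_distrib, Finset.sum_ite_eq',
        Finset.mem_univ, if_true]
      rw [Finset.sum_comm (s := Finset.univ) (t := Finset.univ)
        (f := fun x y => if x = a.1 then flatChristoffel n y k a.2 * (metric n x y - Y x y) else 0)]
      simp only [Finset.sum_ite_eq', Finset.mem_univ, if_true, ← Finset.sum_add_distrib]
      exact Finset.sum_congr rfl fun m _ => by ring) (i, j)
  exact sub_eq_zero.1 hz

theorem constantCoeff_pairing (hn : n ≠ 0) (m : ℕ) :
    constantCoeff (pairing (paramX n) m) = if m + 1 = n then 1 else 0 := by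
  have h := congrArg (PowerSeries.map (constantCoeff (σ := Fin (n + 1)) (R := ℂ)))
    (revCrit_mul_mk_pairing hn (paramX n))
  have h1 : PowerSeries.map (constantCoeff (σ := Fin (n + 1)) (R := ℂ)) (revCrit (paramX n)) = 1 := by
    rw [revCrit, map_add, map_one, map_sum, Finset.sum_eq_zero, add_zero]
    intro i _
    rw [map_mul, PowerSeries.map_C, map_mul, constantCoeff_X, mul_zero, map_zero, zero_mul]
  rw [map_mul, h1, one_mul, map_pow, PowerSeries.map_X] at h
  have h2 := congrArg (PowerSeries.coeff m) h
  rw [PowerSeries.coeff_map, PowerSeries.coeff_mk, PowerSeries.coeff_X_pow] at h2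
  rw [h2]
  exact if_congr (by omega) rfl rfl

/-- At the origin `critPoly` is x^n, so the matrix is an antidiagonal block of ones together with
the entry -1. -/
theorem flatMetric_mul_self (hn : n ≠ 0) : flatMetric n * flatMetric n = 1 := by
  classical
  have hc : ∀ (i j : Fin n), (i : ℕ) + j + 1 = n ↔ j = i.rev := by
    intro i j
    rw [Fin.ext_iff, Fin.val_rev]; omega
  ext i j
  rw [Matrix.mul_apply, Fin.sum_univ_castSucc]
  simp only [flatMetric, Matrix.of_apply]
  induction i using Fin.lastCases with
  | last =>
    induction j using Fin.lastCases with
    | last => simp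
    | cast j => simp [(Fin.castSucc_lt_last j).ne']
  | cast i =>
    induction j using Fin.lastCases with
    | last => simp [(Fin.castSucc_lt_last i).ne]
    | cast j =>
      simp only [metric_castSucc_castSucc, constantCoeff_pairing hn, hc, metric_castSucc_last,
        map_zero, zero_mul, add_zero, ite_mul, one_mul, Finset.sum_ite_eq', Finset.mem_univ, if_true,
        Fin.rev_rev, Matrix.one_apply, Fin.castSucc_inj, eq_comm (a := j)]

theorem det_flatMetric_ne_zero (hn : n ≠ 0) : (flatMetric n).det ≠ 0 := by
  intro h
  have := congrArg Matrix.det (flatMetric_mul_self hn)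
  rw [Matrix.det_mul, h, zero_mul, Matrix.det_one] at this
  exact zero_ne_one this

/-- Associativity, read off at the coefficient of x^{N-2}. -/
theorem metric_invariant (hn : 2 ≤ n) (i j k : Fin (n + 1)) :
    ∑ m, mulCoord (paramX n) i j m * metric n m k
      = ∑ m, mulCoord (paramX n) j k m * metric n i m := by
  have h := mulCoord_paramX_assoc hn (Fin.castSucc ⟨n - 1, by omega⟩) i j k
  have hl : ((⟨n - 1, by omega⟩ : Fin n) : ℕ) + 1 = n := by simp; omega
  simpa only [mulCoord_eq_metric _ _ hl] using h

end Metric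

end DSaito
end

noncomputable section
namespace DSaito

open MvPolynomial

variable {n : ℕ}

/-! ### The Saito Frobenius manifold. -/

section Frobenius

theorem pderiv_comm (f : Params n) (i j : Fin n) :
    pderiv i (pderiv j f) = pderiv j (pderiv i f) :=
  MvPolynomial.funext fun p => by
    simpa only [pd_eval] using pd_comm (analyticAt_eval f p) i j

theorem pd_pd_eval (f : Params n) (i j : Fin n) (p : Fin n → ℂ) :
    pd i (pd j fun q => eval q f) p = eval p (pderiv i (pderiv j f)) := by
  rw [pd_eval, pd_eval]

/-- The vector potential of the Saito manifold in the flat coordinates. -/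
def flatPotential (n : ℕ) (α : Fin (n + 1)) : Params (n + 1) :=
  aeval (invCoord n) (saitoPotential n α)

theorem eval_flatPotential (α : Fin (n + 1)) (p : Fin (n + 1) → ℂ) :
    eval (fun a => saitoCoord (n + 1) a p) (flatPotential n α) = eval p (saitoPotential n α) := by
  rw [flatPotential, eval_aeval]
  exact congrArg (fun q => eval q _) (funext (eval_invCoord p))

theorem saitoCoord_flat (hn : n ≠ 0) (p : Fin (n + 1) → ℂ) (α i j : Fin (n + 1)) :
    pd i (pd j (saitoCoord (n + 1) α)) p
      = ∑ k, eval p (flatChristoffel n k i j) * pd k (saitoCoord (n + 1) α) p := by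
  have h := congrArg (eval p) (hessian_flatCoord hn α i j)
  simp only [map_sum, map_mul] at h
  simp only [pd_saitoCoord]
  rw [← h]
  exact pd_pd_eval _ i j p

theorem analyticAt_saitoCoord (α : Fin (n + 1)) (p : Fin (n + 1) → ℂ) :
    AnalyticAt ℂ (saitoCoord (n + 1) α) p := analyticAt_eval _ p

/-- The Hessian in the coordinates t is the covariant Hessian in the coordinates v, so the
Christoffel term of `hessian_saitoPotential` cancels. -/
theorem flatPotential_structure (hn : n ≠ 0) (p : Fin (n + 1) → ℂ) (α i j : Fin (n + 1)) :
    ∑ k, eval p (mulCoord (paramX n) i j k) * pd k (saitoCoord (n + 1) α) p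
      = ∑ b, ∑ c, eval (fun a => saitoCoord (n + 1) a p) (pderiv b (pderiv c (flatPotential n α)))
        * pd i (saitoCoord (n + 1) b) p * pd j (saitoCoord (n + 1) c) p := by
  have h := sum_pd_pd_eq_hessian (f := fun τ => eval τ (flatPotential n α))
    (t := saitoCoord (n + 1)) (p := p) (analyticAt_eval _ _) (fun a => analyticAt_saitoCoord a p) i j
    (fun k => eval p (flatChristoffel n k i j)) (fun a => saitoCoord_flat hn p a i j)
  simp only [eval_flatPotential, pd_pd_eval] at h
  simp only [pd_eval] at h
  rw [h, hessian_saitoPotential hn]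
  simp only [map_add, map_sum, map_mul, pd_saitoCoord]
  ring

theorem isVectorPotential_flatPotential (hn : 2 ≤ n) : IsVectorPotential Set.univ (saitoMul (n + 1))
    (saitoCoord (n + 1)) fun α τ => eval τ (flatPotential n α) := by
  refine ⟨fun α τ _ => analyticAt_eval _ τ, fun p _ α i j => ?_⟩
  simp only [saitoMul_eq hn, pd_pd_eval]
  exact flatPotential_structure (by omega) p α i j

theorem saitoMetric_eq (hn : 2 ≤ n) (hN : 4 ≤ n + 1) (i j : Fin (n + 1)) (p : Fin (n + 1) → ℂ) :
    saitoMetric (n + 1) hN i j p = eval p (metric n i j) := by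
  rw [saitoMetric, saitoMul_eq hn,
    show (⟨n + 1 - 2, by omega⟩ : Fin (n + 1)) = Fin.castSucc ⟨n - 1, by omega⟩ from
      Fin.ext (by simp), mulCoord_eq_metric]
  simp; omega

theorem isConstantMatrixOf_flatMetric (hn : 2 ≤ n) (hN : 4 ≤ n + 1) :
    IsConstantMatrixOf Set.univ (saitoMetric (n + 1) hN) (saitoCoord (n + 1)) (flatMetric n) := by
  intro p _ i j
  rw [saitoMetric_eq hn, metric_eq_sum hn]
  simp only [map_sum, map_mul, eval_C, pd_saitoCoord]

theorem isFlatFManifold_saito (hn : 2 ≤ n) :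
    IsFlatFManifold Set.univ (christoffel (saitoCoord (n + 1))) (saitoMul (n + 1))
      (fun k _ => if k = 0 then 1 else 0) ∧
    IsFlatCoordinates Set.univ (christoffel (saitoCoord (n + 1)))
      (fun k _ => if k = 0 then 1 else 0) (saitoCoord (n + 1)) := by
  refine isFlatFManifold_of_vectorPotential isOpen_univ ?_ (fun α p _ => analyticAt_saitoCoord α p)
    (injective_saitoCoord n).injOn (fun p _ => det_jacobianMatrix_saitoCoord p) ?_ ?_ ?_ ?_
    (isVectorPotential_flatPotential hn)
  · intro k i j p _
    exact analyticAt_eval _ p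
  · intro p _ a
    rw [pd_saitoCoord, pderiv_zero_flatCoord (by omega)]
    split_ifs <;> simp
  · intro p _ k i j
    rw [saitoMul, structureConstant_comm]; rfl
  · intro p _ l i j k
    have := congrArg (eval p) (mulCoord_paramX_assoc hn l i j k)
    simpa only [saitoMul_eq hn, map_sum, map_mul] using this
  · intro p _ k j
    rw [saitoMul_eq hn, mulCoord_paramX_zero_left hn]
    split_ifs <;> simp

/-- Flatness of t determines the connection because the Jacobian matrix is invertible. -/
theorem christoffel_saitoCoord (hn : n ≠ 0) (k i j : Fin (n + 1)) (p : Fin (n + 1) → ℂ) :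
    christoffel (saitoCoord (n + 1)) k i j p = eval p (flatChristoffel n k i j) := by
  have h : (fun m => pdMatrix i (jacobianMatrix (saitoCoord (n + 1))) p m j)
      = (jacobianMatrix (saitoCoord (n + 1)) p).mulVec fun k => eval p (flatChristoffel n k i j) := by
    funext m
    refine (saitoCoord_flat hn p m i j).trans ?_
    exact Finset.sum_congr rfl fun _ _ => mul_comm _ _
  have h2 : (jacobianMatrix (saitoCoord (n + 1)) p)⁻¹.mulVec
      ((jacobianMatrix (saitoCoord (n + 1)) p).mulVec fun k => eval p (flatChristoffel n k i j))
      = fun k => eval p (flatChristoffel n k i j) := by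
    rw [Matrix.mulVec_mulVec, Matrix.nonsing_inv_mul _ (det_jacobianMatrix_saitoCoord p).isUnit,
      Matrix.one_mulVec]
  rw [← h] at h2
  exact congrFun h2 k

theorem definesFrobeniusManifold_saito {N : ℕ} (hN : 4 ≤ N) :
    DefinesFrobeniusManifold Set.univ (saitoMul N) (saitoMetric N hN) (saitoCoord N) := by
  obtain ⟨n, rfl⟩ : ∃ n, N = n + 1 := ⟨N - 1, by omega⟩
  have hn : 2 ≤ n := by omega
  have hη : ∀ i j, saitoMetric (n + 1) hN i j = fun p => eval p (metric n i j) :=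
    fun i j => funext (saitoMetric_eq hn hN i j)
  refine ⟨_, _, ⟨(isFlatFManifold_saito hn).1, ?_, ?_, ?_, ?_, ?_⟩, (isFlatFManifold_saito hn).2⟩
  · intro i j p _
    exact analyticAt_eval _ p
  · intro p _ i j
    rw [hη, hη, metric_comm]
  · intro p _
    have h : Matrix.of (fun i j => saitoMetric (n + 1) hN i j p)
        = (jacobianMatrix (saitoCoord (n + 1)) p).transpose * flatMetric n
          * jacobianMatrix (saitoCoord (n + 1)) p := by
      ext i j
      rw [Matrix.of_apply, isConstantMatrixOf_flatMetric hn hN p trivial]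
      simp only [Matrix.mul_apply, Matrix.transpose_apply, Finset.sum_mul]
      rw [Finset.sum_comm]
      exact Finset.sum_congr rfl fun _ _ => Finset.sum_congr rfl fun _ _ => by
        rw [mul_comm (flatMetric n _ _)]; rfl
    rw [h, Matrix.det_mul, Matrix.det_mul, Matrix.det_transpose]
    exact mul_ne_zero (mul_ne_zero (det_jacobianMatrix_saitoCoord p)
      (det_flatMetric_ne_zero (by omega))) (det_jacobianMatrix_saitoCoord p)
  · intro p _ k i j
    simp only [hη, pd_eval, christoffel_saitoCoord (n := n) (by omega)]
    rw [pderiv_metric hn]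
    simp only [map_sum, map_add, map_mul]
  · intro p _ i j k
    simp only [hη, saitoMul_eq hn]
    simpa only [map_sum, map_mul] using congrArg (eval p) (metric_invariant hn i j k)

end Frobenius

/-! ### The potential of the Saito manifold. -/

section Potential

/-- The third derivatives of the potential of the Saito manifold. -/
def thirdDeriv (n : ℕ) (a b c : Fin (n + 1)) : Params (n + 1) :=
  ∑ μ, C (flatMetric n a μ) * pderiv b (pderiv c (flatPotential n μ))

/-- In the frame ∂/∂v the tensor `thirdDeriv` is η(∂_i, ∂_j ∘ ∂_k). -/
theorem sum_thirdDeriv (hn : 2 ≤ n) (p : Fin (n + 1) → ℂ) (i j k : Fin (n + 1)) :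
    ∑ a, ∑ b, ∑ c, eval (fun a => saitoCoord (n + 1) a p) (thirdDeriv n a b c)
        * pd i (saitoCoord (n + 1) a) p * pd j (saitoCoord (n + 1) b) p
        * pd k (saitoCoord (n + 1) c) p
      = ∑ m, eval p (mulCoord (paramX n) j k m) * eval p (metric n i m) := by
  have hn0 : n ≠ 0 := by omega
  have h1 : ∀ a, ∑ b, ∑ c, eval (fun a => saitoCoord (n + 1) a p) (thirdDeriv n a b c)
        * pd i (saitoCoord (n + 1) a) p * pd j (saitoCoord (n + 1) b) p
        * pd k (saitoCoord (n + 1) c) p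
      = ∑ μ, flatMetric n a μ * pd i (saitoCoord (n + 1) a) p
        * ∑ m, eval p (mulCoord (paramX n) j k m) * pd m (saitoCoord (n + 1) μ) p := by
    intro a
    simp only [flatPotential_structure hn0 p _ j k, thirdDeriv, map_sum, map_mul, eval_C,
      Finset.sum_mul, Finset.mul_sum]
    rw [Finset.sum_congr rfl fun b _ => Finset.sum_comm, Finset.sum_comm]
    exact Finset.sum_congr rfl fun μ _ => Finset.sum_congr rfl fun b _ =>
      Finset.sum_congr rfl fun c _ => by ring
  rw [Finset.sum_congr rfl fun a _ => h1 a]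
  simp only [metric_eq_sum hn i, map_sum, map_mul, eval_C, Finset.mul_sum, pd_saitoCoord]
  rw [Finset.sum_congr rfl fun a _ => Finset.sum_comm, Finset.sum_comm]
  exact Finset.sum_congr rfl fun m _ => Finset.sum_congr rfl fun a _ =>
    Finset.sum_congr rfl fun μ _ => by ring

theorem thirdDeriv_comm₂₃ (a b c : Fin (n + 1)) : thirdDeriv n a b c = thirdDeriv n a c b := by
  simp only [thirdDeriv, pderiv_comm _ b c]

/-- In the frame ∂/∂v this is invariance of η together with commutativity. Testing at points
suffices, and every τ is t(p) for some p by polynomial inversion. -/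
theorem thirdDeriv_comm₁₂ (hn : 2 ≤ n) (a b c : Fin (n + 1)) :
    thirdDeriv n a b c = thirdDeriv n b a c := by
  refine MvPolynomial.funext fun τ => ?_
  obtain ⟨p, rfl⟩ : ∃ p, (fun a => saitoCoord (n + 1) a p) = τ :=
    ⟨_, funext (saitoCoord_invCoord τ)⟩
  refine congrFun (congrFun (congrFun (eq_of_sum_mul_eq (det_jacobianMatrix_saitoCoord p)
    (X := fun a b c => eval (fun a => saitoCoord (n + 1) a p) (thirdDeriv n a b c))
    (Y := fun a b c => eval (fun a => saitoCoord (n + 1) a p) (thirdDeriv n b a c)) ?_) a) b) c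
  intro i j k
  refine (sum_thirdDeriv hn p i j k).trans ?_
  rw [Finset.sum_comm]
  have h := (sum_thirdDeriv hn p j i k)
  have e1 := congrArg (eval p) (metric_invariant hn i j k)
  have e2 := congrArg (eval p) (metric_invariant hn j i k)
  simp only [mulCoord_comm _ j i] at e2
  simp only [map_sum, map_mul] at e1 e2
  rw [← e1, e2, ← h]
  refine Finset.sum_congr rfl fun a _ => Finset.sum_congr rfl fun b _ =>
    Finset.sum_congr rfl fun c _ => ?_
  simp only [jacobianMatrix, Matrix.of_apply]
  ring

theorem pderiv_thirdDeriv (a b c d : Fin (n + 1)) :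
    pderiv d (thirdDeriv n a b c) = pderiv c (thirdDeriv n a b d) := by
  simp only [thirdDeriv, map_sum, pderiv_C_mul]
  refine Finset.sum_congr rfl fun μ _ => ?_
  rw [pderiv_comm _ b c, pderiv_comm _ b d, pderiv_comm _ d c]

theorem pderiv_zero_pderiv_flatPotential (hn : 2 ≤ n) (a b : Fin (n + 1)) :
    pderiv 0 (pderiv b (flatPotential n a)) = if a = b then 1 else 0 := by
  refine MvPolynomial.funext fun τ => ?_
  obtain ⟨p, rfl⟩ : ∃ p, (fun a => saitoCoord (n + 1) a p) = τ :=
    ⟨_, funext (saitoCoord_invCoord τ)⟩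
  have hJ := det_jacobianMatrix_saitoCoord p
  have h : (fun b => eval (fun a => saitoCoord (n + 1) a p) (pderiv 0 (pderiv b (flatPotential n a)))
      - if a = b then 1 else 0) = 0 := by
    refine Matrix.eq_zero_of_vecMul_eq_zero hJ ?_
    funext j
    have h1 := flatPotential_structure (n := n) (by omega) p a 0 j
    have h0 : ∀ b, pd 0 (saitoCoord (n + 1) b) p = if b = 0 then 1 else 0 := by
      intro b
      rw [pd_saitoCoord, pderiv_zero_flatCoord (by omega)]
      simp only [Fin.ext_iff, Fin.val_zero]
      split_ifs <;> simp
    simp only [mulCoord_paramX_zero_left hn, h0, mul_ite, mul_one, mul_zero] at h1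
    simp only [apply_ite (eval p), map_one, map_zero, ite_mul, one_mul, zero_mul,
      Finset.sum_ite_eq', Finset.mem_univ, if_true] at h1
    rw [Finset.sum_comm] at h1
    simp only [Finset.sum_ite_eq', Finset.mem_univ, if_true] at h1
    simp only [Matrix.vecMul, dotProduct, sub_mul, Finset.sum_sub_distrib, ite_mul, one_mul,
      zero_mul, Finset.sum_ite_eq, Finset.mem_univ, if_true, jacobianMatrix, Matrix.of_apply,
      Pi.zero_apply]
    rw [h1, sub_self]
  have h2 := sub_eq_zero.1 (congrFun h b)
  rw [h2]
  split_ifs <;> simp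

/-- The potential of the Saito manifold. -/
theorem exists_saitoPotential (hn : 2 ≤ n) : ∃ F : Params (n + 1), (∀ m ∈ F.support, 3 ≤ m.degree) ∧
    (∀ α β, pderiv 0 (pderiv α (pderiv β F)) = C (flatMetric n α β)) ∧
    ∀ α β γ, (fun τ => pd β (pd γ (gradientPotential (flatMetric n) F α)) τ)
        = (fun τ => pd β (pd γ fun τ => eval τ (flatPotential n α)) τ) := by
  classical
  obtain ⟨F, hF, hF3⟩ := exists_potential (thirdDeriv_comm₁₂ hn) thirdDeriv_comm₂₃
    (fun a b c d => pderiv_thirdDeriv (n := n) a b c d)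
  refine ⟨F, hF, fun α β => ?_, fun α β γ => ?_⟩
  · rw [hF3, thirdDeriv_comm₁₂ hn, thirdDeriv]
    simp only [pderiv_zero_pderiv_flatPotential hn]
    simp
  -- The gradient of F and `flatPotential` may differ by affine functions, so only second
  -- derivatives are compared; raising the index cancels the factor `flatMetric`.
  · have hg : gradientPotential (flatMetric n) F α
        = fun τ => eval τ (∑ μ, C ((flatMetric n)⁻¹ α μ) * pderiv μ F) := by
      funext τ
      simp [gradientPotential]
    funext τ
    rw [hg, pd_pd_eval, pd_pd_eval]
    refine congrArg _ ?_
    have h1 : ∀ μ, pderiv β (pderiv γ (pderiv μ F)) = thirdDeriv n μ β γ := by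
      intro μ
      rw [hF3, thirdDeriv_comm₂₃, thirdDeriv_comm₁₂ hn]
    simp only [map_sum, pderiv_C_mul, h1, thirdDeriv, Finset.mul_sum, ← mul_assoc, ← C_mul]
    rw [Finset.sum_comm]
    simp only [← Finset.sum_mul, ← map_sum]
    have h2 : ∀ ν, ∑ μ, (flatMetric n)⁻¹ α μ * flatMetric n μ ν = if α = ν then 1 else 0 := by
      intro ν
      rw [← Matrix.mul_apply, Matrix.nonsing_inv_mul _
        (det_flatMetric_ne_zero (n := n) (by omega)).isUnit, Matrix.one_apply]
    simp only [h2]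
    simp

theorem analyticAt_gradientPotential (G : Matrix (Fin n) (Fin n) ℂ) (F : Params n) (α : Fin n)
    (τ : Fin n → ℂ) : AnalyticAt ℂ (gradientPotential G F α) τ :=
  Finset.analyticAt_fun_sum _ fun _ _ => analyticAt_const.mul (analyticAt_eval _ _)

end Potential

end DSaito
end

noncomputable section
namespace DSaito

variable {n : ℕ}

/-! ### Compatibility of the tables with change of the parameter ring. -/

section Naturality

variable {S S' : Type*} [CommRing S] [CommRing S'] (f : S →+* S')

theorem map_critPoly (v : Fin (n + 1) → S) :
    (critPoly v).map f = critPoly fun i => f (v i) := by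
  simp [critPoly, Polynomial.map_sum]

theorem map_quotPoly (v : Fin (n + 1) → S) (m : ℕ) :
    (quotPoly v m).map f = quotPoly (fun i => f (v i)) m := by
  rw [quotPoly, Polynomial.map_divByMonic f (critPoly_monic v), map_critPoly, Polynomial.map_pow,
    Polynomial.map_X, quotPoly]

theorem map_remPoly (v : Fin (n + 1) → S) (m : ℕ) :
    (remPoly v m).map f = remPoly (fun i => f (v i)) m := by
  rw [remPoly, Polynomial.map_modByMonic f (critPoly_monic v), map_critPoly, Polynomial.map_pow,
    Polynomial.map_X, remPoly]

theorem map_mulQuot (v : Fin (n + 1) → S) (i j : Fin (n + 1)) :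
    (mulQuot v i j).map f = mulQuot (fun i => f (v i)) i j := by
  induction i using Fin.lastCases <;> induction j using Fin.lastCases <;> simp [map_quotPoly]

variable [Algebra ℂ S] [Algebra ℂ S']

/-- The ring homomorphism need not be ℂ-linear, but the inverse of 2 is unique. -/
theorem map_half : f (algebraMap ℂ S (1 / 2)) = algebraMap ℂ S' (1 / 2) := by
  have h := congrArg f (half_add_half S)
  rw [map_add, map_one] at h
  have h2 := half_add_half S'
  linear_combination (algebraMap ℂ S' (1 / 2)) * h - f (algebraMap ℂ S (1 / 2)) * h2

theorem map_halfLast (v : Fin (n + 1) → S) : f (halfLast v) = halfLast fun i => f (v i) := by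
  rw [halfLast, map_mul, map_half, halfLast]

theorem map_mulCoord (v : Fin (n + 1) → S) (i j k : Fin (n + 1)) :
    f (mulCoord v i j k) = mulCoord (fun i => f (v i)) i j k := by
  induction i using Fin.lastCases <;> induction j using Fin.lastCases <;>
    induction k using Fin.lastCases <;>
    simp [← map_critPoly, ← map_quotPoly, ← map_remPoly, ← map_halfLast, apply_ite f]

theorem map_extX (s : S) : f (extX s) = extX (f s) := by
  rw [extX, map_mul, map_half, map_pow, extX]

omit [Algebra ℂ S] [Algebra ℂ S'] in
theorem map_extY (v : Fin (n + 1) → S) (t : S) : f (extY v t) = extY (fun i => f (v i)) (f t) := by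
  simp [extY]

theorem map_extCrit (v : Fin (n + 1) → S) (s t : S) :
    f (extCrit v s t) = extCrit (fun i => f (v i)) (f s) (f t) := by
  have h : (critPoly v).divX.map f = (critPoly fun i => f (v i)).divX := by
    ext k; rw [Polynomial.coeff_map, Polynomial.coeff_divX, Polynomial.coeff_divX, ← map_critPoly f,
      Polynomial.coeff_map]
  rw [extCrit, map_add, ← Polynomial.eval_map_apply, h, map_pow, map_extX, map_extY, extCrit]

theorem map_extMulCoord (v : Fin (n + 1) → S) (s t : S) (i j k : Fin (n + 1 + 1)) :
    f (extMulCoord v s t i j k) = extMulCoord (fun i => f (v i)) (f s) (f t) i j k := by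
  induction i using Fin.lastCases <;> induction j using Fin.lastCases <;>
    induction k using Fin.lastCases <;>
    simp [map_mulCoord, map_extCrit, map_monomialD, map_extY, ← map_mulQuot,
      Polynomial.eval_map_apply, ← map_extX]

end Naturality

/-! ### The multiplication on ℂ^N × ℂ^*. -/

section ExtLaws

open MvPolynomial

namespace IsExtJacobianAlgebra

variable {S A : Type*} [CommRing S] [Algebra ℂ S] [CommRing A] [Algebra S A] [IsDomain S]
  {v : Fin (n + 1) → S} {s t : S} {π : MvPolynomial (Fin 3) S →ₐ[S] A}

theorem extMulCoord_assoc (h : IsExtJacobianAlgebra v s π) (hst : s * t = 1) (hn : 2 ≤ n)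
    (hv : v (Fin.last n) ≠ 0) (l i j k : Fin (n + 1 + 1)) :
    ∑ m, extMulCoord v s t i j m * extMulCoord v s t m k l
      = ∑ m, extMulCoord v s t j k m * extMulCoord v s t i m l := by
  simp only [← h.structureConstant_eq hst hn hv]
  exact structureConstant_assoc (h.isModuleBasis hst hn hv) l i j k

theorem extMulCoord_zero_left (h : IsExtJacobianAlgebra v s π) (hst : s * t = 1) (hn : 2 ≤ n)
    (hv : v (Fin.last n) ≠ 0) (j k : Fin (n + 1 + 1)) :
    extMulCoord v s t 0 j k = if k = j then 1 else 0 := by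
  rw [← h.structureConstant_eq hst hn hv]
  refine structureConstant_one (h.isModuleBasis hst hn hv) ?_ k j
  exact (extMonomial_castSucc _ _ _ 0).trans (monomialD_zero (by omega) _ _)

end IsExtJacobianAlgebra

/-- Evaluation at a point of `ℂ^N × ℂ^*`. -/
def evalExtHom {N : ℕ} (p : Fin (N + 1) → ℂ) (hp : p (Fin.last N) ≠ 0) : ExtParams N →+* ℂ :=
  IsLocalization.Away.lift (S := ExtParams N) (X (Fin.last N)) (g := eval p)
    (by rw [eval_X]; exact hp.isUnit)

theorem evalExt_eq {N : ℕ} {p : Fin (N + 1) → ℂ} (hp : p (Fin.last N) ≠ 0) (f : ExtParams N) :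
    evalExt f p = evalExtHom p hp f := by
  rw [evalExt, dif_pos hp]; rfl

theorem evalExtHom_algebraMap {N : ℕ} {p : Fin (N + 1) → ℂ} (hp : p (Fin.last N) ≠ 0)
    (f : MvPolynomial (Fin (N + 1)) ℂ) :
    evalExtHom p hp (algebraMap _ (ExtParams N) f) = eval p f :=
  IsLocalization.Away.lift_eq _ _ f

theorem evalExtHom_extParam {N : ℕ} {p : Fin (N + 1) → ℂ} (hp : p (Fin.last N) ≠ 0)
    (i : Fin (N + 1)) : evalExtHom p hp (extParam N i) = p i := by
  rw [extParam, evalExtHom_algebraMap, eval_X]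

theorem evalExtHom_extSInv {p : Fin (n + 1 + 1) → ℂ} (hp : p (Fin.last (n + 1)) ≠ 0) :
    evalExtHom p hp (extSInv n) = (p (Fin.last (n + 1)))⁻¹ := by
  have h := congrArg (evalExtHom p hp) (extS_mul_inv n)
  rw [map_mul, map_one, evalExtHom_extParam] at h
  exact eq_inv_of_mul_eq_one_right h

theorem isOpen_extManifold (N : ℕ) : IsOpen (extManifold N) :=
  isOpen_ne_fun (continuous_apply _) continuous_const

theorem analyticAt_coord {m : ℕ} (i : Fin m) (p : Fin m → ℂ) : AnalyticAt ℂ (fun q => q i) p :=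
  (ContinuousLinearMap.proj (R := ℂ) (φ := fun _ : Fin m => ℂ) i).analyticAt p

theorem analyticOnNhd_evalExt {N : ℕ} (f : ExtParams N) :
    AnalyticOnNhd ℂ (evalExt f) (extManifold N) := by
  intro p hp
  -- Locally the function is the quotient of a polynomial by a power of the nonvanishing coordinate
  -- v_{N+1}.
  obtain ⟨k, a, h⟩ := IsLocalization.Away.surj (X (Fin.last N) : MvPolynomial (Fin (N + 1)) ℂ) f
  have h1 : (fun q => eval q a * (q (Fin.last N) ^ k)⁻¹) =ᶠ[nhds p] evalExt f := by
    filter_upwards [(isOpen_extManifold N).mem_nhds hp] with q hq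
    have hq' : q (Fin.last N) ≠ 0 := hq
    have h2 := congrArg (evalExtHom q hq') h
    rw [map_mul, map_pow, evalExtHom_algebraMap, evalExtHom_algebraMap, eval_X] at h2
    rw [evalExt_eq hq', ← h2, mul_assoc, mul_inv_cancel₀ (pow_ne_zero _ hq), mul_one]
  refine AnalyticAt.congr ?_ h1
  exact (analyticAt_eval a p).mul (((analyticAt_coord _ p).pow k).inv (pow_ne_zero _ hp))

theorem extMul_eq (hn : 2 ≤ n) {p : Fin (n + 1 + 1) → ℂ} (hp : p ∈ extManifold (n + 1))
    (k i j : Fin (n + 1 + 1)) : extMul (n + 1) k i j p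
      = extMulCoord (fun a => p a.castSucc) (p (Fin.last _)) (p (Fin.last _))⁻¹ i j k := by
  have hp' : p (Fin.last (n + 1)) ≠ 0 := hp
  rw [extMul, extStructureConstant_eq hn, evalExt_eq hp', map_extMulCoord,
    evalExtHom_extSInv]
  simp only [evalExtHom_extParam]

theorem extMul_comm (k i j : Fin (n + 1 + 1)) (p : Fin (n + 1 + 1) → ℂ) :
    extMul (n + 1) k i j p = extMul (n + 1) k j i p := by
  rw [extMul, structureConstant_comm]; rfl

theorem extMul_assoc (hn : 2 ≤ n) {p : Fin (n + 1 + 1) → ℂ} (hp : p ∈ extManifold (n + 1))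
    (l i j k : Fin (n + 1 + 1)) :
    ∑ m, extMul (n + 1) m i j p * extMul (n + 1) l m k p
      = ∑ m, extMul (n + 1) m j k p * extMul (n + 1) l i m p := by
  have hp' : p (Fin.last (n + 1)) ≠ 0 := hp
  have h := congrArg (evalExtHom p hp') ((isExtJacobianAlgebra_ext n).extMulCoord_assoc
    (extS_mul_inv n) hn (extParam_ne_zero _) l i j k)
  simp only [map_sum, map_mul, ← evalExt_eq, ← extStructureConstant_eq hn] at h
  exact h

theorem extMul_zero_left (hn : 2 ≤ n) {p : Fin (n + 1 + 1) → ℂ} (hp : p ∈ extManifold (n + 1))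
    (k j : Fin (n + 1 + 1)) : extMul (n + 1) k 0 j p = if k = j then 1 else 0 := by
  rw [extMul, extStructureConstant_eq hn, evalExt_eq hp,
    (isExtJacobianAlgebra_ext n).extMulCoord_zero_left (extS_mul_inv n) hn (extParam_ne_zero _)]
  split_ifs <;> simp

theorem saitoMul_eq_mulCoord (hn : 2 ≤ n) (k i j : Fin (n + 1)) (p : Fin (n + 1) → ℂ) :
    saitoMul (n + 1) k i j p = mulCoord p i j k := by
  rw [saitoMul_eq hn, map_mulCoord]
  simp only [eval_X]

end ExtLaws

end DSaito
end

noncomputable section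
namespace DSaito

open MvPolynomial

variable {n : ℕ}

/-! ### Derivatives of Laurent monomials in s. -/

section LaurentTerms

/-- The function `f(v_1, …, v_N) s^m`. -/
def laurentTerm (f : Params n) (m : ℤ) (q : Fin (n + 1) → ℂ) : ℂ :=
  eval (Fin.init q : Fin n → ℂ) f * q (Fin.last n) ^ m

theorem analyticAt_comp_init {g : (Fin n → ℂ) → ℂ} {p : Fin (n + 1) → ℂ}
    (hg : AnalyticAt ℂ g (Fin.init p : Fin n → ℂ)) :
    AnalyticAt ℂ (fun q : Fin (n + 1) → ℂ => g (Fin.init q : Fin n → ℂ)) p :=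
  analyticAt_comp_coord (t := fun (a : Fin n) (q : Fin (n + 1) → ℂ) => q a.castSucc) hg
    fun _ => analyticAt_coord _ p

theorem pd_comp_init {g : (Fin n → ℂ) → ℂ} {p : Fin (n + 1) → ℂ}
    (hg : AnalyticAt ℂ g (Fin.init p : Fin n → ℂ)) (i : Fin (n + 1)) :
    pd i (fun q : Fin (n + 1) → ℂ => g (Fin.init q : Fin n → ℂ)) p
      = Fin.lastCases (motive := fun _ => ℂ) 0 (fun i => pd i g (Fin.init p : Fin n → ℂ)) i := by
  have h := pd_comp (f := g) (t := fun (a : Fin n) (q : Fin (n + 1) → ℂ) => q a.castSucc) (p := p)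
    hg.differentiableAt (fun _ => (analyticAt_coord _ p).differentiableAt) i
  refine h.trans ?_
  simp only [pd_coord]
  induction i using Fin.lastCases with
  | last => simp [(Fin.castSucc_lt_last _).ne']
  | cast i => simp; rfl

theorem pd_zpow_last {p : Fin (n + 1) → ℂ} (hp : p (Fin.last n) ≠ 0) (m : ℤ) (i : Fin (n + 1)) :
    pd i (fun q => q (Fin.last n) ^ m) p
      = if i = Fin.last n then m * p (Fin.last n) ^ (m - 1) else 0 := by
  have h := (hasDerivAt_zpow m (p (Fin.last n)) (Or.inl hp)).hasFDerivAt.comp p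
    (ContinuousLinearMap.proj (R := ℂ) (φ := fun _ : Fin (n + 1) => ℂ) (Fin.last n)).hasFDerivAt
  have h1 : fderiv ℂ (fun q : Fin (n + 1) → ℂ => q (Fin.last n) ^ m) p = _ := h.fderiv
  rw [pd, h1]
  simp [Pi.single_apply, eq_comm]

theorem analyticAt_laurentTerm (f : Params n) (m : ℤ) {p : Fin (n + 1) → ℂ}
    (hp : p ∈ extManifold n) : AnalyticAt ℂ (laurentTerm f m) p :=
  (analyticAt_comp_init (analyticAt_eval f _)).mul ((analyticAt_coord _ p).zpow hp)

theorem pd_laurentTerm (f : Params n) (m : ℤ) {p : Fin (n + 1) → ℂ}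
    (hp : p ∈ extManifold n) (i : Fin (n + 1)) : pd i (laurentTerm f m) p
      = Fin.lastCases (motive := fun _ => ℂ) (laurentTerm (C (m : ℂ) * f) (m - 1) p)
        (fun i => laurentTerm (pderiv i f) m p) i := by
  have h := pd_mul (analyticAt_comp_init (analyticAt_eval f (Fin.init p))).differentiableAt
    ((analyticAt_coord (Fin.last n) p).zpow (n := m) hp).differentiableAt i
  refine h.trans ?_
  rw [pd_comp_init (analyticAt_eval _ _)]
  have h2 := pd_zpow_last hp m i
  refine (congrArg₂ _ rfl (congrArg₂ _ rfl h2)).trans ?_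
  induction i using Fin.lastCases with
  | last => simp [laurentTerm]; ring
  | cast i => simp [laurentTerm, (Fin.castSucc_lt_last i).ne, pd_eval]

variable {ι : Type*} [Fintype ι]

theorem analyticAt_sum_laurentTerm (f : ι → Params n) (m : ι → ℤ) {p : Fin (n + 1) → ℂ}
    (hp : p ∈ extManifold n) : AnalyticAt ℂ (fun q => ∑ a, laurentTerm (f a) (m a) q) p :=
  Finset.analyticAt_fun_sum _ fun _ _ => analyticAt_laurentTerm _ _ hp

theorem pd_castSucc_sum_laurentTerm (f : ι → Params n) (m : ι → ℤ) {p : Fin (n + 1) → ℂ}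
    (hp : p ∈ extManifold n) (i : Fin n) : pd i.castSucc (fun q => ∑ a, laurentTerm (f a) (m a) q) p
      = ∑ a, laurentTerm (pderiv i (f a)) (m a) p := by
  rw [pd_sum _ fun a _ => (analyticAt_laurentTerm (f a) (m a) hp).differentiableAt]
  exact Finset.sum_congr rfl fun a _ => by rw [pd_laurentTerm _ _ hp, Fin.lastCases_castSucc]

theorem pd_last_sum_laurentTerm (f : ι → Params n) (m : ι → ℤ) {p : Fin (n + 1) → ℂ}
    (hp : p ∈ extManifold n) : pd (Fin.last n) (fun q => ∑ a, laurentTerm (f a) (m a) q) p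
      = ∑ a, laurentTerm (C (m a : ℂ) * f a) (m a - 1) p := by
  rw [pd_sum _ fun a _ => (analyticAt_laurentTerm (f a) (m a) hp).differentiableAt]
  exact Finset.sum_congr rfl fun a _ => by rw [pd_laurentTerm _ _ hp, Fin.lastCases_last]

/-- Functions that agree on `ℂ^N × ℂ^*` have the same derivatives there. -/
theorem pd_congr_extManifold {f g : (Fin (n + 1) → ℂ) → ℂ} (h : ∀ q ∈ extManifold n, f q = g q)
    {p : Fin (n + 1) → ℂ} (hp : p ∈ extManifold n) (i : Fin (n + 1)) : pd i f p = pd i g p := by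
  refine pd_congr ?_ i
  filter_upwards [(isOpen_extManifold n).mem_nhds hp] with q hq using h q hq

theorem evalLaurent_sum (f : ι → Params n) (m : ι → ℤ) {p : Fin (n + 1) → ℂ}
    (hp : p ∈ extManifold n) :
    evalLaurent (∑ a, LaurentPolynomial.C (f a) * LaurentPolynomial.T (m a)) p
      = ∑ a, laurentTerm (f a) (m a) p := by
  have hp' : p (Fin.last n) ≠ 0 := hp
  rw [evalLaurent, dif_pos hp', map_sum]
  refine Finset.sum_congr rfl fun a _ => ?_
  rw [LaurentPolynomial.eval₂_C_mul_T]
  simp [laurentTerm]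

theorem coeff_C_mul_T (f : Params n) (m k : ℤ) :
    (LaurentPolynomial.C f * LaurentPolynomial.T m : LaurentPolynomial (Params n)).coeff k
      = if m = k then f else 0 := by
  classical
  rw [← LaurentPolynomial.single_eq_C_mul_T]
  exact Finsupp.single_apply

end LaurentTerms

/-! ### The open potential and its second derivatives. -/

section OpenPotential

/-- The exponents of `s` in the open potential. -/
def openExponent (n : ℕ) : Fin (n + 1 + 1) → ℤ :=
  Fin.snoc (α := fun _ => ℤ) (Fin.snoc (α := fun _ => ℤ) (fun i : Fin n => 2 * (i : ℕ) + 1) (-1))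
    (2 * n + 1)

/-- The coefficients of the powers of `s` in the open potential. -/
def openCoeff (V : Fin (n + 1) → Params (n + 1)) : Fin (n + 1 + 1) → Params (n + 1) :=
  Fin.snoc (α := fun _ => Params (n + 1)) (Fin.snoc (α := fun _ => Params (n + 1))
    (fun i : Fin n => C (1 / (2 ^ (i : ℕ) * (2 * ((i : ℕ) : ℂ) + 1))) * V i.castSucc)
    (C (1 / 2) * V (Fin.last n) ^ 2)) (C (1 / (2 ^ (n - 1) * (2 * (n : ℂ) + 1) * (2 * n))))

theorem openPotential_eq (V : Fin (n + 1) → Params (n + 1)) :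
    openPotential (n + 1) V = ∑ a, LaurentPolynomial.C (openCoeff V a)
      * LaurentPolynomial.T (openExponent n a) := by
  rw [openPotential, Fin.sum_univ_castSucc (n := n + 1)]
  refine congrArg₂ _ (Finset.sum_congr rfl fun i _ => ?_) ?_
  · induction i using Fin.lastCases with
    | last => simp [openCoeff, openExponent]
    | cast i =>
      rw [if_neg (by have := i.2; simp; omega)]
      simp [openCoeff, openExponent]
  · simp only [openCoeff, openExponent, Fin.snoc_last]
    rw [show n + 1 - 2 = n - 1 by omega]
    refine congrArg₂ _ (congrArg _ (congrArg _ ?_)) (congrArg _ ?_)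
    · push_cast; ring
    · push_cast; ring

theorem openExponent_nonneg (a : Fin (n + 1 + 1)) (h : a ≠ (Fin.last n).castSucc) :
    0 ≤ openExponent n a := by
  induction a using Fin.lastCases with
  | last => simp [openExponent]; omega
  | cast a =>
    induction a using Fin.lastCases with
    | last => exact absurd rfl h
    | cast a => simp [openExponent]; omega

theorem coeff_openPotential_of_lt (V : Fin (n + 1) → Params (n + 1)) (m : ℤ)
    (hm : m < -1) : (openPotential (n + 1) V).coeff m = 0 := by
  rw [openPotential_eq, AddMonoidAlgebra.coeff_sum, Finsupp.finsetSum_apply]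
  refine Finset.sum_eq_zero fun a _ => ?_
  rw [coeff_C_mul_T, if_neg]
  by_cases h : a = (Fin.last n).castSucc
  · rw [h]; simp [openExponent]; omega
  · have := openExponent_nonneg a h; omega

theorem coeff_openPotential_neg_one (V : Fin (n + 1) → Params (n + 1)) :
    (openPotential (n + 1) V).coeff (-1) = C (1 / 2) * V (Fin.last n) ^ 2 := by
  rw [openPotential_eq, AddMonoidAlgebra.coeff_sum, Finsupp.finsetSum_apply,
    Finset.sum_eq_single (Fin.last n).castSucc]
  · rw [coeff_C_mul_T]; simp [openExponent, openCoeff]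
  · intro a _ h
    rw [coeff_C_mul_T, if_neg]
    have := openExponent_nonneg a h; omega
  · simp

/-- The open potential in the coordinates `v`. -/
def openFunction (n : ℕ) (q : Fin (n + 1 + 1) → ℂ) : ℂ :=
  ∑ a, laurentTerm (openCoeff (paramX n) a) (openExponent n a) q

theorem openCoeff_castSucc_castSucc (V : Fin (n + 1) → Params (n + 1)) (i : Fin n) :
    openCoeff V i.castSucc.castSucc
      = C (1 / (2 ^ (i : ℕ) * (2 * ((i : ℕ) : ℂ) + 1))) * V i.castSucc := by simp [openCoeff]

theorem openCoeff_last_castSucc (V : Fin (n + 1) → Params (n + 1)) :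
    openCoeff V (Fin.last n).castSucc = C (1 / 2) * V (Fin.last n) ^ 2 := by simp [openCoeff]

theorem openCoeff_last (V : Fin (n + 1) → Params (n + 1)) : openCoeff V (Fin.last (n + 1))
    = C (1 / (2 ^ (n - 1) * (2 * (n : ℂ) + 1) * (2 * n))) := by simp [openCoeff]

theorem openExponent_castSucc_castSucc (i : Fin n) :
    openExponent n i.castSucc.castSucc = 2 * (i : ℕ) + 1 := by simp [openExponent]

theorem openExponent_last_castSucc : openExponent n (Fin.last n).castSucc = -1 := by
  simp [openExponent]

theorem openExponent_last : openExponent n (Fin.last (n + 1)) = 2 * n + 1 := by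
  simp [openExponent]

theorem pderiv_castSucc_openCoeff (k : Fin n) {a : Fin (n + 1 + 1)}
    (h : a ≠ k.castSucc.castSucc) : pderiv k.castSucc (openCoeff (paramX n) a) = 0 := by
  induction a using Fin.lastCases with
  | last => rw [openCoeff_last, pderiv_C]
  | cast a =>
    induction a using Fin.lastCases with
    | last =>
      rw [openCoeff_last_castSucc, pderiv_C_mul, pderiv_pow,
        pderiv_X_of_ne (Fin.castSucc_lt_last k).ne', mul_zero, mul_zero]
    | cast a =>
      rw [openCoeff_castSucc_castSucc, pderiv_C_mul, pderiv_X_of_ne, mul_zero]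
      exact fun h' => h (congrArg Fin.castSucc h')

theorem pderiv_last_openCoeff {a : Fin (n + 1 + 1)}
    (h : a ≠ (Fin.last n).castSucc) : pderiv (Fin.last n) (openCoeff (paramX n) a) = 0 := by
  induction a using Fin.lastCases with
  | last => rw [openCoeff_last, pderiv_C]
  | cast a =>
    induction a using Fin.lastCases with
    | last => exact absurd rfl h
    | cast a =>
      rw [openCoeff_castSucc_castSucc, pderiv_C_mul, pderiv_X_of_ne (Fin.castSucc_lt_last a).ne,
        mul_zero]

theorem laurentTerm_zero (m : ℤ) (q : Fin (n + 1) → ℂ) : laurentTerm 0 m q = 0 := by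
  simp [laurentTerm]

theorem analyticAt_openFunction {p : Fin (n + 1 + 1) → ℂ} (hp : p ∈ extManifold (n + 1)) :
    AnalyticAt ℂ (openFunction n) p := analyticAt_sum_laurentTerm _ _ hp

theorem pd_castSucc_castSucc_openFunction {p : Fin (n + 1 + 1) → ℂ} (hp : p ∈ extManifold (n + 1))
    (k : Fin n) : pd k.castSucc.castSucc (openFunction n) p
      = laurentTerm (C (1 / (2 ^ (k : ℕ) * (2 * ((k : ℕ) : ℂ) + 1)))) (2 * (k : ℕ) + 1) p := by
  refine (pd_castSucc_sum_laurentTerm _ _ hp _).trans ?_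
  rw [Finset.sum_eq_single k.castSucc.castSucc]
  · rw [openCoeff_castSucc_castSucc, pderiv_C_mul, pderiv_X_self, mul_one,
      openExponent_castSucc_castSucc]
  · intro a _ h
    rw [pderiv_castSucc_openCoeff k h, laurentTerm_zero]
  · simp

theorem pd_last_castSucc_openFunction {p : Fin (n + 1 + 1) → ℂ} (hp : p ∈ extManifold (n + 1)) :
    pd (Fin.last n).castSucc (openFunction n) p = laurentTerm (X (Fin.last n)) (-1) p := by
  refine (pd_castSucc_sum_laurentTerm _ _ hp _).trans ?_
  rw [Finset.sum_eq_single (Fin.last n).castSucc]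
  · rw [openCoeff_last_castSucc, pderiv_C_mul, pderiv_pow, pderiv_X_self,
      openExponent_last_castSucc]
    congr 1
    have := half_add_half (Params (n + 1))
    change C (1 / 2) + C (1 / 2) = (1 : Params (n + 1)) at this
    push_cast
    linear_combination (X (Fin.last n)) * this
  · intro a _ h
    rw [pderiv_last_openCoeff h, laurentTerm_zero]
  · simp

theorem zpow_two_mul_eq {s : ℂ} (i : ℕ) : s ^ (2 * (i : ℤ)) = 2 ^ i * extX s ^ i := by
  have h : s ^ 2 = 2 * extX s := by simp [extX]
  rw [zpow_mul, zpow_natCast, ← mul_pow, ← h]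
  norm_cast

theorem two_pow_mul_ne_zero (i : ℕ) : (2 ^ i * (2 * (i : ℂ) + 1)) ≠ 0 :=
  mul_ne_zero (pow_ne_zero _ two_ne_zero) (by exact_mod_cast Nat.succ_ne_zero (2 * i))

theorem hessian_openFunction_castSucc_castSucc {p : Fin (n + 1 + 1) → ℂ}
    (hp : p ∈ extManifold (n + 1)) (i : Fin (n + 1)) (j : Fin n) :
    pd i.castSucc (pd j.castSucc.castSucc (openFunction n)) p = 0 := by
  rw [pd_congr_extManifold (fun q hq => pd_castSucc_castSucc_openFunction hq j) hp]
  rw [pd_laurentTerm _ _ hp, Fin.lastCases_castSucc, pderiv_C, laurentTerm_zero]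

theorem hessian_openFunction_castSucc_last {p : Fin (n + 1 + 1) → ℂ}
    (hp : p ∈ extManifold (n + 1)) (i : Fin (n + 1)) :
    pd i.castSucc (pd (Fin.last n).castSucc (openFunction n)) p
      = if i = Fin.last n then (p (Fin.last _))⁻¹ else 0 := by
  rw [pd_congr_extManifold (fun q hq => pd_last_castSucc_openFunction hq) hp]
  change pd i.castSucc (laurentTerm _ _) p = _
  rw [pd_laurentTerm _ _ hp, Fin.lastCases_castSucc]
  split_ifs with h
  · rw [h, pderiv_X_self]; simp [laurentTerm]
  · rw [pderiv_X_of_ne (Ne.symm h), laurentTerm_zero]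

/-- The s-derivative of the open potential is Λ at x = s²/2, y = -v_N/s². Its derivative in v_j is
φ_j at this point, the scalar by which φ_j acts on w. -/
theorem hessian_openFunction_last_castSucc {p : Fin (n + 1 + 1) → ℂ}
    (hp : p ∈ extManifold (n + 1)) (j : Fin (n + 1)) :
    pd (Fin.last _) (pd j.castSucc (openFunction n)) p = monomialD (n + 1) (extX (p (Fin.last _)))
      (extY (fun a => p a.castSucc) (p (Fin.last _))⁻¹) j := by
  have hp' : p (Fin.last (n + 1)) ≠ 0 := hp
  induction j using Fin.lastCases with
  | last =>
    rw [pd_congr_extManifold (fun q hq => pd_last_castSucc_openFunction hq) hp]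
    change pd (Fin.last _) (laurentTerm _ _) p = _
    rw [pd_laurentTerm _ _ hp, Fin.lastCases_last, monomialD_last]
    simp only [laurentTerm, map_mul, eval_C, eval_X, extY, Fin.init]
    rw [show (-1 - 1 : ℤ) = -(2 : ℕ) by norm_num, zpow_neg, zpow_natCast, inv_pow]
    push_cast; ring
  | cast j =>
    rw [pd_congr_extManifold (fun q hq => pd_castSucc_castSucc_openFunction hq j) hp]
    change pd (Fin.last _) (laurentTerm _ _) p = _
    rw [pd_laurentTerm _ _ hp, Fin.lastCases_last, monomialD_castSucc]
    simp only [laurentTerm, map_mul, eval_C, add_sub_cancel_right]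
    rw [zpow_two_mul_eq]
    have h1 := two_pow_mul_ne_zero (j : ℕ)
    have h2 := left_ne_zero_of_mul h1
    have h3 := right_ne_zero_of_mul h1
    push_cast
    field_simp

/-- Chain rule for λ(s²/2): dx/ds = s, while y contributes nothing as ∂_yΛ = 0 on the curve. The
result is the coefficient in w² = s ∂_xΛ w. -/
theorem hessian_openFunction_last_last (hn : n ≠ 0) {p : Fin (n + 1 + 1) → ℂ}
    (hp : p ∈ extManifold (n + 1)) :
    pd (Fin.last _) (pd (Fin.last _) (openFunction n)) p = p (Fin.last _)
      * extCrit (fun a => p a.castSucc) (p (Fin.last _)) (p (Fin.last _))⁻¹ := by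
  have hp' : p (Fin.last (n + 1)) ≠ 0 := hp
  rw [pd_congr_extManifold (f := pd (Fin.last _) (openFunction n)) (fun q hq =>
    pd_last_sum_laurentTerm (openCoeff (paramX n)) (openExponent n) hq) hp]
  refine (pd_last_sum_laurentTerm _ _ hp).trans ?_
  set s := p (Fin.last (n + 1)) with hs
  set v : Fin (n + 1) → ℂ := fun a => p a.castSucc with hv
  set x := extX s with hx
  have hx0 : x ≠ 0 := by simp [hx, extX, hp']
  have hxs : s * s = 2 * x := by simp [hx, extX]; ring
  -- After multiplication by x the identity can be tested on `critPoly`, whose coefficients are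
  -- explicit.
  refine mul_right_cancel₀ hx0 ?_
  have hc := congrArg (Polynomial.eval x) (X_mul_divX_critPoly hn v)
  conv_rhs at hc => rw [critPoly]
  simp only [Polynomial.eval_mul, Polynomial.eval_X, Polynomial.eval_add, Polynomial.eval_pow,
    Polynomial.eval_finsetSum, Polynomial.eval_C] at hc
  have hpow : ∀ i : ℕ, s ^ (2 * (i : ℤ) - 1) * x = 2 ^ i * s * x ^ i / 2 := by
    intro i
    have h : s⁻¹ * x = s / 2 := by
      rw [inv_mul_eq_div, div_eq_div_iff hp' two_ne_zero]; linear_combination -hxs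
    rw [zpow_sub_one₀ hp', zpow_two_mul_eq, ← hx]
    linear_combination 2 ^ i * x ^ i * h
  have hterm : ∀ (f : Params (n + 1)) (m : ℤ), laurentTerm (C (m : ℂ) * f) (m - 1) p
      = m * eval v f * s ^ (m - 1) := by
    intro f m
    simp only [laurentTerm, map_mul, eval_C]; rfl
  simp only [hterm]
  rw [Fin.sum_univ_castSucc, Fin.sum_univ_castSucc]
  simp only [openCoeff_castSucc_castSucc, openCoeff_last_castSucc, openCoeff_last,
    openExponent_castSucc_castSucc, openExponent_last_castSucc, openExponent_last, map_mul, eval_C,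
    map_pow, eval_X, add_sub_cancel_right]
  have h1 : ∀ i : Fin n, ((2 * (i : ℕ) : ℤ) : ℂ) * (((2 * (i : ℕ) + 1 : ℤ) : ℂ)
      * (1 / (2 ^ (i : ℕ) * (2 * ((i : ℕ) : ℂ) + 1)) * v i.castSucc)) * s ^ (2 * ((i : ℕ) : ℤ) - 1) * x
      = s * ((i : ℕ) * v i.castSucc * x ^ (i : ℕ)) := by
    intro i
    rw [mul_assoc, hpow]
    have h2 := two_pow_mul_ne_zero (i : ℕ)
    have h3 := left_ne_zero_of_mul h2
    have h4 := right_ne_zero_of_mul h2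
    push_cast
    field_simp
  have h2 : ((2 * n : ℤ) : ℂ) * (((2 * n + 1 : ℤ) : ℂ)
      * (1 / (2 ^ (n - 1) * (2 * (n : ℂ) + 1) * (2 * n)))) * s ^ (2 * (n : ℤ) - 1) * x
      = s * x ^ n := by
    rw [mul_assoc, hpow]
    obtain ⟨m, rfl⟩ : ∃ m, n = m + 1 := ⟨n - 1, by omega⟩
    have h2 := two_pow_mul_ne_zero (m + 1)
    have h3 := right_ne_zero_of_mul h2
    have h4 : ((m + 1 : ℕ) : ℂ) ≠ 0 := by exact_mod_cast Nat.succ_ne_zero m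
    push_cast [Nat.add_sub_cancel] at h3 h4 ⊢
    field_simp
    ring
  have h3 : s ^ (-1 - 1 - 1 : ℤ) = (s⁻¹) ^ 3 := by
    rw [show (-1 - 1 - 1 : ℤ) = -(3 : ℕ) by norm_num, zpow_neg, zpow_natCast, inv_pow]
  have h4 : s * s⁻¹ = 1 := mul_inv_cancel₀ hp'
  rw [add_mul, add_mul, Finset.sum_mul, Finset.sum_congr rfl fun i _ => h1 i, h2, h3, extCrit, extY,
    ← Finset.mul_sum]
  push_cast
  linear_combination (-s) * hc - (v (Fin.last n)) ^ 2 * (s⁻¹) ^ 3 * x * h4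


end OpenPotential

end DSaito
end

noncomputable section
namespace DSaito

open MvPolynomial

variable {n : ℕ}

/-! ### The extended flat F-manifold. -/

section Extension

theorem extCoord_castSucc {N : ℕ} (α : Fin N) :
    extCoord N α.castSucc = fun p => saitoCoord N α (Fin.init p) := by simp [extCoord]

theorem extCoord_last (N : ℕ) : extCoord N (Fin.last N) = fun p => p (Fin.last N) := by
  simp [extCoord]

theorem pd_castSucc_extCoord_castSucc (i α : Fin (n + 1)) :
    pd i.castSucc (extCoord (n + 1) α.castSucc)
      = fun q => pd i (saitoCoord (n + 1) α) (Fin.init q : Fin (n + 1) → ℂ) := by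
  funext q
  rw [extCoord_castSucc, pd_comp_init (analyticAt_saitoCoord _ _), Fin.lastCases_castSucc]

theorem pd_last_extCoord_castSucc (α : Fin (n + 1)) :
    pd (Fin.last _) (extCoord (n + 1) α.castSucc) = fun _ => 0 := by
  funext q
  rw [extCoord_castSucc, pd_comp_init (analyticAt_saitoCoord _ _), Fin.lastCases_last]

theorem pd_extCoord_last {N : ℕ} (i : Fin (N + 1)) :
    pd i (extCoord N (Fin.last N)) = fun _ => if i = Fin.last N then 1 else 0 := by
  funext q
  rw [extCoord_last, pd_coord]

theorem analyticAt_extCoord (α : Fin (n + 1 + 1)) (p : Fin (n + 1 + 1) → ℂ) :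
    AnalyticAt ℂ (extCoord (n + 1) α) p := by
  induction α using Fin.lastCases with
  | last => rw [extCoord_last]; exact analyticAt_coord _ p
  | cast α => rw [extCoord_castSucc]; exact analyticAt_comp_init (analyticAt_saitoCoord _ _)

/-- The Christoffel symbols of the coordinates of the extended manifold. -/
def extChristoffel (p : Fin (n + 1 + 1) → ℂ) (i j k : Fin (n + 1 + 1)) : ℂ :=
  Fin.lastCases (motive := fun _ => ℂ) 0 (fun i => Fin.lastCases (motive := fun _ => ℂ) 0
    (fun j => Fin.lastCases (motive := fun _ => ℂ) 0
      (fun k => eval (Fin.init p : Fin (n + 1) → ℂ) (flatChristoffel n k i j)) k) j) i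

@[simp] theorem extChristoffel_last_left (p : Fin (n + 1 + 1) → ℂ) (j k : Fin (n + 1 + 1)) :
    extChristoffel p (Fin.last _) j k = 0 := by simp [extChristoffel]

@[simp] theorem extChristoffel_last_right (p : Fin (n + 1 + 1) → ℂ) (i k : Fin (n + 1 + 1)) :
    extChristoffel p i (Fin.last _) k = 0 := by
  induction i using Fin.lastCases <;> simp [extChristoffel]

@[simp] theorem extChristoffel_last_up (p : Fin (n + 1 + 1) → ℂ) (i j : Fin (n + 1 + 1)) :
    extChristoffel p i j (Fin.last _) = 0 := by
  induction i using Fin.lastCases <;> induction j using Fin.lastCases <;> simp [extChristoffel]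

@[simp] theorem extChristoffel_castSucc (p : Fin (n + 1 + 1) → ℂ) (i j k : Fin (n + 1)) :
    extChristoffel p i.castSucc j.castSucc k.castSucc
      = eval (Fin.init p : Fin (n + 1) → ℂ) (flatChristoffel n k i j) := by simp [extChristoffel]

theorem extCoord_flat (hn : n ≠ 0) (p : Fin (n + 1 + 1) → ℂ) (α i j : Fin (n + 1 + 1)) :
    pd i (pd j (extCoord (n + 1) α)) p
      = ∑ k, extChristoffel p i j k * pd k (extCoord (n + 1) α) p := by
  rw [Fin.sum_univ_castSucc, extChristoffel_last_up, zero_mul, add_zero]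
  induction α using Fin.lastCases with
  | last =>
    simp only [pd_extCoord_last, pd_const, (Fin.castSucc_lt_last _).ne, if_false, mul_zero,
      Finset.sum_const_zero]
  | cast α =>
    simp only [pd_castSucc_extCoord_castSucc]
    induction j using Fin.lastCases with
    | last => simp [pd_last_extCoord_castSucc, pd_const]
    | cast j =>
      rw [pd_castSucc_extCoord_castSucc,
        pd_comp_init (analyticAt_pd (analyticAt_saitoCoord _ _) _)]
      induction i using Fin.lastCases with
      | last => simp
      | cast i =>
        rw [Fin.lastCases_castSucc, saitoCoord_flat hn]
        simp only [extChristoffel_castSucc]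

theorem init_extCoord (p : Fin (n + 1 + 1) → ℂ) :
    (Fin.init (fun a => extCoord (n + 1) a p) : Fin (n + 1) → ℂ)
      = fun a => saitoCoord (n + 1) a (Fin.init p) := by
  funext a
  simp [Fin.init, extCoord_castSucc]

theorem extCoord_mem {p : Fin (n + 1 + 1) → ℂ} (hp : p ∈ extManifold (n + 1)) :
    (fun a => extCoord (n + 1) a p) ∈ extManifold (n + 1) := by
  change extCoord (n + 1) (Fin.last _) p ≠ 0
  rw [extCoord_last]
  exact hp

theorem analyticAt_evalLaurent_openPotential (V : Fin (n + 1) → Params (n + 1))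
    {τ : Fin (n + 1 + 1) → ℂ} (hτ : τ ∈ extManifold (n + 1)) :
    AnalyticAt ℂ (evalLaurent (openPotential (n + 1) V)) τ := by
  refine (analyticAt_sum_laurentTerm (openCoeff V) (openExponent n) hτ).congr ?_
  filter_upwards [(isOpen_extManifold _).mem_nhds hτ] with q hq
  rw [openPotential_eq, evalLaurent_sum _ _ hq]

theorem eval_openCoeff_invCoord (p : Fin (n + 1) → ℂ) (a : Fin (n + 1 + 1)) :
    eval (fun a => saitoCoord (n + 1) a p) (openCoeff (invCoord n) a)
      = eval p (openCoeff (paramX n) a) := by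
  induction a using Fin.lastCases with
  | last => simp [openCoeff_last]
  | cast a =>
    induction a using Fin.lastCases with
    | last => simp [openCoeff_last_castSucc, eval_invCoord]
    | cast a => simp [openCoeff_castSucc_castSucc, eval_invCoord]

theorem evalLaurent_openPotential_extCoord {p : Fin (n + 1 + 1) → ℂ}
    (hp : p ∈ extManifold (n + 1)) :
    evalLaurent (openPotential (n + 1) (invCoord n)) (fun a => extCoord (n + 1) a p)
      = openFunction n p := by
  rw [openPotential_eq, evalLaurent_sum _ _ (extCoord_mem hp), openFunction]
  simp only [laurentTerm, init_extCoord, eval_openCoeff_invCoord, extCoord_last]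

/-- The covariant Hessian of the open potential. -/
theorem hessian_openFunction (hn : 2 ≤ n) {p : Fin (n + 1 + 1) → ℂ}
    (hp : p ∈ extManifold (n + 1)) (i j : Fin (n + 1 + 1)) :
    pd i (pd j (openFunction n)) p - ∑ k, extChristoffel p i j k * pd k (openFunction n) p
      = extMul (n + 1) (Fin.last _) i j p := by
  have hp' : p (Fin.last (n + 1)) ≠ 0 := hp
  rw [extMul_eq hn hp, Fin.sum_univ_castSucc, extChristoffel_last_up, zero_mul, add_zero]
  induction i using Fin.lastCases with
  | last =>
    simp only [extChristoffel_last_left, zero_mul, Finset.sum_const_zero, sub_zero]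
    induction j using Fin.lastCases with
    | last =>
      rw [hessian_openFunction_last_last (by omega) hp, extMulCoord_last_last, Fin.snoc_last]
    | cast j =>
      rw [hessian_openFunction_last_castSucc hp, extMulCoord_last_castSucc, Fin.snoc_last]
  | cast i =>
    induction j using Fin.lastCases with
    | last =>
      simp only [extChristoffel_last_right, zero_mul, Finset.sum_const_zero, sub_zero]
      rw [pd_comm (analyticAt_openFunction hp), hessian_openFunction_last_castSucc hp,
        extMulCoord_castSucc_last, Fin.snoc_last]
    | cast j =>
      rw [Fin.sum_univ_castSucc, extMulCoord_castSucc_castSucc, Fin.snoc_last]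
      simp only [extChristoffel_castSucc, flatChristoffel_last_up, map_zero, zero_mul, add_zero]
      induction j using Fin.lastCases with
      | last =>
        rw [hessian_openFunction_castSucc_last hp]
        simp only [flatChristoffel_last_right, map_zero, zero_mul, Finset.sum_const_zero, sub_zero]
        induction i using Fin.lastCases with
        | last => simp
        | cast i => simp [(Fin.castSucc_lt_last i).ne]
      | cast j =>
        -- The open potential is affine in v_1, …, v_{N-1}, so the coefficient of w in x^{i+j} must
        -- come from the Christoffel term alone.
        rw [hessian_openFunction_castSucc_castSucc hp, zero_sub]
        induction i using Fin.lastCases with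
        | last => simp
        | cast i =>
          set s := p (Fin.last (n + 1)) with hs
          set v : Fin (n + 1) → ℂ := fun a => p a.castSucc with hv
          have hq : ∀ k : ℕ, eval (Fin.init p : Fin (n + 1) → ℂ)
              ((quotPoly (paramX n) (i + j)).coeff k) = (quotPoly v (i + j)).coeff k := by
            intro k
            rw [← Polynomial.coeff_map, map_quotPoly]
            simp only [eval_X]; rfl
          -- The factor k + 1/2 meets the denominator 2k + 1 of the open potential. What remains is
          -- (s/2) q(x), which equals x q(x)/s at x = s²/2.
          have h1 : ∀ k : Fin n, eval (Fin.init p : Fin (n + 1) → ℂ)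
              (flatChristoffel n k.castSucc i.castSucc j.castSucc)
              * pd k.castSucc.castSucc (openFunction n) p
              = -(s / 2 * ((quotPoly v (i + j)).coeff k * extX s ^ (k : ℕ))) := by
            intro k
            rw [flatChristoffel_castSucc, pd_castSucc_castSucc_openFunction hp, map_neg, map_mul, hq,
              eval_C, laurentTerm, eval_C, ← hs, zpow_add_one₀ hp', zpow_two_mul_eq]
            have h2 := two_pow_mul_ne_zero (k : ℕ)
            have h3 := left_ne_zero_of_mul h2
            have h4 : ((k : ℕ) : ℂ) * 2 + 1 ≠ 0 := by
              rw [mul_comm]; exact right_ne_zero_of_mul h2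
            field_simp
          rw [Finset.sum_congr rfl fun k _ => h1 k, Finset.sum_neg_distrib, neg_neg, ← Finset.mul_sum,
            mulQuot_castSucc_castSucc, Polynomial.eval_mul, Polynomial.eval_X]
          have h5 := aeval_eq_sum_fin (n := n) (p := quotPoly v (i + j))
            (by rw [natDegree_quotPoly]; omega) (extX s)
          rw [Polynomial.coe_aeval_eq_eval] at h5
          simp only [Algebra.algebraMap_self, RingHom.id_apply] at h5
          rw [h5, ← mul_assoc]
          congr 1
          simp only [extX, Algebra.algebraMap_self, RingHom.id_apply]
          field_simp

/-- The vector potential of the extended flat F-manifold. -/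
theorem isVectorPotential_ext (hn : 2 ≤ n) {g : Fin (n + 1) → (Fin (n + 1) → ℂ) → ℂ}
    (hga : ∀ α τ, AnalyticAt ℂ (g α) τ)
    (hg : IsVectorPotential Set.univ (saitoMul (n + 1)) (saitoCoord (n + 1)) g) :
    IsVectorPotential (extManifold (n + 1)) (extMul (n + 1)) (extCoord (n + 1))
      (Fin.snoc (fun (α : Fin (n + 1)) (τ : Fin (n + 1 + 1) → ℂ) => g α (Fin.init τ))
        (evalLaurent (openPotential (n + 1) (invCoord n)))) := by
  constructor
  · rintro α _ ⟨p, hp, rfl⟩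
    induction α using Fin.lastCases with
    | last =>
      rw [Fin.snoc_last]
      exact analyticAt_evalLaurent_openPotential _ (extCoord_mem hp)
    | cast α =>
      rw [Fin.snoc_castSucc]
      exact analyticAt_comp_init (hga α _)
  · intro p hp α i j
    induction α using Fin.lastCases with
    | last =>
      rw [Fin.snoc_last, sum_pd_pd_eq_hessian
        (analyticAt_evalLaurent_openPotential _ (extCoord_mem hp))
        (fun a => analyticAt_extCoord a p) i j (extChristoffel p i j)
        fun a => extCoord_flat (by omega) p a i j]
      -- Off s = 0 the Laurent polynomial in t composed with the coordinates is the open potential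
      -- in v, so their derivatives agree on the open set.
      have h : ∀ k, ∀ q ∈ extManifold (n + 1), pd k (fun q =>
          evalLaurent (openPotential (n + 1) (invCoord n)) fun a => extCoord (n + 1) a q) q
          = pd k (openFunction n) q := fun k q hq =>
        pd_congr_extManifold (fun _ h => evalLaurent_openPotential_extCoord h) hq k
      have h' : ∑ k, extChristoffel p i j k * pd k (fun q =>
          evalLaurent (openPotential (n + 1) (invCoord n)) fun a => extCoord (n + 1) a q) p
          = ∑ k, extChristoffel p i j k * pd k (openFunction n) p :=
        Finset.sum_congr rfl fun k _ => by rw [h k p hp]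
      rw [pd_congr_extManifold (h j) hp, h', hessian_openFunction hn hp]
      simp [pd_extCoord_last]
    | cast α =>
      rw [Fin.snoc_castSucc]
      -- These components are independent of s, so every second derivative involving s vanishes and
      -- the identity reduces to that of the Saito manifold.
      have hpd : ∀ b c : Fin (n + 1 + 1), pd b (pd c
          fun τ : Fin (n + 1 + 1) → ℂ => g α (Fin.init τ)) (fun a => extCoord (n + 1) a p)
          = Fin.lastCases (motive := fun _ => ℂ) 0 (fun b => Fin.lastCases (motive := fun _ => ℂ) 0
            (fun c => pd b (pd c (g α)) fun a => saitoCoord (n + 1) a (Fin.init p)) c) b := by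
        intro b c
        induction c using Fin.lastCases with
        | last =>
          have h : (pd (Fin.last _) fun τ : Fin (n + 1 + 1) → ℂ => g α (Fin.init τ))
              = fun _ => 0 := funext fun q => by rw [pd_comp_init (hga _ _), Fin.lastCases_last]
          rw [h, pd_const]
          induction b using Fin.lastCases <;> simp
        | cast c =>
          have h : (pd c.castSucc fun τ : Fin (n + 1 + 1) → ℂ => g α (Fin.init τ))
              = fun q => pd c (g α) (Fin.init q : Fin (n + 1) → ℂ) :=
            funext fun q => by rw [pd_comp_init (hga _ _), Fin.lastCases_castSucc]
          rw [h, pd_comp_init (analyticAt_pd (hga _ _) _), init_extCoord]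
          simp only [Fin.lastCases_castSucc]
      simp only [hpd]
      simp only [Fin.sum_univ_castSucc (n := n + 1), Fin.lastCases_castSucc, Fin.lastCases_last,
        zero_mul, Finset.sum_const_zero, add_zero, pd_castSucc_extCoord_castSucc,
        pd_last_extCoord_castSucc, mul_zero, extMul_eq hn hp]
      induction i using Fin.lastCases with
      | last =>
        simp only [pd_last_extCoord_castSucc, mul_zero, zero_mul, Finset.sum_const_zero]
        induction j using Fin.lastCases <;> simp
      | cast i =>
        induction j using Fin.lastCases with
        | last => simp [pd_last_extCoord_castSucc]
        | cast j =>
          simp only [pd_castSucc_extCoord_castSucc, extMulCoord_castSucc_castSucc,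
            Fin.snoc_castSucc]
          have h := hg.structure_constants (Fin.init p) trivial α i j
          simp only [saitoMul_eq_mulCoord hn] at h
          exact h

theorem injective_extCoord (n : ℕ) : Function.Injective fun p a => extCoord (n + 1) a p := by
  intro p q h
  have h1 : (Fin.init p : Fin (n + 1) → ℂ) = Fin.init q := by
    refine injective_saitoCoord n ?_
    change (fun a => saitoCoord (n + 1) a (Fin.init p)) = fun a => saitoCoord (n + 1) a (Fin.init q)
    rw [← init_extCoord, ← init_extCoord]
    exact congrArg Fin.init h
  funext a
  induction a using Fin.lastCases with
  | last => simpa [extCoord_last] using congrFun h (Fin.last _)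
  | cast a => exact congrFun h1 a

theorem det_jacobianMatrix_extCoord (p : Fin (n + 1 + 1) → ℂ) :
    (jacobianMatrix (extCoord (n + 1)) p).det ≠ 0 := by
  refine det_jacobianMatrix_ne_zero
    (W := Fin.snoc (α := fun _ => (Fin (n + 1 + 1) → ℂ) → ℂ)
      (fun (k : Fin (n + 1)) τ => eval (Fin.init τ : Fin (n + 1) → ℂ) (invCoord n k))
      fun τ => τ (Fin.last _))
    (fun a => (analyticAt_extCoord a p).differentiableAt) (fun k => ?_) fun q k => ?_
  · induction k using Fin.lastCases with
    | last => rw [Fin.snoc_last]; exact (analyticAt_coord _ _).differentiableAt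
    | cast k =>
      rw [Fin.snoc_castSucc]
      exact (analyticAt_comp_init (analyticAt_eval _ _)).differentiableAt
  · induction k using Fin.lastCases with
    | last => rw [Fin.snoc_last]; exact congrFun (extCoord_last _) q
    | cast k => rw [Fin.snoc_castSucc, init_extCoord, eval_invCoord]; rfl

theorem definesFlatFManifold_ext {N : ℕ} (hN : 3 ≤ N) :
    DefinesFlatFManifold (extManifold N) (extMul N) (extCoord N) := by
  obtain ⟨n, rfl⟩ : ∃ n, N = n + 1 := ⟨N - 1, by omega⟩
  have hn : 2 ≤ n := by omega
  refine ⟨_, _, isFlatFManifold_of_vectorPotential (isOpen_extManifold _)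
    (fun k i j => analyticOnNhd_evalExt _) (fun a p _ => analyticAt_extCoord a p)
    (injective_extCoord n).injOn (fun p _ => det_jacobianMatrix_extCoord p) ?_
    (fun p _ k i j => extMul_comm k i j p) (fun p hp => extMul_assoc hn hp)
    (fun p hp => extMul_zero_left hn hp)
    (isVectorPotential_ext hn (fun α τ => analyticAt_eval _ _)
      (isVectorPotential_flatPotential hn))⟩
  intro p _ a
  induction a using Fin.lastCases with
  | last =>
    rw [pd_extCoord_last, if_neg, if_neg]
    · simp
    · exact (Fin.castSucc_lt_last (0 : Fin (n + 1))).ne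
  | cast a =>
    refine (congrFun (pd_castSucc_extCoord_castSucc 0 a) p).trans ?_
    rw [pd_saitoCoord, pderiv_zero_flatCoord (by omega), Fin.val_castSucc]
    split_ifs <;> simp

end Extension

end DSaito
end

theorem mainTheorem2 (N : ℕ) (hN : 4 ≤ N) :
    -- the classes `[1], [x], …, [x^{N-2}], [y]` and `[1], [x], …, [x^{N-2}], [y], [w]` are bases,
    -- so that the multiplications on the tangent spaces are well defined
    DSaito.IsModuleBasis (DSaito.Params N) (DSaito.saitoBasis N) ∧
    DSaito.IsModuleBasis (DSaito.ExtParams N) (DSaito.extBasis N) ∧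
    -- the Saito Frobenius manifold, and its normalized flat coordinates `t^α = v_α + O(v²)`
    DSaito.DefinesFrobeniusManifold Set.univ (DSaito.saitoMul N) (DSaito.saitoMetric N hN)
      (DSaito.saitoCoord N) ∧
    (∀ (α : Fin N) (m : Fin N →₀ ℕ), m.degree ≤ 1 →
      (DSaito.flatCoord N α).coeff m = (MvPolynomial.X α : DSaito.Params N).coeff m) ∧
    -- the extended flat F-manifold
    DSaito.DefinesFlatFManifold (DSaito.extManifold N) (DSaito.extMul N) (DSaito.extCoord N) ∧
    -- `G` is the matrix of the Saito metric in the flat coordinates, `F` is the Saito potential,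
    -- and `V` is the polynomial coordinate change inverse to `t`
    ∃ (G : Matrix (Fin N) (Fin N) ℂ) (F : DSaito.Params N) (V : Fin N → DSaito.Params N),
      G.det ≠ 0 ∧
      DSaito.IsConstantMatrixOf Set.univ (DSaito.saitoMetric N hN) (DSaito.saitoCoord N) G ∧
      (∀ m ∈ F.support, 3 ≤ m.degree) ∧
      (∀ α β : Fin N, MvPolynomial.pderiv ⟨0, by omega⟩
        (MvPolynomial.pderiv α (MvPolynomial.pderiv β F)) = MvPolynomial.C (G α β)) ∧
      DSaito.IsVectorPotential Set.univ (DSaito.saitoMul N) (DSaito.saitoCoord N)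
        (DSaito.gradientPotential G F) ∧
      (∀ α : Fin N, MvPolynomial.aeval (DSaito.flatCoord N) (V α) = MvPolynomial.X α ∧
        MvPolynomial.aeval V (DSaito.flatCoord N α) = MvPolynomial.X α) ∧
      -- the vector potential of the extended flat F-manifold; its first `N` components do not
      -- depend on `s = t^{N+1}` and form the vector potential of the Saito Frobenius manifold
      DSaito.IsVectorPotential (DSaito.extManifold N) (DSaito.extMul N) (DSaito.extCoord N)
        (Fin.snoc
          (fun (α : Fin N) (τ : Fin (N + 1) → ℂ) => DSaito.gradientPotential G F α (Fin.init τ))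
          (DSaito.evalLaurent (DSaito.openPotential N V))) ∧
      -- `F^o` has a simple pole at `s = 0`
      (∀ m : ℤ, m < -1 → (DSaito.openPotential N V).coeff m = 0) ∧
      (DSaito.openPotential N V).coeff (-1) =
        MvPolynomial.C (1 / 2) * MvPolynomial.X ⟨N - 1, by omega⟩ ^ 2 := by
  obtain ⟨n, rfl⟩ : ∃ n, N = n + 1 := ⟨N - 1, by omega⟩
  have hn : 2 ≤ n := by omega
  obtain ⟨F, hF, hF0, hFg⟩ := DSaito.exists_saitoPotential hn
  have hV : DSaito.IsVectorPotential Set.univ (DSaito.saitoMul (n + 1)) (DSaito.saitoCoord (n + 1))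
      (DSaito.gradientPotential (DSaito.flatMetric n) F) := by
    refine ⟨fun α τ _ => DSaito.analyticAt_gradientPotential _ F α τ, fun p _ α i j => ?_⟩
    rw [(DSaito.isVectorPotential_flatPotential hn).structure_constants p trivial α i j]
    refine Finset.sum_congr rfl fun β _ => Finset.sum_congr rfl fun γ _ => ?_
    rw [← congrFun (hFg α β γ)]
  exact ⟨DSaito.saitoBasis_isModuleBasis (by omega), DSaito.extBasis_isModuleBasis (by omega),
    DSaito.definesFrobeniusManifold_saito hN, DSaito.coeff_flatCoord,
    DSaito.definesFlatFManifold_ext (by omega), DSaito.flatMetric n, F, DSaito.invCoord n,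
    DSaito.det_flatMetric_ne_zero (by omega), DSaito.isConstantMatrixOf_flatMetric hn hN, hF, hF0, hV,
    fun α => ⟨DSaito.aeval_flatCoord_invCoord α, DSaito.aeval_invCoord_flatCoord α⟩,
    DSaito.isVectorPotential_ext hn (DSaito.analyticAt_gradientPotential _ F) hV,
    DSaito.coeff_openPotential_of_lt _, by
      rw [DSaito.coeff_openPotential_neg_one, DSaito.invCoord_last]; rfl⟩
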